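/- **Model.** Let $G$ be a connected undirected graph with vertex set $\{0,\dots,n-1\}$, $m$ edges and diameter $D$, and let $\ell\ge 1$. In the CONGEST model the nodes act in synchronous rounds; in a round every node may send one message of $O(\log n)$ bits over each of its edges. Nodes know their own identity number, those of their neighbours, and $n$, $D$, $\ell$. Requests $k=0,1,2,\dots$ have independent random sources $S_k$ with $\Pr[S_k=v]=\deg(v)/2m$; request $k+1$ is issued when request $k$ has been completed. **Algorithm Continuous-Random-Walks.** Put $\lambda=\lceil 24\sqrt{\ell D}\,(\log n)^3\rceil$ and $\eta_v=\lceil \deg(v)\log n\rceil$. First a BFS tree with root $0$ is built once, with routing labels (flooding, subtree sizes upwards, depth-first labels downwards). *Pre-Processing.* Every node $v$ starts $\eta_v$ independent simple random walks; the $i$-th has length $\lambda+r_i$ with $r_i$ uniform in $\{0,\dots,\lambda-1\}$. Every walk travels as a message, and the label of its destination is sent back to its source on the reverse path. On each directed edge one message crosses per round, the one with the fewest hops so far first. The end is detected by messages sent up the tree and announced by messages sent down the tree. The walks form a table, and each may be used once. *Single-Random-Walk.* A token starts at the source. As long as the length completed is at most $\ell-2\lambda$, the node holding the token picks a uniformly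 random one of its unused short walks and sends the token through the tree to its destination; if it has none, the attempt fails. Then the token makes the remaining steps one by one to uniformly random neighbours, and the node holding it after $\ell$ steps in all is the answer. Pre-Processing is called once at the start. When an attempt fails, this is announced through the tree, Pre-Processing is called again, and the same request is rerun with the new table; otherwise the next request uses the rest of the current table. All random choices are independent. Let $R_k$ be the number of rounds and $M_k$ the number of messages between the completion of request $k-1$ (the very start, if $k=0$) and the completion of request $k$, with everything above counted. **Theorem.** There is an absolute constant $b$ such that for every $c>0$ there are $C>0$ and $n_0$ (depending only on $c$) such that the following holds for all $n\ge n_0$, all such $G$, and all $1\le\ell\le c\,m$. 1. All messages have at most $C\log n$ bits. 2. Almost surely every request $k$ is answered, by exactly one node $A_k$; this node is always the end of a walk of exactly $\ell$ steps in $G$ from $S_k$. Moreover, with $P$ the transition matrix of the simple random walk on $G$, for all $k,s,v$, $$\bigl|\Pr[S_k=s,\ A_k=v]-\Pr[S_k=s]\,P^{\ell}(s,v)\bigr|\le\Pr[S_k=s\text{ and an attempt for request }k\text{ fails}].$$ 3. The amortized message complexity per walk is $O(\ell+D)$: for every $K\ge 0$, $$\mathbb E\Bigl[\sum_{k<K}M_k\Bigr]\le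 C\bigl((\ell+D)K+\lambda m\log n\bigr),$$ where the second term accounts for the initial table, and almost surely $\limsup_{K\to\infty}\frac1K\sum_{k<K}M_k\le C(\ell+D)$. 4. With high probability every single request completes in $\tilde O(\sqrt{\ell D}+D)$ rounds: for every $k$, $$\Pr\bigl[R_k\le C(\log n)^b(\sqrt{\ell D}+D)\bigr]\ge 1-\frac1n .$$ -/

import Mathlib

open MeasureTheory
open scoped ENNReal

/-! # Continuous random walks on a synchronous message-passing network

The network is a graph `G` on the vertex set `Fin n`; the identity number of a node is its value.
An execution is described message by message: a round says, for every ordered pair of adjacent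
nodes, which message (if any) the first one sends to the second one. Rounds and messages are counted
on these transcripts. All random decisions are made with private coins of the nodes, and the
execution is a function of the coins and of the requested sources. -/

namespace ContinuousRandomWalk

noncomputable section

open scoped Classical

/-! ## Messages, rounds, transcripts -/

/-- The messages of the algorithm. Nodes are named by numbers below `n`. -/
inductive Msg : Type
  /-- flooding message that builds the breadth first search (BFS) tree -/
  | explore
  /-- from a node to its parent in the tree: size of the subtree -/
  | size (s : ℕ)
  /-- from a node to its child in the tree: the routing label of the child -/
  | label (a : ℕ)
  /-- short walk on its way: source, index at the source, desired length, steps made so far -/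
  | walk (src idx len cnt : ℕ)
  /-- answer to a short walk on the reverse path: source, index at the source, steps left,
  routing label of the destination -/
  | back (src idx cnt dest : ℕ)
  /-- all nodes of my subtree have got the answers to all their short walks -/
  | done
  /-- the table is complete -/
  | go
  /-- the walk requested at `src` failed, build a new table -/
  | fail (src : ℕ)
  /-- the token: source, routing label of the next connector, length completed there -/
  | token (src dest len : ℕ)
  /-- the token in the final, naive part of the walk: source, length completed so far -/
  | step (src len : ℕ)

/-- Number of bits of a message: four for its kind, and its fields in binary. -/
def Msg.bits : Msg → ℕ
  | .explore => 4
  | .size s => 4 + s.size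
  | .label a => 4 + a.size
  | .walk src idx len cnt => 4 + src.size + idx.size + len.size + cnt.size
  | .back src idx cnt dest => 4 + src.size + idx.size + cnt.size + dest.size
  | .done => 4
  | .go => 4
  | .fail src => 4 + src.size
  | .token src dest len => 4 + src.size + dest.size + len.size
  | .step src len => 4 + src.size + len.size

section Algorithm

variable {n : ℕ} [NeZero n] (G : SimpleGraph (Fin n)) [DecidableRel G.Adj] (ℓ : ℕ)

/-- One synchronous round: at most one message on every edge in each of its two directions. -/
abbrev Round : Type := G.Dart → Option Msg

variable {G} in
/-- Number of messages sent in a round. -/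
def Round.count (r : Round G) : ℕ := (Finset.univ.filter fun d => (r d).isSome).card

variable {G} in
/-- Number of messages of a transcript. The number of its rounds is the length of the list. -/
def messages (t : List (Round G)) : ℕ := (t.map Round.count).sum

/-- A round in which only `x` sends a message, to `y`. -/
def single (x y : Fin n) (msg : Msg) : Round G :=
  fun d => if d.fst = x ∧ d.snd = y then some msg else none

/-! ## Parameters -/

/-- Number `η deg(v) log n` of short walks of `v`, for `η = 1`. -/
def numWalks (v : Fin n) : ℕ := ⌈(G.degree v : ℝ) * Real.log n⌉₊

/-- The length parameter `λ = 24 √(ℓ D) (log n)³` of the short walks. -/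
def lam : ℕ := ⌈24 * √((ℓ : ℝ) * G.diam) * Real.log n ^ 3⌉₊

/-- A short walk of one table: its source and its index at the source. -/
abbrev Short : Type := (v : Fin n) × Fin (numWalks G v)

/-! ## Coins -/

/-- Names of the independent random choices. A *table* is the result of one call of the
pre-processing; tables are numbered by `e`, requests by `k`. -/
inductive CoinIdx : Type
  /-- the source of request `k` -/
  | src (k : ℕ)
  /-- the random part of the length of short walk `w` -/
  | len (e : ℕ) (w : Short G)
  /-- choice of node `x` for the short walk `w` if this is at `x` after `t` steps -/
  | hop (e : ℕ) (w : Short G) (t : ℕ) (x : Fin n)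
  /-- the random order in which `x` takes its short walks out of table `e` -/
  | pick (e : ℕ) (x : Fin n)
  /-- choice of node `x` for the `t`-th naive step of the walk for request `k` -/
  | step (e k t : ℕ) (x : Fin n)

/-- The possible next nodes of a walk that is at `x`: the neighbours of `x` (and `x` itself if there
is none, which does not happen in a connected graph with at least two nodes). -/
def Next (x : Fin n) : Type := {y : Fin n // G.Adj x y ∨ (y = x ∧ ∀ z, ¬ G.Adj x z)}

instance (x : Fin n) : Fintype (Next G x) := by unfold Next; infer_instance

instance (x : Fin n) : Nonempty (Next G x) := by
  by_cases h : ∃ z, G.Adj x z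
  · exact ⟨⟨h.choose, Or.inl h.choose_spec⟩⟩
  · exact ⟨⟨x, Or.inr ⟨rfl, fun z hz => h ⟨z, hz⟩⟩⟩⟩

/-- The range of a random choice. -/
def CoinType : CoinIdx G → Type
  | .src _ => Fin n
  | .len _ _ => Fin (lam G ℓ - 1 + 1)
  | .hop _ _ _ x => Next G x
  | .pick _ x => Equiv.Perm (Fin (numWalks G x))
  | .step _ _ _ x => Next G x

instance (i : CoinIdx G) : MeasurableSpace (CoinType G ℓ i) := ⊤

/-- Sources are drawn with probability proportional to the degree. -/
def sourceLaw : PMF (Fin n) :=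
  if h : ∑' v, (G.degree v : ℝ≥0∞) = 0 then PMF.pure 0
  else PMF.normalize (fun v => (G.degree v : ℝ≥0∞)) h
    (by rw [tsum_fintype]; exact ENNReal.sum_ne_top.2 fun v _ => ENNReal.natCast_ne_top _)

/-- All other choices are uniform: neighbours, the number `r` in `[0, λ - 1]` that is added to `λ`,
and the order of the short walks of a node. -/
def coinLaw : (i : CoinIdx G) → PMF (CoinType G ℓ i)
  | .src _ => sourceLaw G
  | .len _ _ => PMF.uniformOfFintype (Fin (lam G ℓ - 1 + 1))
  | .hop _ _ _ x => PMF.uniformOfFintype (Next G x)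
  | .pick _ x => PMF.uniformOfFintype (Equiv.Perm (Fin (numWalks G x)))
  | .step _ _ _ x => PMF.uniformOfFintype (Next G x)

/-- An outcome of all random choices. -/
abbrev Coins : Type := (i : CoinIdx G) → CoinType G ℓ i

/-- The random choices are independent. -/
def coinMeasure : Measure (Coins G ℓ) :=
  Measure.infinitePi fun i => (coinLaw G ℓ i).toMeasure

/-! ## The BFS tree, built once

The root is node `0`. A node at depth `t` is first reached by the flooding in the rounds of the
nodes at depth `t - 1`, and takes the sender with the least identity number as its parent. -/

def depth (v : Fin n) : ℕ := G.dist 0 v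

def parent (v : Fin n) : Fin n :=
  if h : (Finset.univ.filter fun w => G.Adj v w ∧ depth G w + 1 = depth G v).Nonempty
  then Finset.min' _ h else v

/-- The nodes of the subtree with root `v`, including `v`. -/
def subtree (v : Fin n) : Finset (Fin n) :=
  Finset.univ.filter fun w => ∃ j : ℕ, (parent G)^[j] w = v

/-- The position of `v` in the depth first order of the tree. The labels of the nodes of
`subtree G v` are the `(subtree G v).card` consecutive numbers that start with `label G v`; hence a
node that knows its own label and the labels and subtree sizes of its children can route a message
by the label of its destination. -/
def label (v : Fin n) : ℕ :=
  ∑ j ∈ Finset.range (depth G v),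
    (1 + ∑ y ∈ Finset.univ.filter (fun y => y ≠ 0 ∧ parent G y = parent G ((parent G)^[j] v) ∧
      y < (parent G)^[j] v), (subtree G y).card)

/-- A wave of messages from the root to the leaves. -/
def downWave (msg : Fin n → Msg) : List (Round G) :=
  (List.range G.diam).map fun t d =>
    if d.fst = parent G d.snd ∧ depth G d.fst = t then some (msg d.snd) else none

/-- Construction of the tree: flooding, then subtree sizes from the leaves to the root, then labels
from the root to the leaves. -/
def setup : List (Round G) :=
  ((List.range (G.diam + 1)).map fun t d =>
    if depth G d.fst = t then some .explore else none) ++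
  ((List.range G.diam).map fun t d =>
    if d.snd = parent G d.fst ∧ depth G d.fst = G.diam - t then
      some (.size (subtree G d.fst).card) else none) ++
  downWave G fun y => .label (label G y)

/-- The node to which `x` hands over a message for `y`: if `y` lies below `x`, the child of `x` above
`y`, and otherwise the parent of `x`. -/
def hop (y x : Fin n) : Fin n :=
  if x = y then x
  else if y ∈ subtree G x then (parent G)^[depth G y - depth G x - 1] y
  else parent G x

/-- Transport of the message `msg` from `x` to `y` in the tree, one edge per round. -/
def route (x y : Fin n) (msg : Msg) : List (Round G) :=
  (List.range (sInf {j : ℕ | (hop G y)^[j] x = y})).map fun j =>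
    single G ((hop G y)^[j] x) ((hop G y)^[j + 1] x) msg

/-! ## Pre-processing

Every short walk makes its steps, and then an answer travels back on the reverse path to tell the
source the label of the destination. On every directed edge, the message with the fewest hops so far
goes first, one message per round. A node tells its parent that it is done as soon as all its short
walks have been answered, all its children have told it that they are done, and the edge to the
parent is free. -/

variable {G ℓ} (ω : Coins G ℓ) (e : ℕ)

def sourceCoin (k : ℕ) : Fin n := ω (.src k)

def lenCoin (w : Short G) : Fin (lam G ℓ - 1 + 1) := ω (.len e w)

def hopCoin (w : Short G) (t : ℕ) (x : Fin n) : Next G x := ω (.hop e w t x)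

def pickCoin (x : Fin n) : Equiv.Perm (Fin (numWalks G x)) := ω (.pick e x)

def stepCoin (k t : ℕ) (x : Fin n) : Next G x := ω (.step e k t x)

/-- Position of a short walk of table `e` after `t` steps. -/
def walkPos (w : Short G) : ℕ → Fin n
  | 0 => w.1
  | t + 1 => (hopCoin ω e w t (walkPos w t)).1

/-- Desired length `λ + r` of a short walk, with `r` in `[0, λ - 1]`. -/
def walkLen (w : Short G) : ℕ :=
  lam G ℓ + (lenCoin ω e w : ℕ)

def walkEnd (w : Short G) : Fin n := walkPos ω e w (walkLen ω e w)

/-- Where a short walk, or the answer to it, is after `h` of its `2 * walkLen` hops. -/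
def trip (w : Short G) (h : ℕ) : Fin n :=
  if h ≤ walkLen ω e w then walkPos ω e w h else walkPos ω e w (2 * walkLen ω e w - h)

/-- The message that stands for a short walk that has made `h` hops, at its next hop. -/
def tripMsg (w : Short G) (h : ℕ) : Msg :=
  if h < walkLen ω e w then .walk w.1 w.2 (walkLen ω e w) h
  else .back w.1 w.2 (2 * walkLen ω e w - h) (label G (walkEnd ω e w))

variable (G) in
/-- State of the pre-processing: the number of hops of every short walk, and the nodes that have
told their parents that they are done. -/
structure PreState where
  hops : Short G → ℕ
  reported : Finset (Fin n)

/-- In state `st`, the short walk `w` waits for the directed edge `d`. -/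
def Waits (st : PreState G) (w : Short G) (d : G.Dart) : Prop :=
  st.hops w < 2 * walkLen ω e w ∧
    trip ω e w (st.hops w) = d.fst ∧ trip ω e w (st.hops w + 1) = d.snd

/-- `w'` has priority over `w`: fewer hops so far, ties being broken by source and index. -/
def Before (st : PreState G) (w' w : Short G) : Prop :=
  st.hops w' < st.hops w ∨ (st.hops w' = st.hops w ∧
    (w'.1 < w.1 ∨ (w'.1 = w.1 ∧ (w'.2 : ℕ) < (w.2 : ℕ))))

/-- In state `st`, the short walk `w` crosses the directed edge `d`. -/
def Crosses (st : PreState G) (w : Short G) (d : G.Dart) : Prop :=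
  Waits ω e st w d ∧ ∀ w', Waits ω e st w' d → ¬ Before st w' w

/-- All short walks of `v` have been answered and all children of `v` are done. -/
def Ready (st : PreState G) (v : Fin n) : Prop :=
  (∀ i : Fin (numWalks G v), st.hops ⟨v, i⟩ = 2 * walkLen ω e ⟨v, i⟩) ∧
    ∀ y, y ≠ 0 → parent G y = v → y ∈ st.reported

/-- On the edge `d` from a node to its parent, the message `done` is sent. -/
def Reports (st : PreState G) (d : G.Dart) : Prop :=
  d.snd = parent G d.fst ∧ d.fst ∉ st.reported ∧ Ready ω e st d.fst ∧ ∀ w, ¬ Crosses ω e st w d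

/-- The messages of the round that begins in state `st`. -/
def preRound (st : PreState G) : Round G := fun d =>
  if h : ∃ w, Crosses ω e st w d then some (tripMsg ω e h.choose (st.hops h.choose))
  else if Reports ω e st d then some .done
  else none

/-- The state after the round that begins in state `st`. -/
def preNext (st : PreState G) : PreState G where
  hops w := if ∃ d, Crosses ω e st w d then st.hops w + 1 else st.hops w
  reported := st.reported ∪ Finset.univ.filter fun v => ∃ d : G.Dart, d.fst = v ∧ Reports ω e st d

def preState (t : ℕ) : PreState G := (preNext ω e)^[t] ⟨fun _ => 0, ∅⟩

/-- The pre-processing that computes table `e`. It ends when the root knows that all short walks have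
been answered, and the root then tells all nodes. -/
def preProcessing : List (Round G) :=
  ((List.range (sInf {t : ℕ | Ready ω e (preState ω e t) 0})).map fun t =>
    preRound ω e (preState ω e t)) ++
  downWave G fun _ => .go

/-! ## A single random walk -/

variable (G) in
/-- State of a walk of the token: its position, the length completed, the number of short walks that
each node has used up so far, whether the walk failed, and the rounds so far. -/
structure TokenState where
  pos : Fin n
  len : ℕ
  used : Fin n → ℕ
  failed : Bool
  log : List (Round G)

/-- One pass of the loop that stitches short walks of table `e`. The loop is left when the length
completed exceeds `ℓ - 2 λ`, and also when the node that holds the token has no unused short walk;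
otherwise this node takes a uniformly random one of its unused short walks (the next one in its
random order) and sends the token to its destination. -/
def stitch (s : Fin n) (st : TokenState G) : TokenState G :=
  if st.failed = true ∨ ℓ < st.len + 2 * lam G ℓ then st
  else if h : st.used st.pos < numWalks G st.pos then
    let w : Short G := ⟨st.pos, pickCoin ω e st.pos ⟨st.used st.pos, h⟩⟩
    { pos := walkEnd ω e w
      len := st.len + walkLen ω e w
      used := Function.update st.used st.pos (st.used st.pos + 1)
      failed := false
      log := st.log ++ route G st.pos (walkEnd ω e w)
        (.token s (label G (walkEnd ω e w)) (st.len + walkLen ω e w)) }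
  else { st with failed := true }

/-- The naive walk from `x` with the choices for request `k`. -/
def naivePos (k : ℕ) (x : Fin n) : ℕ → Fin n
  | 0 => x
  | t + 1 => (stepCoin ω e k t (naivePos k x t)).1

/-! ## Continuous random walks -/

/-- The source of request `k`. -/
def source (k : ℕ) : Fin n := sourceCoin ω k

/-- State of the algorithm before an attempt to perform a walk: the number of the current request,
the number of the current table, and the number of its short walks that each node has used up. -/
structure RunState (n : ℕ) where
  req : ℕ
  table : ℕ
  used : Fin n → ℕ

/-- The stitching part of the attempt that begins in state `st`. Every pass of the loop that does not
leave it adds at least `λ ≥ 1` to the length completed, so that `ℓ` passes are enough. -/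
def stitched (st : RunState n) : TokenState G :=
  (stitch ω st.table (source ω st.req))^[ℓ] ⟨source ω st.req, 0, st.used, false, []⟩

/-- The attempt that begins in state `st` gets stuck. -/
def Fails (st : RunState n) : Prop := (stitched ω st).failed = true

/-- The node that holds the token at the end of a successful attempt. -/
def endpoint (st : RunState n) : Fin n :=
  naivePos ω st.table st.req (stitched ω st).pos (ℓ - (stitched ω st).len)

/-- The rounds of the final, naive part of a successful attempt. -/
def naiveRounds (st : RunState n) : List (Round G) :=
  (List.range (ℓ - (stitched ω st).len)).map fun t =>
    single G (naivePos ω st.table st.req (stitched ω st).pos t)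
      (naivePos ω st.table st.req (stitched ω st).pos (t + 1))
      (.step (source ω st.req) ((stitched ω st).len + t))

/-- The root, and then all nodes, learn that the attempt failed. -/
def failRounds (st : RunState n) : List (Round G) :=
  ((List.range (depth G (stitched ω st).pos)).map fun j =>
    single G ((parent G)^[j] (stitched ω st).pos) ((parent G)^[j + 1] (stitched ω st).pos)
      (.fail (source ω st.req))) ++
  downWave G fun _ => .fail (source ω st.req)

/-- All rounds of the attempt that begins in state `st`, including, if it fails, those of the
pre-processing that is then called. -/
def attemptRounds (st : RunState n) : List (Round G) :=
  (stitched ω st).log ++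
    if Fails ω st then failRounds ω st ++ preProcessing ω (st.table + 1) else naiveRounds ω st

/-- After a success the next request is served with the same table; after a failure the same request
is tried again with a new table. -/
def runNext (st : RunState n) : RunState n :=
  if Fails ω st then ⟨st.req, st.table + 1, fun _ => 0⟩
  else ⟨st.req + 1, st.table, (stitched ω st).used⟩

/-- The state before attempt `a`. -/
def run (a : ℕ) : RunState n := (runNext ω)^[a] ⟨0, 0, fun _ => 0⟩

/-- The rounds before the first attempt. -/
def initialRounds : List (Round G) := setup G ++ preProcessing ω 0

/-- Request `k` is answered, with the node `v`. -/
def Answers (k : ℕ) (v : Fin n) : Prop :=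
  ∃ a, (run ω a).req = k ∧ ¬ Fails ω (run ω a) ∧ endpoint ω (run ω a) = v

/-- Some attempt to answer request `k` fails, so that a new table is built. -/
def Rebuilds (k : ℕ) : Prop := ∃ a, (run ω a).req = k ∧ Fails ω (run ω a)

/-- Number of rounds from the completion of request `k - 1` (from the start, if `k = 0`) to the
completion of request `k`; it is `∞` if request `k` is never completed. -/
def requestRounds (k : ℕ) : ℝ≥0∞ :=
  (if k = 0 then ((initialRounds ω).length : ℝ≥0∞) else 0) +
    ∑' a, if (run ω a).req = k then ((attemptRounds ω (run ω a)).length : ℝ≥0∞) else 0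

/-- Number of messages from the completion of request `k - 1` (from the start, if `k = 0`) to the
completion of request `k`. -/
def requestMessages (k : ℕ) : ℝ≥0∞ :=
  (if k = 0 then (messages (initialRounds ω) : ℝ≥0∞) else 0) +
    ∑' a, if (run ω a).req = k then (messages (attemptRounds ω (run ω a)) : ℝ≥0∞) else 0

/-- Number of messages until the first `K` requests have been completed. -/
def totalMessages (K : ℕ) : ℝ≥0∞ := ∑ k ∈ Finset.range K, requestMessages ω k

/-- A round occurs in the execution. -/
def Occurs (r : Round G) : Prop :=
  r ∈ initialRounds ω ∨ ∃ a, r ∈ attemptRounds ω (run ω a)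

variable (G) in
/-- Transition matrix of the simple random walk. -/
def transition : Matrix (Fin n) (Fin n) ℝ :=
  Matrix.of fun u v => if G.Adj u v then 1 / (G.degree u : ℝ) else 0

end Algorithm

end

end ContinuousRandomWalk

/-!
The randomness of the execution is one point `ω` of a product space with countably many
independent coins. The proof follows which coins have been looked at. An event is *local* to a set
of coins if it is measurable and decided by them (`IsLocal`); events local to disjoint sets are
independent. The set `revealed k e U` holds the coins that can have influenced the execution while
it serves requests with table `e` and has used up the short walks in `U`. The history before an
attempt is local to such a set (`RunLocal.inter_iterate`), and the next short walk is not in it.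
Hence, given the history, the token is a Markov chain with the kernel `tokKernel`
(`IsLocal.setLIntegral_tokStep_iterate`). The law of the answer and the life of a table are
governed by a martingale and a supermartingale of this kernel.

*Law of the answer.* The probability that an exact walk from the position of the token, with the
number of steps that remain, ends at `v` is a martingale of the stitching loop
(`tokKernel_transition`). So if the token is always continued after the first attempt for a
request, even from a failed state, its end has the law `P ^ ℓ`. The answer differs from this end
only if that first attempt fails (`answers_law`).

*Life of a table.* A walk of `ℓ` steps visits `v` at most `deg v · O(√ℓ + ℓ / m)` times in
expectation, from any start (`visits_le`): the energy of the Green function is bounded by its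
maximum, so by Cauchy–Schwarz along a shortest path it stays large on a large ball, but its total
mass is `ℓ + 1`. The lengths of the short walks are uniform on an interval of length `λ`, so only
a fraction `1 / λ` of these visits are ends of short walks, and `λ` is so large that this number
is at most `deg v / kap`. Therefore the potential `tokPot`, the sum over `v` of
`exp (4 (used v / deg v - log n)) (1 + kap · load)`, where `load` bounds the visits to come
divided by `deg v`, is a supermartingale of the loop (`tokKernel_tokPot_le`). It is at least `1`
after a failure and of order `n⁻³` for a new table. From one request to the next it grows only by
the factor `growth`, as the sources are stationary. So with high probability a new table survives
`lifetime` many requests, a number of order `λ m log n / (ℓ + D)`, whatever happened before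
(`Regime.measure_failsWithin_le`). Splitting off one table after the other
(`measure_inter_reaches_le`) shows that the number of tables for `K` requests is
`O(K / lifetime + 1)` in expectation and, by Borel–Cantelli, almost surely in the long run
(`tableBounds`); in particular all requests are answered.

*Messages.* A table costs `O(λ m log n)` messages, as each message of the pre-processing moves a
walk by one hop or is the only report of a node (`sum_count_preRound_le`). Divided by `lifetime`
this is `O(ℓ + D)` for each request. Apart from that, an attempt costs at most `O(ℓ + D)`
messages.

*Rounds.* As every node starts walks in proportion to its degree, the number of walks that cross a
directed edge at their `h`-th hop has expectation at most `log n + 1`, and is `O(log n)` for all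
edges and all `h` with high probability, by a Chernoff bound (`measure_card_crossers_le`). Walks
with fewer hops go first, so by induction on `h` all walks have made `h` hops after `O(h log n)`
rounds (`min_le_hops`). A request that takes longer than one attempt, one new table and a second
attempt, all of them fast, meets a new table that is slow or fails at once, which has probability
at most `1 / n`.
-/

namespace ContinuousRandomWalk
noncomputable section
open scoped Classical
set_option linter.unusedSectionVars false

/-! ### Events that depend on a set of coordinates of a product space -/

section Local

variable {ι : Type*} {X : ι → Type*} [∀ i, MeasurableSpace (X i)]

/-- The measurable event `A` of a product space is decided by the coordinates in `S`. -/
structure IsLocal (S : Set ι) (A : Set (∀ i, X i)) : Prop where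
  meas : MeasurableSet A
  dep : ∀ ⦃x y⦄, (∀ i ∈ S, x i = y i) → x ∈ A → y ∈ A

namespace IsLocal

variable {S T : Set ι} {A B : Set (∀ i, X i)}

theorem mono (h : IsLocal S A) (hST : S ⊆ T) : IsLocal T A :=
  ⟨h.meas, fun _ _ hxy => h.dep fun i hi => hxy i (hST hi)⟩

theorem inter (hA : IsLocal S A) (hB : IsLocal S B) : IsLocal S (A ∩ B) :=
  ⟨hA.meas.inter hB.meas, fun _ _ h hx => ⟨hA.dep h hx.1, hB.dep h hx.2⟩⟩

theorem univ : IsLocal S (Set.univ : Set (∀ i, X i)) := ⟨.univ, fun _ _ _ _ => trivial⟩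

theorem compl (hA : IsLocal S A) : IsLocal S Aᶜ :=
  ⟨hA.meas.compl, fun _ _ h hx hy => hx (hA.dep (fun i hi => (h i hi).symm) hy)⟩

theorem iUnion {κ : Type*} [Countable κ] {A : κ → Set (∀ i, X i)} (h : ∀ k, IsLocal S (A k)) :
    IsLocal S (⋃ k, A k) :=
  ⟨.iUnion fun k => (h k).meas, fun _ _ hxy hx => by
    obtain ⟨k, hk⟩ := Set.mem_iUnion.1 hx
    exact Set.mem_iUnion.2 ⟨k, (h k).dep hxy hk⟩⟩

theorem eval (i : ι) (c : X i) [MeasurableSingletonClass (X i)] :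
    IsLocal {i} {ω : ∀ i, X i | ω i = c} :=
  ⟨measurable_pi_apply i (measurableSet_singleton c), fun x y h hx => by
    have := h i rfl
    simp only [Set.mem_ofPred_eq] at hx ⊢
    rw [← this, hx]⟩

end IsLocal

/-- A function that depends on the coordinates in `S` factors through them: the other coordinates
can be frozen at any value. -/
theorem measurable_iSup_comap_of_dependsOn {β : Type*} [MeasurableSpace β] {S : Set ι}
    {f : (∀ i, X i) → β} (hf : Measurable f) (h : DependsOn f S) :
    Measurable[⨆ i ∈ S, MeasurableSpace.comap (fun ω : ∀ i, X i => ω i) inferInstance] f := by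
  rcases isEmpty_or_nonempty (∀ i, X i) with hX | ⟨⟨x₀⟩⟩
  · exact @measurable_of_empty _ _ (_) _ hX f
  · have hg : f = f ∘ fun ω i => if i ∈ S then ω i else x₀ i := by
      funext ω
      exact h fun i hi => by simp [hi]
    rw [hg]
    refine hf.comp (@measurable_pi_iff _ _ _ (_) _ _ |>.2 fun i => ?_)
    by_cases hi : i ∈ S
    · simp only [hi, if_true]
      exact (comap_measurable _).mono (le_iSup₂ (f := fun i (_ : i ∈ S) =>
        MeasurableSpace.comap (fun ω : ∀ i, X i => ω i) inferInstance) i hi) le_rfl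
    · simp only [hi, if_false]
      exact @measurable_const _ _ _ (_) _

variable (μ : ∀ i, Measure (X i)) [∀ i, IsProbabilityMeasure (μ i)]

/-- Functions of disjoint sets of coordinates are independent under a product measure. -/
theorem lintegral_mul_of_dependsOn {S T : Set ι} (hST : Disjoint S T) {f g : (∀ i, X i) → ℝ≥0∞}
    (hf : Measurable f) (hg : Measurable g) (hfS : DependsOn f S) (hgT : DependsOn g T) :
    ∫⁻ ω, f ω * g ω ∂(Measure.infinitePi μ) =
      (∫⁻ ω, f ω ∂(Measure.infinitePi μ)) * ∫⁻ ω, g ω ∂(Measure.infinitePi μ) := by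
  have hle : ∀ i, MeasurableSpace.comap (fun ω : ∀ i, X i => ω i) inferInstance ≤
      (inferInstance : MeasurableSpace (∀ i, X i)) := fun i => (measurable_pi_apply i).comap_le
  have hind := ProbabilityTheory.indep_iSup_of_disjoint hle
    (ProbabilityTheory.iIndepFun_infinitePi (P := μ) (X := fun i x => x)
      fun i => measurable_id).iIndep hST
  exact ProbabilityTheory.lintegral_mul_eq_lintegral_mul_lintegral_of_independent_measurableSpace
    (iSup₂_le fun i _ => hle i) (iSup₂_le fun i _ => hle i) hind
    (measurable_iSup_comap_of_dependsOn hf hfS) (measurable_iSup_comap_of_dependsOn hg hgT)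

theorem IsLocal.dependsOn_indicator {S : Set ι} {A : Set (∀ i, X i)} (h : IsLocal S A) :
    DependsOn (A.indicator (1 : (∀ i, X i) → ℝ≥0∞)) S := by
  intro x y hxy
  have : x ∈ A ↔ y ∈ A := ⟨h.dep hxy, h.dep fun i hi => (hxy i hi).symm⟩
  simp only [Set.indicator, this, Pi.one_apply]

theorem IsLocal.measure_inter {S T : Set ι} {A B : Set (∀ i, X i)} (hA : IsLocal S A)
    (hB : IsLocal T B) (hST : Disjoint S T) :
    Measure.infinitePi μ (A ∩ B) = Measure.infinitePi μ A * Measure.infinitePi μ B := by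
  have := lintegral_mul_of_dependsOn μ hST (measurable_one.indicator hA.meas)
    (measurable_one.indicator hB.meas) hA.dependsOn_indicator hB.dependsOn_indicator
  rw [lintegral_indicator_one hA.meas, lintegral_indicator_one hB.meas] at this
  rw [← this, ← lintegral_indicator_one (hA.meas.inter hB.meas), Set.inter_indicator_one]
  rfl

theorem IsLocal.measure_inter_eval {S : Set ι} {A : Set (∀ i, X i)} (hA : IsLocal S A) {i : ι}
    [MeasurableSingletonClass (X i)] (hi : i ∉ S) (c : X i) :
    Measure.infinitePi μ (A ∩ {ω | ω i = c}) = Measure.infinitePi μ A * μ i {c} := by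
  rw [hA.measure_inter μ (IsLocal.eval i c) (Set.disjoint_singleton_right.2 hi)]
  congr 1
  rw [← Measure.infinitePi_map_eval μ i,
    Measure.map_apply (measurable_pi_apply i) (measurableSet_singleton c)]
  rfl

end Local

/-! ### Functions with countably many values -/

section Fibers

variable {Ω α : Type*} [MeasurableSpace Ω] [Countable α] (μ : Measure Ω)

/-- All fibers of `f` are measurable: measurability of a function with countably many values. -/
def MeasFibers {Ω β : Type*} [MeasurableSpace Ω] (f : Ω → β) : Prop :=
  ∀ b, MeasurableSet (f ⁻¹' {b})

theorem setLIntegral_eq_tsum_fiber {A : Set Ω} (hA : MeasurableSet A) {f : Ω → α}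
    (hf : MeasFibers f) (Ψ : Ω → ℝ≥0∞) :
    ∫⁻ ω in A, Ψ ω ∂μ = ∑' t, ∫⁻ ω in A ∩ f ⁻¹' {t}, Ψ ω ∂μ := by
  rw [← lintegral_iUnion (fun t => hA.inter (hf t))]
  · congr 2
    ext ω
    simp
  · intro t t' htt'
    rw [Function.onFun, Set.disjoint_left]
    rintro ω ⟨_, h⟩ ⟨_, h'⟩
    exact htt' (h.symm.trans h')

theorem measure_eq_tsum_fiber {A : Set Ω} (hA : MeasurableSet A) {f : Ω → α}
    (hf : MeasFibers f) :
    μ A = ∑' t, μ (A ∩ f ⁻¹' {t}) := by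
  have := setLIntegral_eq_tsum_fiber μ hA hf 1
  simpa using this

theorem measure_le_tsum_fiber (A : Set Ω) (f : Ω → α) :
    μ A ≤ ∑' t, μ (A ∩ f ⁻¹' {t}) := by
  refine (measure_mono fun ω hω => ?_).trans (measure_iUnion_le _)
  exact Set.mem_iUnion.2 ⟨f ω, hω, rfl⟩

theorem measFibers_const {β : Type*} (b : β) : MeasFibers fun _ : Ω => b := by
  intro b'
  by_cases h : b = b'
  · simp [h]
  · have : (fun _ : Ω => b) ⁻¹' {b'} = ∅ := by ext; simp [h]
    rw [this]
    exact .empty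

/-- If `f` has countably many values and measurable fibers, then so does `ω ↦ g (f ω) ω`, as soon as
every `g t` has measurable fibers. -/
theorem MeasFibers.bind {β : Type*} {f : Ω → α} (hf : MeasFibers f) {g : α → Ω → β}
    (hg : ∀ t, MeasFibers (g t)) : MeasFibers fun ω => g (f ω) ω := by
  intro b
  have : (fun ω => g (f ω) ω) ⁻¹' {b} = ⋃ t, f ⁻¹' {t} ∩ g t ⁻¹' {b} := by
    ext ω
    simp
  rw [this]
  exact .iUnion fun t => (hf t).inter (hg t b)

theorem MeasFibers.map {β : Type*} {f : Ω → α} (hf : MeasFibers f) (g : α → β) :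
    MeasFibers fun ω => g (f ω) :=
  hf.bind (g := fun t _ => g t) fun _ => measFibers_const _

theorem MeasFibers.setOf {f : Ω → α} (hf : MeasFibers f) (p : α → Prop) :
    MeasurableSet {ω | p (f ω)} := by
  have := hf.map p True
  convert this using 1
  ext ω
  simp

end Fibers

/-! ### Laws of the coins -/

section Coins

variable {n : ℕ} [NeZero n] {G : SimpleGraph (Fin n)} [DecidableRel G.Adj] {ℓ : ℕ}

instance (i : CoinIdx G) : MeasurableSingletonClass (CoinType G ℓ i) := ⟨fun _ => trivial⟩

instance : IsProbabilityMeasure (coinMeasure G ℓ) := by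
  unfold coinMeasure
  infer_instance

theorem transition_nonneg (x y : Fin n) : 0 ≤ transition G x y := by
  simp only [transition, Matrix.of_apply]
  split_ifs <;> positivity

theorem transition_pow_nonneg (t : ℕ) (x y : Fin n) : 0 ≤ (transition G ^ t) x y := by
  induction t generalizing y with
  | zero => simp only [pow_zero, Matrix.one_apply]; split_ifs <;> norm_num
  | succ t ih =>
    rw [pow_succ, Matrix.mul_apply]
    exact Finset.sum_nonneg fun z _ => mul_nonneg (ih z) (transition_nonneg z y)

theorem adj_of_next (hG : ∀ x, ∃ y, G.Adj x y) {x : Fin n} (c : Next G x) : G.Adj x c.1 := by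
  rcases c.2 with h | ⟨_, h⟩
  · exact h
  · obtain ⟨y, hy⟩ := hG x
    exact absurd hy (h y)

theorem card_next (hG : ∀ x, ∃ y, G.Adj x y) (x : Fin n) :
    Fintype.card (Next G x) = G.degree x := by
  rw [← G.card_neighborFinset_eq_degree, ← Fintype.card_coe]
  refine Fintype.card_congr (Equiv.subtypeEquivRight fun y => ?_)
  rw [SimpleGraph.mem_neighborFinset]
  refine ⟨?_, Or.inl⟩
  rintro (h | ⟨_, h⟩)
  · exact h
  · obtain ⟨y, hy⟩ := hG x
    exact absurd hy (h y)

theorem uniform_next_apply (hG : ∀ x, ∃ y, G.Adj x y) {x : Fin n} (c : Next G x) :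
    PMF.uniformOfFintype (Next G x) c = ENNReal.ofReal (transition G x c.1) := by
  have hd : 0 < G.degree x := by
    rw [G.degree_pos_iff_exists_adj]
    exact hG x
  rw [PMF.uniformOfFintype_apply, card_next hG, transition, Matrix.of_apply,
    if_pos (adj_of_next hG c), one_div, ENNReal.ofReal_inv_of_pos (by exact_mod_cast hd),
    ENNReal.ofReal_natCast]

theorem IsLocal.measure_inter_coin {S : Set (CoinIdx G)} {A : Set (Coins G ℓ)} (hA : IsLocal S A)
    {i : CoinIdx G} (hi : i ∉ S) (c : CoinType G ℓ i) :
    coinMeasure G ℓ (A ∩ {ω | ω i = c}) = coinMeasure G ℓ A * coinLaw G ℓ i c := by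
  unfold coinMeasure
  rw [hA.measure_inter_eval _ hi, PMF.toMeasure_apply_singleton _ _ (measurableSet_singleton c)]

/-- A random walk driven by coins: position `x` at time `t` is left according to the coin
`c t x`. -/
structure IsCoinWalk (v : Fin n) (c : ℕ → Fin n → CoinIdx G) (pos : Coins G ℓ → ℕ → Fin n) :
    Prop where
  zero : ∀ ω, pos ω 0 = v
  inj : ∀ t t' x x', c t x = c t' x' → t = t'
  exists_next : ∃ f : ℕ → Fin n → Coins G ℓ → Fin n,
    (∀ ω t, pos ω (t + 1) = f t (pos ω t) ω) ∧
    (∀ t x y, IsLocal {c t x} {ω | f t x ω = y}) ∧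
    ∀ t x y (S : Set (CoinIdx G)) (A : Set (Coins G ℓ)), IsLocal S A → c t x ∉ S →
      coinMeasure G ℓ (A ∩ {ω | f t x ω = y}) =
        coinMeasure G ℓ A * ENNReal.ofReal (transition G x y)

section CoinWalk

variable {v : Fin n} {c : ℕ → Fin n → CoinIdx G} {pos : Coins G ℓ → ℕ → Fin n}

theorem IsCoinWalk.isLocal (h : IsCoinWalk v c pos) (T : ℕ) (y : Fin n) :
    IsLocal {i | ∃ t < T, ∃ x, i = c t x} {ω | pos ω T = y} := by
  obtain ⟨f, hf, hloc, -⟩ := h.exists_next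
  induction T generalizing y with
  | zero =>
    by_cases hv : v = y
    · simpa [h.zero, hv] using IsLocal.univ
    · simpa [h.zero, hv] using IsLocal.univ.compl
  | succ T ih =>
    have : {ω | pos ω (T + 1) = y} = ⋃ x, {ω | pos ω T = x} ∩ {ω | f T x ω = y} := by
      ext ω
      simp [hf]
    rw [this]
    refine IsLocal.iUnion fun x => IsLocal.inter ((ih x).mono ?_) ((hloc T x y).mono ?_)
    · rintro _ ⟨t, ht, x, rfl⟩
      exact ⟨t, by omega, x, rfl⟩
    · rintro _ rfl
      exact ⟨T, by omega, x, rfl⟩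

/-- A walk driven by fresh coins is a random walk, given any event `A` that does not look at them.
-/
theorem IsCoinWalk.measure_inter (h : IsCoinWalk v c pos) {S : Set (CoinIdx G)}
    {A : Set (Coins G ℓ)} (hA : IsLocal S A) (T : ℕ) (hS : ∀ t < T, ∀ x, c t x ∉ S) (y : Fin n) :
    coinMeasure G ℓ (A ∩ {ω | pos ω T = y}) =
      coinMeasure G ℓ A * ENNReal.ofReal ((transition G ^ T) v y) := by
  have hf := h.exists_next
  obtain ⟨f, hf, hloc, hlaw⟩ := hf
  induction T generalizing y with
  | zero =>
    by_cases hv : v = y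
    · simp [h.zero, hv]
    · simp [h.zero, hv]
  | succ T ih =>
    rw [measure_eq_tsum_fiber (f := fun ω => pos ω T) _
      (hA.meas.inter (h.isLocal _ y).meas) (fun x => (h.isLocal T x).meas), tsum_fintype,
      pow_succ, Matrix.mul_apply, ENNReal.ofReal_sum_of_nonneg
        (fun z _ => mul_nonneg (transition_pow_nonneg T v z) (transition_nonneg z y)),
      Finset.mul_sum]
    refine Finset.sum_congr rfl fun x _ => ?_
    have : A ∩ {ω | pos ω (T + 1) = y} ∩ (fun ω => pos ω T) ⁻¹' {x} =
        (A ∩ {ω | pos ω T = x}) ∩ {ω | f T x ω = y} := by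
      ext ω
      simp only [Set.mem_inter_iff, Set.mem_ofPred_eq, Set.mem_preimage, Set.mem_singleton_iff, hf]
      constructor
      · rintro ⟨⟨h1, h2⟩, rfl⟩
        exact ⟨⟨h1, rfl⟩, h2⟩
      · rintro ⟨⟨h1, rfl⟩, h2⟩
        exact ⟨⟨h1, h2⟩, rfl⟩
    rw [this, hlaw T x y (S ∪ {i | ∃ t < T, ∃ x, i = c t x}) _
      ((hA.mono Set.subset_union_left).inter ((h.isLocal T x).mono Set.subset_union_right)),
      ih (fun t ht => hS t (by omega)) x, ENNReal.ofReal_mul (transition_pow_nonneg T v x),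
      mul_assoc]
    rintro (h' | ⟨t, ht, x', h'⟩)
    · exact hS T (by omega) x h'
    · have := h.inj _ _ _ _ h'
      omega

end CoinWalk

/-- If the coin `i` gives a uniform element of `Next G x`, then its value is a step of the simple
random walk from `x`. The type `Next G x` is the set of neighbours, as there are no isolated nodes.
-/
theorem measure_inter_next {x : Fin n} (hG : ∀ x, ∃ y, G.Adj x y) (i : CoinIdx G)
    (f : Coins G ℓ → Next G x) (hf : ∀ c, IsLocal {i} {ω | f ω = c})
    (hlaw : ∀ c (S : Set (CoinIdx G)) (A : Set (Coins G ℓ)), IsLocal S A → i ∉ S →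
      coinMeasure G ℓ (A ∩ {ω | f ω = c}) = coinMeasure G ℓ A * PMF.uniformOfFintype (Next G x) c)
    (y : Fin n) : IsLocal {i} {ω | (f ω).1 = y} ∧
    ∀ (S : Set (CoinIdx G)) (A : Set (Coins G ℓ)), IsLocal S A → i ∉ S →
      coinMeasure G ℓ (A ∩ {ω | (f ω).1 = y}) =
        coinMeasure G ℓ A * ENNReal.ofReal (transition G x y) := by
  by_cases hy : G.Adj x y
  · have : {ω | (f ω).1 = y} = {ω | f ω = (⟨y, Or.inl hy⟩ : Next G x)} := by
      ext ω
      exact ⟨fun h => Subtype.ext h, fun h => congrArg Subtype.val h⟩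
    rw [this]
    refine ⟨hf _, fun S A hA hi => (hlaw _ S A hA hi).trans ?_⟩
    exact congrArg (coinMeasure G ℓ A * ·) (uniform_next_apply hG (⟨y, Or.inl hy⟩ : Next G x))
  · have : {ω | (f ω).1 = y} = ∅ := by
      ext ω
      refine ⟨fun h => hy ?_, fun h => h.elim⟩
      rw [← (h : (f ω).1 = y)]
      exact adj_of_next hG _
    rw [this]
    refine ⟨by simpa using IsLocal.univ.compl, fun S A hA hi => ?_⟩
    simp [transition, hy]

theorem isCoinWalk_walkPos (hG : ∀ x, ∃ y, G.Adj x y) (e : ℕ) (w : Short G) :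
    IsCoinWalk (ℓ := ℓ) w.1 (fun t x => .hop e w t x) fun ω => walkPos ω e w := by
  refine ⟨fun ω => rfl, fun t t' x x' h => by injection h,
    fun t x ω => (hopCoin ω e w t x).1, fun ω t => rfl, fun t x y => ?_, fun t x y => ?_⟩
  · exact (measure_inter_next hG (CoinIdx.hop e w t x) (fun ω => hopCoin ω e w t x)
      (fun c => IsLocal.eval (X := CoinType G ℓ) (CoinIdx.hop e w t x) c)
      (fun c S A hA hi => hA.measure_inter_coin (i := (CoinIdx.hop e w t x)) hi c) y).1
  · exact (measure_inter_next hG (CoinIdx.hop e w t x) (fun ω => hopCoin ω e w t x)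
      (fun c => IsLocal.eval (X := CoinType G ℓ) (CoinIdx.hop e w t x) c)
      (fun c S A hA hi => hA.measure_inter_coin (i := (CoinIdx.hop e w t x)) hi c) y).2

theorem isCoinWalk_naivePos (hG : ∀ x, ∃ y, G.Adj x y) (e k : ℕ) (v : Fin n) :
    IsCoinWalk (ℓ := ℓ) v (fun t x => .step e k t x) fun ω : Coins G ℓ => naivePos ω e k v := by
  refine ⟨fun ω => rfl, fun t t' x x' h => by injection h,
    fun t x ω => (stepCoin ω e k t x).1, fun ω t => rfl, fun t x y => ?_, fun t x y => ?_⟩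
  · exact (measure_inter_next hG (CoinIdx.step e k t x) (fun ω => stepCoin ω e k t x)
      (fun c => IsLocal.eval (X := CoinType G ℓ) (CoinIdx.step e k t x) c)
      (fun c S A hA hi => hA.measure_inter_coin (i := (CoinIdx.step e k t x)) hi c) y).1
  · exact (measure_inter_next hG (CoinIdx.step e k t x) (fun ω => stepCoin ω e k t x)
      (fun c => IsLocal.eval (X := CoinType G ℓ) (CoinIdx.step e k t x) c)
      (fun c S A hA hi => hA.measure_inter_coin (i := (CoinIdx.step e k t x)) hi c) y).2

end Coins

/-! ### Sources and short walks -/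

section Kernel

variable {n : ℕ} [NeZero n] {G : SimpleGraph (Fin n)} [DecidableRel G.Adj] {ℓ : ℕ}

/-- The stationary distribution of the simple random walk. -/
def stationary (G : SimpleGraph (Fin n)) [DecidableRel G.Adj] (v : Fin n) : ℝ :=
  G.degree v / (2 * G.edgeFinset.card)

theorem sum_degree_real : ∑ v, (G.degree v : ℝ) = 2 * G.edgeFinset.card := by
  exact_mod_cast G.sum_degrees_eq_twice_card_edges

theorem sourceLaw_apply (hG : ∀ x, ∃ y, G.Adj x y) (v : Fin n) :
    sourceLaw G v = ENNReal.ofReal (stationary G v) := by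
  have hs : ∑ v, (G.degree v : ℝ≥0∞) = ENNReal.ofReal (2 * G.edgeFinset.card) := by
    rw [← sum_degree_real, ENNReal.ofReal_sum_of_nonneg fun _ _ => by positivity]
    simp
  have hd : 0 < G.degree v := by
    rw [G.degree_pos_iff_exists_adj]
    exact hG v
  have hpos : (0 : ℝ) < 2 * G.edgeFinset.card := by
    rw [← sum_degree_real]
    exact Finset.sum_pos' (fun _ _ => by positivity) ⟨v, Finset.mem_univ _, by exact_mod_cast hd⟩
  have h0 : ∑' v, (G.degree v : ℝ≥0∞) ≠ 0 := by
    rw [tsum_fintype, hs]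
    simpa using hpos
  rw [sourceLaw, dif_neg h0, PMF.normalize_apply, tsum_fintype, hs, stationary, div_eq_mul_inv,
    ENNReal.ofReal_mul (Nat.cast_nonneg _), ENNReal.ofReal_inv_of_pos hpos, ENNReal.ofReal_natCast]

theorem IsLocal.measure_inter_source (hG : ∀ x, ∃ y, G.Adj x y) {S : Set (CoinIdx G)}
    {A : Set (Coins G ℓ)} (hA : IsLocal S A) {k : ℕ} (hk : CoinIdx.src k ∉ S) (s : Fin n) :
    coinMeasure G ℓ (A ∩ {ω | source ω k = s}) =
      coinMeasure G ℓ A * ENNReal.ofReal (stationary G s) := by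
  rw [← sourceLaw_apply hG]
  exact hA.measure_inter_coin (i := CoinIdx.src k) hk s

/-- Expectation of `F` at the length and the end of a short walk from `x`. -/
def shortAvg (G : SimpleGraph (Fin n)) [DecidableRel G.Adj] (ℓ : ℕ) (F : ℕ → Fin n → ℝ≥0∞)
    (x : Fin n) : ℝ≥0∞ :=
  ∑ r : Fin (lam G ℓ - 1 + 1), ((lam G ℓ - 1 + 1 : ℕ) : ℝ≥0∞)⁻¹ *
    ∑ y, ENNReal.ofReal ((transition G ^ (lam G ℓ + r)) x y) * F (lam G ℓ + r) y

/-- The coins of one short walk. -/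
def shortCoins (e : ℕ) (w : Short G) : Set (CoinIdx G) :=
  {i | i = .len e w ∨ ∃ t x, i = .hop e w t x}

theorem isLocal_lenCoin (e : ℕ) (w : Short G) (r : Fin (lam G ℓ - 1 + 1)) :
    IsLocal {CoinIdx.len e w} {ω : Coins G ℓ | lenCoin ω e w = r} :=
  IsLocal.eval (X := CoinType G ℓ) (CoinIdx.len e w) r

theorem isLocal_len_walkPos (hG : ∀ x, ∃ y, G.Adj x y) (e : ℕ) (w : Short G)
    (r : Fin (lam G ℓ - 1 + 1)) (T : ℕ) (y : Fin n) :
    IsLocal (shortCoins e w) {ω : Coins G ℓ | lenCoin ω e w = r ∧ walkPos ω e w T = y} := by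
  refine IsLocal.inter ((isLocal_lenCoin e w r).mono ?_)
    (((isCoinWalk_walkPos hG e w).isLocal T y).mono ?_)
  · rintro _ rfl
    exact Or.inl rfl
  · rintro _ ⟨t, _, x, rfl⟩
    exact Or.inr ⟨t, x, rfl⟩

theorem isLocal_walkLen_walkEnd (hG : ∀ x, ∃ y, G.Adj x y) (e : ℕ) (w : Short G)
    (p : ℕ → Fin n → Prop) :
    IsLocal (shortCoins e w) {ω : Coins G ℓ | p (walkLen ω e w) (walkEnd ω e w)} := by
  have : {ω : Coins G ℓ | p (walkLen ω e w) (walkEnd ω e w)} =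
      ⋃ q : {q : Fin (lam G ℓ - 1 + 1) × Fin n // p (lam G ℓ + q.1) q.2},
        {ω : Coins G ℓ | lenCoin ω e w = q.1.1 ∧ walkPos ω e w (lam G ℓ + q.1.1) = q.1.2} := by
    ext ω
    simp only [Set.mem_ofPred_eq, Set.mem_iUnion]
    constructor
    · intro h
      exact ⟨⟨(lenCoin ω e w, walkEnd ω e w), h⟩, rfl, rfl⟩
    · rintro ⟨⟨⟨r, y⟩, h⟩, h1, h2⟩
      simp only at h h1 h2
      subst h1 h2
      exact h
  rw [this]
  exact IsLocal.iUnion fun q => isLocal_len_walkPos hG e w _ _ _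

theorem IsLocal.measure_inter_len_walkPos (hG : ∀ x, ∃ y, G.Adj x y) {S : Set (CoinIdx G)}
    {A : Set (Coins G ℓ)} (hA : IsLocal S A) {e : ℕ} {w : Short G}
    (hw : Disjoint S (shortCoins e w)) (r : Fin (lam G ℓ - 1 + 1)) (T : ℕ) (y : Fin n) :
    coinMeasure G ℓ (A ∩ {ω | lenCoin ω e w = r ∧ walkPos ω e w T = y}) =
      coinMeasure G ℓ A * ((lam G ℓ - 1 + 1 : ℕ) : ℝ≥0∞)⁻¹ *
        ENNReal.ofReal ((transition G ^ T) w.1 y) := by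
  have hAr := (hA.mono (Set.subset_union_left (t := {CoinIdx.len e w}))).inter
    ((isLocal_lenCoin (ℓ := ℓ) e w r).mono (Set.subset_union_right (s := S)))
  have h1 := (isCoinWalk_walkPos hG e w).measure_inter hAr T (fun t _ x hx => ?_) y
  · have h2 : coinMeasure G ℓ (A ∩ {ω | lenCoin ω e w = r}) =
        coinMeasure G ℓ A * ((lam G ℓ - 1 + 1 : ℕ) : ℝ≥0∞)⁻¹ := by
      refine (hA.measure_inter_coin (i := CoinIdx.len e w) ?_ r).trans ?_
      · exact fun h => Set.disjoint_left.1 hw h (Or.inl rfl)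
      · congr 1
        refine (PMF.uniformOfFintype_apply (α := Fin (lam G ℓ - 1 + 1)) r).trans ?_
        rw [Fintype.card_fin]
    rw [← h2, ← h1, Set.inter_assoc]
    rfl
  · rcases hx with hx | hx
    · exact Set.disjoint_left.1 hw hx (Or.inr ⟨t, x, rfl⟩)
    · cases hx

/-- The length and the end of a short walk are independent of what is known before. -/
theorem IsLocal.setLIntegral_short (hG : ∀ x, ∃ y, G.Adj x y) {S : Set (CoinIdx G)}
    {A : Set (Coins G ℓ)} (hA : IsLocal S A) {e : ℕ} {w : Short G}
    (hw : Disjoint S (shortCoins e w)) (F : ℕ → Fin n → ℝ≥0∞) :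
    ∫⁻ ω in A, F (walkLen ω e w) (walkEnd ω e w) ∂(coinMeasure G ℓ) =
      coinMeasure G ℓ A * shortAvg G ℓ F w.1 := by
  have hf : MeasFibers fun ω : Coins G ℓ => (lenCoin ω e w, walkEnd ω e w) := by
    rintro ⟨r, y⟩
    convert (isLocal_len_walkPos (ℓ := ℓ) hG e w r (lam G ℓ + r) y).meas using 1
    ext ω
    simp only [Set.mem_preimage, Set.mem_singleton_iff, Prod.mk.injEq, Set.mem_ofPred_eq, walkEnd,
      walkLen]
    constructor
    · rintro ⟨rfl, h⟩
      exact ⟨rfl, h⟩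
    · rintro ⟨rfl, h⟩
      exact ⟨rfl, h⟩
  rw [setLIntegral_eq_tsum_fiber _ hA.meas hf, tsum_fintype, Fintype.sum_prod_type, shortAvg,
    Finset.mul_sum]
  refine Finset.sum_congr rfl fun r _ => ?_
  rw [Finset.mul_sum, Finset.mul_sum]
  refine Finset.sum_congr rfl fun y _ => ?_
  have hset : A ∩ (fun ω : Coins G ℓ => (lenCoin ω e w, walkEnd ω e w)) ⁻¹' {(r, y)} =
      A ∩ {ω | lenCoin ω e w = r ∧ walkPos ω e w (lam G ℓ + r) = y} := by
    ext ω
    simp only [Set.mem_preimage, Set.mem_singleton_iff, Prod.mk.injEq, Set.mem_ofPred_eq, walkEnd,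
      walkLen, Set.mem_inter_iff]
    constructor
    · rintro ⟨h, rfl, h'⟩
      exact ⟨h, rfl, h'⟩
    · rintro ⟨h, rfl, h'⟩
      exact ⟨h, rfl, h'⟩
  rw [hset]
  have hm : MeasurableSet (A ∩ {ω | lenCoin ω e w = r ∧ walkPos ω e w (lam G ℓ + r) = y}) :=
    hA.meas.inter (isLocal_len_walkPos hG e w r _ y).meas
  rw [setLIntegral_congr_fun (g := fun _ => F (lam G ℓ + r) y) hm, setLIntegral_const,
    hA.measure_inter_len_walkPos hG hw]
  · ring
  · rintro ω ⟨_, rfl, rfl⟩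
    rfl

/-! ### The token as a Markov chain -/

/-- State of the token without the transcript: position, length completed, number of short walks
used at each node, and whether the attempt has failed. There are only countably many such states.
-/
structure Tok (n : ℕ) where
  pos : Fin n
  len : ℕ
  used : Fin n → ℕ
  failed : Bool

instance : Countable (Tok n) := by
  refine Function.Injective.countable
    (f := fun t : Tok n => (t.pos, t.len, t.used, t.failed)) ?_
  rintro ⟨⟩ ⟨⟩ h
  simpa using h

variable (ℓ) in
/-- The loop of the stitching part is left in this state. -/
def Tok.Stopped (G : SimpleGraph (Fin n)) (t : Tok n) : Prop :=
  t.failed = true ∨ ℓ < t.len + 2 * lam G ℓ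

/-- The short walk that is used next at `x`, after `u`. -/
def nextShort (ω : Coins G ℓ) (e : ℕ) (x : Fin n) (i : ℕ) (h : i < numWalks G x) : Short G :=
  ⟨x, pickCoin ω e x ⟨i, h⟩⟩

/-- One pass of the stitching loop, without the transcript. -/
def tokStep (ω : Coins G ℓ) (e : ℕ) (t : Tok n) : Tok n :=
  if t.Stopped ℓ G then t
  else if h : t.used t.pos < numWalks G t.pos then
    ⟨walkEnd ω e (nextShort ω e t.pos _ h), t.len + walkLen ω e (nextShort ω e t.pos _ h),
      Function.update t.used t.pos (t.used t.pos + 1), false⟩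
  else { t with failed := true }

/-- Expectation of `Ψ` after one pass of the stitching loop that begins in the state `t`. -/
def tokKernel (G : SimpleGraph (Fin n)) [DecidableRel G.Adj] (ℓ : ℕ) (Ψ : Tok n → ℝ≥0∞)
    (t : Tok n) : ℝ≥0∞ :=
  if t.Stopped ℓ G then Ψ t
  else if t.used t.pos < numWalks G t.pos then
    shortAvg G ℓ (fun L y => Ψ ⟨y, t.len + L,
      Function.update t.used t.pos (t.used t.pos + 1), false⟩) t.pos
  else Ψ { t with failed := true }

/-- The short walks that have been used if every node `v` has used `u v` walks in the order `π`. -/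
def usedShorts (π : (x : Fin n) → Equiv.Perm (Fin (numWalks G x))) (u : Fin n → ℕ) :
    Set (Short G) :=
  {w | ((π w.1).symm w.2 : ℕ) < u w.1}

/-- The coins that the execution may have looked at while it runs with table `e`: sources of the
requests before `k`, everything about earlier tables, the orders in table `e`, and the short walks
in `U`. -/
def revealed (k e : ℕ) (U : Set (Short G)) : Set (CoinIdx G)
  | .src j => j < k
  | .len e' w => e' < e ∨ (e' = e ∧ w ∈ U)
  | .hop e' w _ _ => e' < e ∨ (e' = e ∧ w ∈ U)
  | .pick e' _ => e' ≤ e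
  | .step _ _ _ _ => False

/-- The orders of table `e` are given by `π`. -/
def picksEq (e : ℕ) (π : (x : Fin n) → Equiv.Perm (Fin (numWalks G x))) : Set (Coins G ℓ) :=
  {ω | ∀ x, pickCoin ω e x = π x}

theorem revealed_mono {k k' e : ℕ} {U U' : Set (Short G)} (hk : k ≤ k') (hU : U ⊆ U') :
    revealed k e U ⊆ revealed k' e U' := by
  rintro (_ | _ | _ | _ | _) hi
  · exact lt_of_lt_of_le hi hk
  · exact hi.imp id fun h => ⟨h.1, hU h.2⟩
  · exact hi.imp id fun h => ⟨h.1, hU h.2⟩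
  · exact hi
  · exact hi

theorem revealed_table_mono {k k' e e' : ℕ} {U U' : Set (Short G)} (hk : k ≤ k') (he : e < e') :
    revealed k e U ⊆ revealed k' e' U' := by
  rintro (_ | _ | _ | _ | _) hi
  · exact lt_of_lt_of_le hi hk
  · exact Or.inl (hi.elim (fun h => h.trans he) fun h => h.1 ▸ he)
  · exact Or.inl (hi.elim (fun h => h.trans he) fun h => h.1 ▸ he)
  · exact le_trans hi he.le
  · exact hi

/-- The orders in the current table count as revealed: the choice among the unused walks is made
part of the history, and only the walks themselves remain random. -/
theorem isLocal_picksEq (k e : ℕ) (U : Set (Short G))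
    (π : (x : Fin n) → Equiv.Perm (Fin (numWalks G x))) :
    IsLocal (revealed k e U) (picksEq (ℓ := ℓ) e π) := by
  have : picksEq (ℓ := ℓ) e π = ⋂ x, {ω | ω (.pick e x) = π x} := by
    ext ω
    simp [picksEq, pickCoin]
  constructor
  · rw [this]
    exact .iInter fun x => (IsLocal.eval (X := CoinType G ℓ) (CoinIdx.pick e x) (π x)).meas
  · intro ω ω' h hω x
    rw [← hω x]
    exact (h (.pick e x) (le_refl e)).symm

theorem usedShorts_mono {π : (x : Fin n) → Equiv.Perm (Fin (numWalks G x))} {u u' : Fin n → ℕ}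
    (h : u ≤ u') : usedShorts π u ⊆ usedShorts π u' :=
  fun w hw => lt_of_lt_of_le hw (h w.1)

section Step

variable {k e : ℕ} {π : (x : Fin n) → Equiv.Perm (Fin (numWalks G x))} {A : Set (Coins G ℓ)}
  {t : Tok n}

/-- The short walk that is used next has not been looked at. -/
theorem disjoint_revealed_shortCoins {x : Fin n} {u : Fin n → ℕ} (h : u x < numWalks G x) :
    Disjoint (revealed k e (usedShorts π u)) (shortCoins e ⟨x, π x ⟨u x, h⟩⟩) := by
  rw [Set.disjoint_left]
  rintro i hi (rfl | ⟨t, y, rfl⟩)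
  · rcases hi with hi | ⟨_, hi⟩
    · exact lt_irrefl _ hi
    · simp [usedShorts] at hi
  · rcases hi with hi | ⟨_, hi⟩
    · exact lt_irrefl _ hi
    · simp [usedShorts] at hi

/-- A pass of the loop reveals at most the short walk that it uses. -/
theorem IsLocal.inter_tokStep (hG : ∀ x, ∃ y, G.Adj x y)
    (hA : IsLocal (revealed k e (usedShorts π t.used)) A) (hπ : A ⊆ picksEq e π) (t' : Tok n) :
    IsLocal (revealed k e (usedShorts π t'.used)) (A ∩ {ω | tokStep ω e t = t'}) := by
  have hconst : ∀ t₁ : Tok n, t₁.used = t.used → (∀ ω : Coins G ℓ, tokStep ω e t = t₁) →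
      IsLocal (revealed k e (usedShorts π t'.used))
        (A ∩ {ω | tokStep ω e t = t'}) := by
    intro t₁ h1 h2
    by_cases h : t₁ = t'
    · subst h
      simpa [h2, h1] using hA
    · simpa [h2, h] using IsLocal.univ.compl
  by_cases hs : t.Stopped ℓ G
  · exact hconst t rfl fun ω => by simp [tokStep, hs]
  by_cases hu : t.used t.pos < numWalks G t.pos
  · by_cases ht' : t'.used = Function.update t.used t.pos (t.used t.pos + 1)
    · set w : Short G := ⟨t.pos, π t.pos ⟨t.used t.pos, hu⟩⟩ with hw
      have : A ∩ {ω | tokStep ω e t = t'} =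
          A ∩ {ω | (⟨walkEnd ω e w, t.len + walkLen ω e w,
            Function.update t.used t.pos (t.used t.pos + 1), false⟩ : Tok n) = t'} := by
        ext ω
        refine and_congr_right fun hω => ?_
        have : nextShort ω e t.pos _ hu = w := by rw [nextShort, hπ hω t.pos]
        simp only [tokStep, hs, hu, this, Set.mem_ofPred_eq, if_false,
          dif_pos]
      rw [this]
      have hsub : usedShorts π t.used ⊆ usedShorts π t'.used := by
        refine usedShorts_mono fun x => ?_
        rw [ht']
        by_cases hx : x = t.pos
        · subst hx
          simp
        · simp [hx]
      refine IsLocal.inter (hA.mono (revealed_mono le_rfl hsub)) ?_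
      refine (isLocal_walkLen_walkEnd hG e w fun L y => (⟨y, t.len + L,
            Function.update t.used t.pos (t.used t.pos + 1), false⟩ : Tok n) = t').mono ?_
      have hwm : w ∈ usedShorts π t'.used := by
        simp [usedShorts, hw, ht']
      rintro i (rfl | ⟨_, _, rfl⟩)
      · exact Or.inr ⟨rfl, hwm⟩
      · exact Or.inr ⟨rfl, hwm⟩
    · have : A ∩ {ω | tokStep ω e t = t'} = ∅ := by
        ext ω
        simp only [Set.mem_inter_iff, Set.mem_ofPred_eq, Set.mem_empty_iff_false, iff_false,
          not_and]
        rintro _ rfl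
        apply ht'
        simp [tokStep, hs, hu]
      rw [this]
      simpa using IsLocal.univ.compl
  · exact hconst { t with failed := true } rfl fun ω => by
      simp [tokStep, hs, hu]

/-- Given the history, a pass of the loop acts by `tokKernel`. -/
theorem IsLocal.setLIntegral_tokStep (hG : ∀ x, ∃ y, G.Adj x y)
    (hA : IsLocal (revealed k e (usedShorts π t.used)) A) (hπ : A ⊆ picksEq e π)
    (Ψ : Tok n → ℝ≥0∞) :
    ∫⁻ ω in A, Ψ (tokStep ω e t) ∂(coinMeasure G ℓ) =
      coinMeasure G ℓ A * tokKernel G ℓ Ψ t := by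
  by_cases hs : t.Stopped ℓ G
  · simp [tokStep, tokKernel, hs, mul_comm]
  by_cases hu : t.used t.pos < numWalks G t.pos
  · rw [tokKernel, if_neg hs, if_pos hu, ← hA.setLIntegral_short hG
      (disjoint_revealed_shortCoins hu)]
    refine setLIntegral_congr_fun hA.meas fun ω hω => ?_
    have : nextShort ω e t.pos _ hu = ⟨t.pos, π t.pos ⟨t.used t.pos, hu⟩⟩ := by
      rw [nextShort, hπ hω t.pos]
    simp only [tokStep, hs, hu, this, if_false, dif_pos]
  · simp [tokStep, tokKernel, hs, hu, mul_comm]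

theorem measFibers_tokStep (hG : ∀ x, ∃ y, G.Adj x y) (e : ℕ) (t : Tok n) :
    MeasFibers fun ω : Coins G ℓ => tokStep ω e t := by
  intro t'
  have : (fun ω : Coins G ℓ => tokStep ω e t) ⁻¹' {t'} =
      ⋃ π, picksEq e π ∩ {ω | tokStep ω e t = t'} := by
    ext ω
    simp only [Set.mem_preimage, Set.mem_singleton_iff, Set.mem_iUnion, Set.mem_inter_iff,
      Set.mem_ofPred_eq, exists_and_right]
    exact ⟨fun h => ⟨⟨fun x => pickCoin ω e x, fun x => rfl⟩, h⟩, fun h => h.2⟩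
  rw [this]
  exact .iUnion fun π => ((isLocal_picksEq 0 e _ π).inter_tokStep hG subset_rfl t').meas

theorem measFibers_tokStep_iterate (hG : ∀ x, ∃ y, G.Adj x y) (e : ℕ) (t : Tok n) (i : ℕ) :
    MeasFibers fun ω : Coins G ℓ => (tokStep ω e)^[i] t := by
  induction i generalizing t with
  | zero => exact measFibers_const t
  | succ i ih => exact (measFibers_tokStep hG e t).bind fun t' => ih t'

theorem IsLocal.inter_tokStep_iterate (hG : ∀ x, ∃ y, G.Adj x y)
    (hA : IsLocal (revealed k e (usedShorts π t.used)) A) (hπ : A ⊆ picksEq e π) (i : ℕ)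
    (t' : Tok n) :
    IsLocal (revealed k e (usedShorts π t'.used))
      (A ∩ {ω | (tokStep ω e)^[i] t = t'}) := by
  induction i generalizing A t with
  | zero =>
    by_cases h : t = t'
    · subst h
      simpa using hA
    · simpa [h] using IsLocal.univ.compl
  | succ i ih =>
    have : A ∩ {ω | (tokStep ω e)^[i + 1] t = t'} =
        ⋃ t₁, (A ∩ {ω | tokStep ω e t = t₁}) ∩
          {ω | (tokStep ω e)^[i] t₁ = t'} := by
      ext ω
      simp
    rw [this]
    exact IsLocal.iUnion fun t₁ => ih (hA.inter_tokStep hG hπ t₁) (Set.inter_subset_left.trans hπ)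

/-- The stitching loop is a Markov chain with kernel `tokKernel`. -/
theorem IsLocal.setLIntegral_tokStep_iterate (hG : ∀ x, ∃ y, G.Adj x y)
    (hA : IsLocal (revealed k e (usedShorts π t.used)) A) (hπ : A ⊆ picksEq e π) (i : ℕ)
    (Ψ : Tok n → ℝ≥0∞) :
    ∫⁻ ω in A, Ψ ((tokStep ω e)^[i] t) ∂(coinMeasure G ℓ) =
      coinMeasure G ℓ A * (tokKernel G ℓ)^[i] Ψ t := by
  induction i generalizing A t with
  | zero => simp [mul_comm]
  | succ i ih =>
    rw [Function.iterate_succ_apply', ← hA.setLIntegral_tokStep hG hπ,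
      setLIntegral_eq_tsum_fiber _ hA.meas (measFibers_tokStep hG e t),
      setLIntegral_eq_tsum_fiber _ hA.meas (measFibers_tokStep hG e t)]
    refine tsum_congr fun t₁ => ?_
    have h1 := hA.inter_tokStep hG hπ t₁
    have h2 := ih h1 (Set.inter_subset_left.trans hπ)
    refine Eq.trans ?_ (h2.trans ?_)
    · refine setLIntegral_congr_fun h1.meas ?_
      rintro ω ⟨_, rfl⟩
      rfl
    · rw [mul_comm, ← setLIntegral_const]
      refine setLIntegral_congr_fun h1.meas ?_
      rintro ω ⟨_, rfl⟩
      rfl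

end Step
end Kernel

/-! ### Visits of the simple random walk to a node -/

section Visits

variable {n : ℕ} [NeZero n] {G : SimpleGraph (Fin n)} [DecidableRel G.Adj]

theorem degree_pos (hG : ∀ x, ∃ y, G.Adj x y) (x : Fin n) : 0 < (G.degree x : ℝ) := by
  have : 0 < G.degree x := by
    rw [G.degree_pos_iff_exists_adj]
    exact hG x
  exact_mod_cast this

theorem degree_mul_transition (hG : ∀ x, ∃ y, G.Adj x y) (x y : Fin n) :
    (G.degree x : ℝ) * transition G x y = if G.Adj x y then 1 else 0 := by
  have := degree_pos hG x
  simp only [transition, Matrix.of_apply]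
  split_ifs
  · field_simp
  · simp

theorem sum_transition (hG : ∀ x, ∃ y, G.Adj x y) (x : Fin n) : ∑ y, transition G x y = 1 := by
  have := degree_pos hG x
  simp only [transition, Matrix.of_apply, ← Finset.sum_filter, Finset.sum_const, nsmul_eq_mul]
  have h : (Finset.univ.filter fun y => G.Adj x y) = G.neighborFinset x := by
    ext y
    simp
  rw [h, G.card_neighborFinset_eq_degree]
  field_simp

theorem sum_transition_pow (hG : ∀ x, ∃ y, G.Adj x y) (t : ℕ) (x : Fin n) :
    ∑ y, (transition G ^ t) x y = 1 := by
  induction t with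
  | zero => simp [Matrix.one_apply]
  | succ t ih =>
    simp only [pow_succ, Matrix.mul_apply]
    rw [Finset.sum_comm]
    simp only [← Finset.mul_sum, sum_transition hG, mul_one, ih]

theorem degree_mul_transition_comm (hG : ∀ x, ∃ y, G.Adj x y) (x y : Fin n) :
    (G.degree x : ℝ) * transition G x y = G.degree y * transition G y x := by
  rw [degree_mul_transition hG, degree_mul_transition hG]
  simp only [G.adj_comm]

theorem degree_mul_transition_pow_comm (hG : ∀ x, ∃ y, G.Adj x y) (t : ℕ) (x y : Fin n) :
    (G.degree x : ℝ) * (transition G ^ t) x y = G.degree y * (transition G ^ t) y x := by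
  induction t generalizing x y with
  | zero =>
    by_cases h : x = y
    · rw [h]
    · simp [h, Ne.symm h]
  | succ t ih =>
    rw [pow_succ, Matrix.mul_apply, ← pow_succ, pow_succ', Matrix.mul_apply, Finset.mul_sum,
      Finset.mul_sum]
    refine Finset.sum_congr rfl fun z _ => ?_
    calc (G.degree x : ℝ) * ((transition G ^ t) x z * transition G z y)
        = (G.degree x * (transition G ^ t) x z) * transition G z y := by ring
      _ = (G.degree z * transition G z y) * (transition G ^ t) z x := by rw [ih]; ring
      _ = G.degree y * (transition G y z * (transition G ^ t) z x) := by
        rw [degree_mul_transition_comm hG]; ring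

theorem sum_degree_mul_transition_pow (hG : ∀ x, ∃ y, G.Adj x y) (t : ℕ) (v : Fin n) :
    ∑ x, (G.degree x : ℝ) * (transition G ^ t) x v = G.degree v := by
  simp only [degree_mul_transition_pow_comm hG t _ v, ← Finset.mul_sum, sum_transition_pow hG,
    mul_one]

/-- Expected number of visits to `v` in the first `N` positions of a walk from `x`. -/
def visits (G : SimpleGraph (Fin n)) [DecidableRel G.Adj] (v : Fin n) (N : ℕ) (x : Fin n) : ℝ :=
  ∑ t ∈ Finset.range N, (transition G ^ t) x v

theorem visits_nonneg (v : Fin n) (N : ℕ) (x : Fin n) : 0 ≤ visits G v N x :=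
  Finset.sum_nonneg fun t _ => transition_pow_nonneg t x v

theorem visits_succ (v : Fin n) (N : ℕ) (x : Fin n) :
    visits G v (N + 1) x = (if x = v then 1 else 0) + ∑ z, transition G x z * visits G v N z := by
  rw [visits, Finset.sum_range_succ', add_comm]
  congr 1
  simp only [visits, Finset.mul_sum]
  rw [Finset.sum_comm]
  refine Finset.sum_congr rfl fun t _ => ?_
  rw [pow_succ', Matrix.mul_apply]

/-- The expected number of visits to `v` is largest if the walk starts at `v`. -/
theorem visits_le_visits_self (hG : ∀ x, ∃ y, G.Adj x y) (v : Fin n) (N : ℕ) (x : Fin n) :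
    visits G v N x ≤ visits G v N v := by
  induction N generalizing x with
  | zero => simp [visits]
  | succ N ih =>
    by_cases hx : x = v
    · rw [hx]
    · have h1 : visits G v N v ≤ visits G v (N + 1) v := by
        rw [visits, visits, Finset.sum_range_succ]
        exact le_add_of_nonneg_right (transition_pow_nonneg _ _ _)
      refine le_trans ?_ h1
      rw [visits_succ, if_neg hx, zero_add]
      calc ∑ z, transition G x z * visits G v N z
          ≤ ∑ z, transition G x z * visits G v N v :=
            Finset.sum_le_sum fun z _ => mul_le_mul_of_nonneg_left (ih z) (transition_nonneg _ _)
        _ = visits G v N v := by rw [← Finset.sum_mul, sum_transition hG, one_mul]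

theorem sum_degree_mul_visits (hG : ∀ x, ∃ y, G.Adj x y) (v : Fin n) (N : ℕ) :
    ∑ x, (G.degree x : ℝ) * visits G v N x = N * G.degree v := by
  simp only [visits, Finset.mul_sum]
  rw [Finset.sum_comm]
  simp [sum_degree_mul_transition_pow hG]

/-- The Dirichlet energy of the Green function: summation by parts leaves only the source at `v`,
because the mass that is left at time `N` contributes with the opposite sign. -/
theorem energy_visits_le (hG : ∀ x, ∃ y, G.Adj x y) (v : Fin n) (N : ℕ) :
    ∑ x, ∑ y, (if G.Adj x y then (visits G v N x - visits G v N y) ^ 2 else 0) ≤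
      2 * G.degree v * visits G v N v := by
  set a := visits G v N with ha
  have hw : ∀ x y, (if G.Adj x y then (a x - a y) ^ 2 else 0) =
      (G.degree x * transition G x y) * a x ^ 2 + (G.degree y * transition G y x) * a y ^ 2 -
        2 * (G.degree x * a x * (transition G x y * a y)) := by
    intro x y
    have h1 := degree_mul_transition hG x y
    have h2 := degree_mul_transition hG y x
    rw [show (G.degree x : ℝ) * a x * (transition G x y * a y) =
      (G.degree x * transition G x y) * (a x * a y) by ring, h1, h2]
    simp only [G.adj_comm y x]
    split_ifs <;> ring
  have hrow : ∀ x, ∑ y, (G.degree x * transition G x y) * a x ^ 2 = G.degree x * a x ^ 2 := by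
    intro x
    rw [← Finset.sum_mul, ← Finset.mul_sum, sum_transition hG, mul_one]
  have hsum : ∑ x, ∑ y, (if G.Adj x y then (a x - a y) ^ 2 else 0) =
      2 * ∑ x, G.degree x * a x * (a x - ∑ y, transition G x y * a y) := by
    simp only [hw, Finset.sum_sub_distrib, Finset.sum_add_distrib, hrow]
    rw [Finset.sum_comm (f := fun x y => (G.degree y * transition G y x) * a y ^ 2)]
    simp only [hrow, mul_sub, Finset.sum_sub_distrib, ← Finset.mul_sum]
    simp only [pow_two, mul_assoc]
    ring
  -- The discrete Laplacian of `visits` is the indicator of `v` minus the law at time `N`.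
  have hlap : ∀ x, a x - ∑ y, transition G x y * a y ≤ if x = v then 1 else 0 := by
    intro x
    have := visits_succ (G := G) v N x
    rw [visits, Finset.sum_range_succ] at this
    have h0 := transition_pow_nonneg (G := G) N x v
    change a x + _ = _ at this
    linarith
  rw [hsum, mul_assoc]
  refine mul_le_mul_of_nonneg_left ?_ zero_le_two
  calc ∑ x, G.degree x * a x * (a x - ∑ y, transition G x y * a y)
      ≤ ∑ x, G.degree x * a x * (if x = v then 1 else 0) :=
        Finset.sum_le_sum fun x _ => mul_le_mul_of_nonneg_left (hlap x)
          (mul_nonneg (Nat.cast_nonneg _) (visits_nonneg v N x))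
    _ = G.degree v * a v := by simp

/-- Cauchy–Schwarz along a path. -/
theorem sq_sub_le_energy {x y : Fin n} (p : G.Walk x y) (hp : p.IsPath) (f : Fin n → ℝ) (i : ℕ)
    (hi : i ≤ p.length) :
    (f x - f (p.getVert i)) ^ 2 ≤
      i * ∑ x, ∑ y, (if G.Adj x y then (f x - f y) ^ 2 else 0) := by
  have htel : f x - f (p.getVert i) =
      ∑ j ∈ Finset.range i, (f (p.getVert j) - f (p.getVert (j + 1))) := by
    rw [Finset.sum_range_sub' (fun j => f (p.getVert j)), p.getVert_zero]
  rw [htel]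
  refine (sq_sum_le_card_mul_sum_sq).trans ?_
  rw [Finset.card_range]
  refine mul_le_mul_of_nonneg_left ?_ (Nat.cast_nonneg _)
  rw [← Finset.sum_product']
  have hinj : Set.InjOn (fun j => (p.getVert j, p.getVert (j + 1))) (Finset.range i : Set ℕ) := by
    intro j hj j' hj' h
    have h1 := (Prod.mk.inj h).1
    simp only [Finset.coe_range, Set.mem_Iio] at hj hj'
    exact hp.getVert_injOn (by show j ≤ _; omega) (by show j' ≤ _; omega) h1
  calc ∑ j ∈ Finset.range i, (f (p.getVert j) - f (p.getVert (j + 1))) ^ 2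
      = ∑ q ∈ (Finset.range i).image (fun j => (p.getVert j, p.getVert (j + 1))),
          (if G.Adj q.1 q.2 then (f q.1 - f q.2) ^ 2 else 0) := by
        rw [Finset.sum_image hinj]
        refine Finset.sum_congr rfl fun j hj => ?_
        rw [if_pos (p.adj_getVert_succ (by have := Finset.mem_range.1 hj; omega))]
    _ ≤ _ := Finset.sum_le_sum_of_subset_of_nonneg (by intro q _; simp)
        fun q _ _ => by split_ifs <;> positivity

/-- A walk of `N` steps visits `v` at most `deg v · O(√N + N / m)` times in expectation, from any
start: the Green function `visits / deg v` is at least half its maximum `r` on the ball of radius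
`r / 8` around `v`, since its energy is at most `r`, while its integral is `N`. -/
theorem visits_le (hG : ∀ x, ∃ y, G.Adj x y) (hconn : G.Connected) (v : Fin n) (N : ℕ)
    (x : Fin n) :
    visits G v N x ≤ G.degree v * (4 * √N + N / G.edgeFinset.card) := by
  refine (visits_le_visits_self hG v N x).trans ?_
  have hd := degree_pos hG
  set r : ℝ := visits G v N v / G.degree v with hr
  have hrv : visits G v N v = G.degree v * r := by
    rw [hr]; field_simp [(hd v).ne']
  have hr0 : 0 ≤ r := div_nonneg (visits_nonneg _ _ _) (hd v).le
  rw [hrv]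
  refine mul_le_mul_of_nonneg_left ?_ (hd v).le
  set k : ℕ := ⌊r / 8⌋₊ with hk
  have hk1 : (k : ℝ) ≤ r / 8 := Nat.floor_le (by positivity)
  -- On the ball of radius `k` the Green function is at least half its maximum.
  have hk2 : r / 8 < k + 1 := Nat.lt_floor_add_one _
  have hball : ∀ y, G.dist v y ≤ k → G.degree v * (r / 2) ≤ visits G v N y := by
    intro y hy
    obtain ⟨p, hp⟩ := hconn.exists_walk_length_eq_dist v y
    have hpath := p.isPath_of_length_eq_dist hp
    have h1 := sq_sub_le_energy p hpath (visits G v N) p.length le_rfl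
    rw [p.getVert_length] at h1
    have h2 := energy_visits_le hG v N
    have h3 : (p.length : ℝ) ≤ r / 8 := by
      refine le_trans ?_ hk1
      rw [hp]
      exact_mod_cast hy
    have h4 : (visits G v N v - visits G v N y) ^ 2 ≤ (G.degree v * (r / 2)) ^ 2 := by
      refine h1.trans ?_
      calc (p.length : ℝ) * _ ≤ (r / 8) * (2 * G.degree v * visits G v N v) := by
            refine mul_le_mul h3 h2 ?_ (by positivity)
            exact Finset.sum_nonneg fun _ _ => Finset.sum_nonneg fun _ _ => by
              split_ifs <;> positivity
        _ = (G.degree v * (r / 2)) ^ 2 := by rw [hrv]; ring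
    have h5 := abs_le_of_sq_le_sq h4 (by have := hd v; positivity)
    rw [hrv] at h5
    linarith [le_of_abs_le h5]
  have htot := sum_degree_mul_visits hG v N
  have hnn : ∀ y, 0 ≤ (G.degree y : ℝ) * visits G v N y := fun y =>
    mul_nonneg (hd y).le (visits_nonneg _ _ _)
  -- If the ball is the whole graph, the total mass gives `r ≤ N / m`. Otherwise the ball contains
  -- a path with `k + 1 > r / 8` nodes of degree at least `1`, which gives `r ^ 2 / 16 ≤ N`.
  by_cases hall : ∀ y, G.dist v y ≤ k
  · have hm : (0 : ℝ) < 2 * G.edgeFinset.card := by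
      rw [← sum_degree_real]
      exact Finset.sum_pos (fun y _ => hd y) ⟨v, Finset.mem_univ _⟩
    have h1 : ∑ y, (G.degree y : ℝ) * (G.degree v * (r / 2)) ≤ N * G.degree v := by
      rw [← htot]
      exact Finset.sum_le_sum fun y _ => mul_le_mul_of_nonneg_left (hball y (hall y)) (hd y).le
    rw [← Finset.sum_mul, sum_degree_real] at h1
    have h2 : G.edgeFinset.card * r ≤ N := by
      refine le_of_mul_le_mul_right ?_ (hd v)
      linarith
    have h3 : r ≤ N / G.edgeFinset.card := by
      rw [le_div_iff₀ (by linarith)]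
      linarith
    have := Real.sqrt_nonneg (N : ℝ)
    linarith
  · push Not at hall
    obtain ⟨y, hy⟩ := hall
    obtain ⟨p, hp⟩ := hconn.exists_walk_length_eq_dist v y
    have hpath := p.isPath_of_length_eq_dist hp
    have hinj : Set.InjOn p.getVert (Finset.range (k + 1) : Set ℕ) := by
      intro j hj j' hj' h
      simp only [Finset.coe_range, Set.mem_Iio] at hj hj'
      exact hpath.getVert_injOn (by show j ≤ _; omega) (by show j' ≤ _; omega) h
    have h1 : (k + 1 : ℕ) * (G.degree v * (r / 2)) ≤ N * G.degree v := by
      rw [← htot]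
      calc ((k + 1 : ℕ) : ℝ) * (G.degree v * (r / 2))
          = ∑ j ∈ Finset.range (k + 1), G.degree v * (r / 2) := by
            rw [Finset.sum_const, Finset.card_range, nsmul_eq_mul]
        _ ≤ ∑ j ∈ Finset.range (k + 1),
              (G.degree (p.getVert j) : ℝ) * visits G v N (p.getVert j) := by
            refine Finset.sum_le_sum fun j hj => ?_
            have hj' : G.dist v (p.getVert j) ≤ k := by
              refine (SimpleGraph.dist_le (p.take j)).trans ?_
              have := Finset.mem_range.1 hj
              rw [SimpleGraph.Walk.take_length]
              omega
            have h1 : (1 : ℝ) ≤ G.degree (p.getVert j) := by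
              have := hd (p.getVert j)
              exact_mod_cast this
            refine (hball _ hj').trans ?_
            exact le_mul_of_one_le_left (visits_nonneg _ _ _) h1
        _ = ∑ z ∈ (Finset.range (k + 1)).image p.getVert, (G.degree z : ℝ) * visits G v N z := by
            rw [Finset.sum_image hinj]
        _ ≤ _ := Finset.sum_le_sum_of_subset_of_nonneg (Finset.subset_univ _) fun z _ _ => hnn z
    have h2 : (k + 1 : ℝ) * (r / 2) ≤ N := by
      refine le_of_mul_le_mul_right ?_ (hd v)
      push_cast at h1
      linarith
    have h3 : (r / 4) ^ 2 ≤ N := by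
      have := mul_le_mul_of_nonneg_right hk2.le (div_nonneg hr0 zero_le_two)
      linarith
    have h4 : r / 4 ≤ √N := Real.le_sqrt_of_sq_le h3
    have : (0 : ℝ) ≤ N / G.edgeFinset.card := div_nonneg (Nat.cast_nonneg _) (Nat.cast_nonneg _)
    linarith

end Visits

/-! ### A potential for the number of short walks used at the nodes -/

section Potential

variable {n : ℕ} [NeZero n] {G : SimpleGraph (Fin n)} [DecidableRel G.Adj] {ℓ : ℕ}

/-- Real-valued form of `shortAvg`. -/
def shortAvgReal (G : SimpleGraph (Fin n)) [DecidableRel G.Adj] (ℓ : ℕ) (F : ℕ → Fin n → ℝ)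
    (x : Fin n) : ℝ :=
  ∑ r ∈ Finset.range (lam G ℓ), (1 / (lam G ℓ : ℝ)) *
    ∑ y, (transition G ^ (lam G ℓ + r)) x y * F (lam G ℓ + r) y

theorem shortAvg_ofReal (hlam : 1 ≤ lam G ℓ) {F : ℕ → Fin n → ℝ} (hF : ∀ L y, 0 ≤ F L y)
    (x : Fin n) :
    shortAvg G ℓ (fun L y => ENNReal.ofReal (F L y)) x = ENNReal.ofReal (shortAvgReal G ℓ F x) := by
  have h1 : lam G ℓ - 1 + 1 = lam G ℓ := by omega
  have hpos : (0 : ℝ) < lam G ℓ := by exact_mod_cast hlam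
  have hnn : ∀ r, 0 ≤ ∑ y, (transition G ^ (lam G ℓ + r)) x y * F (lam G ℓ + r) y := fun r =>
    Finset.sum_nonneg fun y _ => mul_nonneg (transition_pow_nonneg _ _ _) (hF _ _)
  rw [shortAvg, shortAvgReal, Fin.sum_univ_eq_sum_range (fun r =>
    ((lam G ℓ - 1 + 1 : ℕ) : ℝ≥0∞)⁻¹ * ∑ y, ENNReal.ofReal ((transition G ^ (lam G ℓ + r)) x y) *
      ENNReal.ofReal (F (lam G ℓ + r) y)), h1,
    ENNReal.ofReal_sum_of_nonneg fun r _ => mul_nonneg (by positivity) (hnn r)]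
  refine Finset.sum_congr rfl fun r _ => ?_
  rw [ENNReal.ofReal_mul (by positivity), one_div, ENNReal.ofReal_inv_of_pos hpos,
    ENNReal.ofReal_natCast, ENNReal.ofReal_sum_of_nonneg
      fun y _ => mul_nonneg (transition_pow_nonneg _ _ _) (hF _ _)]
  congr 1
  refine Finset.sum_congr rfl fun y _ => ?_
  rw [ENNReal.ofReal_mul (transition_pow_nonneg _ _ _)]

theorem shortAvgReal_const (hG : ∀ x, ∃ y, G.Adj x y) (hlam : 1 ≤ lam G ℓ) (c : ℝ) (x : Fin n) :
    shortAvgReal G ℓ (fun _ _ => c) x = c := by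
  have hpos : (0 : ℝ) < lam G ℓ := by exact_mod_cast hlam
  simp only [shortAvgReal, ← Finset.sum_mul, sum_transition_pow hG, one_mul, Finset.sum_const,
    Finset.card_range, nsmul_eq_mul]
  field_simp

theorem shortAvgReal_add (F F' : ℕ → Fin n → ℝ) (x : Fin n) :
    shortAvgReal G ℓ (fun L y => F L y + F' L y) x =
      shortAvgReal G ℓ F x + shortAvgReal G ℓ F' x := by
  simp only [shortAvgReal, mul_add, Finset.sum_add_distrib]

theorem shortAvgReal_const_mul (c : ℝ) (F : ℕ → Fin n → ℝ) (x : Fin n) :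
    shortAvgReal G ℓ (fun L y => c * F L y) x = c * shortAvgReal G ℓ F x := by
  simp only [shortAvgReal, Finset.mul_sum]
  refine Finset.sum_congr rfl fun r _ => Finset.sum_congr rfl fun y _ => by ring

theorem shortAvgReal_sum {κ : Type*} (s : Finset κ) (F : κ → ℕ → Fin n → ℝ) (x : Fin n) :
    shortAvgReal G ℓ (fun L y => ∑ i ∈ s, F i L y) x = ∑ i ∈ s, shortAvgReal G ℓ (F i) x := by
  classical
  induction s using Finset.induction_on with
  | empty => simp [shortAvgReal]
  | insert i s hi ih => simp only [Finset.sum_insert hi, shortAvgReal_add, ih]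

/-- Bound for the expected number of later returns to `v` as end of a short walk, divided by
`deg v`, if the token is at `x` and has completed the length `l`: the lengths of the short walks are
spread out so evenly that no time is the end of a short walk with probability more than `1 / λ`. -/
def farLoad (G : SimpleGraph (Fin n)) [DecidableRel G.Adj] (ℓ : ℕ) (v : Fin n) (l : ℕ)
    (x : Fin n) : ℝ :=
  (1 / (lam G ℓ : ℝ)) * (∑ t ∈ Finset.Ico (lam G ℓ) (ℓ - l + 1), (transition G ^ t) x v) /
    G.degree v

/-- The same with the current position included. -/
def load (G : SimpleGraph (Fin n)) [DecidableRel G.Adj] (ℓ : ℕ) (v : Fin n) (l : ℕ)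
    (x : Fin n) : ℝ :=
  (if x = v then 1 else 0) / G.degree v + farLoad G ℓ v l x

theorem farLoad_nonneg (v : Fin n) (l : ℕ) (x : Fin n) : 0 ≤ farLoad G ℓ v l x :=
  div_nonneg (mul_nonneg (by positivity)
    (Finset.sum_nonneg fun t _ => transition_pow_nonneg t x v)) (Nat.cast_nonneg _)

theorem load_nonneg (v : Fin n) (l : ℕ) (x : Fin n) : 0 ≤ load G ℓ v l x :=
  add_nonneg (div_nonneg (by split_ifs <;> norm_num) (Nat.cast_nonneg _)) (farLoad_nonneg v l x)

theorem farLoad_le_visits (v : Fin n) (l : ℕ) (x : Fin n) :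
    farLoad G ℓ v l x ≤ visits G v (ℓ + 1) x / lam G ℓ / G.degree v := by
  rw [farLoad, visits, one_div_mul_eq_div]
  refine div_le_div_of_nonneg_right (div_le_div_of_nonneg_right ?_ (Nat.cast_nonneg _))
    (Nat.cast_nonneg _)
  refine Finset.sum_le_sum_of_subset_of_nonneg (fun t ht => ?_)
    fun t _ _ => transition_pow_nonneg t x v
  rw [Finset.mem_Ico] at ht
  rw [Finset.mem_range]
  omega

/-- The bound of the load is consistent: averaged over the end of the next short walk, it is at
most the load without the current position. The first short walk ends at each time in `[λ, 2 λ)`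
with probability `1 / λ`, and the times from `2 λ` on are what the later walks contribute. -/
theorem shortAvgReal_load_le (hG : ∀ x, ∃ y, G.Adj x y) (hlam : 1 ≤ lam G ℓ) {l : ℕ}
    (hl : l + 2 * lam G ℓ ≤ ℓ) (v x : Fin n) :
    shortAvgReal G ℓ (fun L y => load G ℓ v (l + L) y) x ≤ farLoad G ℓ v l x := by
  set Λ := lam G ℓ with hΛ
  have hpos : (0 : ℝ) < Λ := by exact_mod_cast hlam
  have hd := degree_pos hG v
  have hcomp : ∀ r, ∑ y, (transition G ^ (Λ + r)) x y * load G ℓ v (l + (Λ + r)) y =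
      ((transition G ^ (Λ + r)) x v + (1 / (Λ : ℝ)) *
        ∑ t ∈ Finset.Ico Λ (ℓ - (l + (Λ + r)) + 1), (transition G ^ (Λ + r + t)) x v) /
          G.degree v := by
    intro r
    have h1 : ∀ y, (transition G ^ (Λ + r)) x y * load G ℓ v (l + (Λ + r)) y =
        ((transition G ^ (Λ + r)) x y * (if y = v then 1 else 0)) / G.degree v +
        (1 / (Λ : ℝ)) * (∑ t ∈ Finset.Ico Λ (ℓ - (l + (Λ + r)) + 1),
          (transition G ^ (Λ + r)) x y * (transition G ^ t) y v) / G.degree v := by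
      intro y
      rw [load, farLoad, ← Finset.mul_sum]
      ring
    simp only [h1, Finset.sum_add_distrib, ← Finset.sum_div]
    rw [← Finset.mul_sum, Finset.sum_comm, add_div]
    congr 2
    · simp
    · congr 1
      refine Finset.sum_congr rfl fun t _ => ?_
      rw [pow_add _ (Λ + r) t, Matrix.mul_apply]
  have hshift : ∀ r, ∑ t ∈ Finset.Ico Λ (ℓ - (l + (Λ + r)) + 1), (transition G ^ (Λ + r + t)) x v ≤
      ∑ t ∈ Finset.Ico (2 * Λ) (ℓ - l + 1), (transition G ^ t) x v := by
    intro r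
    rw [Finset.sum_Ico_add (fun t => (transition G ^ t) x v)]
    refine Finset.sum_le_sum_of_subset_of_nonneg (fun t ht => ?_)
      fun t _ _ => transition_pow_nonneg t x v
    rw [Finset.mem_Ico] at ht ⊢
    omega
  rw [shortAvgReal, ← hΛ, farLoad, ← hΛ]
  simp only [hcomp]
  simp only [← mul_div_assoc, ← Finset.sum_div]
  refine div_le_div_of_nonneg_right ?_ hd.le
  rw [← Finset.mul_sum]
  refine mul_le_mul_of_nonneg_left ?_ (by positivity)
  rw [Finset.sum_add_distrib]
  have h2 : ∑ r ∈ Finset.range Λ, (transition G ^ (Λ + r)) x v =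
      ∑ t ∈ Finset.Ico Λ (2 * Λ), (transition G ^ t) x v := by
    rw [Finset.sum_Ico_eq_sum_range]
    congr 2
    omega
  have h3 : ∑ r ∈ Finset.range Λ, (1 / (Λ : ℝ)) *
      ∑ t ∈ Finset.Ico Λ (ℓ - (l + (Λ + r)) + 1), (transition G ^ (Λ + r + t)) x v ≤
      ∑ t ∈ Finset.Ico (2 * Λ) (ℓ - l + 1), (transition G ^ t) x v := by
    calc _ ≤ ∑ r ∈ Finset.range Λ, (1 / (Λ : ℝ)) *
          ∑ t ∈ Finset.Ico (2 * Λ) (ℓ - l + 1), (transition G ^ t) x v :=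
        Finset.sum_le_sum fun r _ => mul_le_mul_of_nonneg_left (hshift r) (by positivity)
      _ = _ := by
        rw [Finset.sum_const, Finset.card_range, nsmul_eq_mul]
        field_simp
  rw [h2]
  refine (add_le_add_right h3 _).trans (le_of_eq ?_)
  exact Finset.sum_Ico_consecutive _ (by omega) (by omega)

/-- The weight of the load in the potential. A visit of the token multiplies the summand of `v` by
`exp (4 / deg v) ≤ 1 + exp 4 / deg v`; the factor `2` covers the remaining factor `1 + kap · load`,
which is at most `2` after the visit. -/
def kap : ℝ := 2 * Real.exp 4

/-- Potential of the numbers of short walks used; it is at least `1` when a node has used up its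
walks. -/
def usedPot (G : SimpleGraph (Fin n)) [DecidableRel G.Adj] (u : Fin n → ℕ) : ℝ :=
  ∑ v, Real.exp (-4 * Real.log n) * Real.exp (4 * u v / G.degree v)

/-- Potential of a state of the token. It is set to `1` after a failure. -/
def tokPot (G : SimpleGraph (Fin n)) [DecidableRel G.Adj] (ℓ : ℕ) (t : Tok n) : ℝ :=
  if t.failed = true then 1
  else ∑ v, Real.exp (-4 * Real.log n) * Real.exp (4 * t.used v / G.degree v) *
    (1 + kap * load G ℓ v t.len t.pos)

theorem kap_pos : 0 < kap := by unfold kap; positivity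

theorem usedPot_nonneg (u : Fin n → ℕ) : 0 ≤ usedPot G u :=
  Finset.sum_nonneg fun _ _ => by positivity

theorem usedPot_le_tokPot {t : Tok n} (ht : t.failed = false) :
    usedPot G t.used ≤ tokPot G ℓ t := by
  rw [tokPot, if_neg (by simp [ht]), usedPot]
  refine Finset.sum_le_sum fun v _ => le_mul_of_one_le_right (by positivity) ?_
  have := mul_nonneg kap_pos.le (load_nonneg (G := G) (ℓ := ℓ) v t.len t.pos)
  linarith

theorem tokPot_nonneg (t : Tok n) : 0 ≤ tokPot G ℓ t := by
  rw [tokPot]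
  split_ifs
  · norm_num
  · refine Finset.sum_nonneg fun v _ => mul_nonneg (by positivity) ?_
    have := mul_nonneg kap_pos.le (load_nonneg (G := G) (ℓ := ℓ) v t.len t.pos)
    linarith

/-- Convexity of `exp` between `0` and `4`. -/
theorem exp_div_sub_one_le {d : ℝ} (hd : 1 ≤ d) : Real.exp (4 / d) - 1 ≤ Real.exp 4 / d := by
  have h0 : 0 < d := by linarith
  have h := convexOn_exp.2 (Set.mem_univ (4 : ℝ)) (Set.mem_univ 0)
    (by positivity : 0 ≤ 1 / d) (sub_nonneg.2 ((div_le_one h0).2 hd)) (by ring)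
  simp only [smul_eq_mul, mul_zero, add_zero, Real.exp_zero, mul_one] at h
  rw [show 1 / d * 4 = 4 / d by ring, show 1 / d * Real.exp 4 = Real.exp 4 / d by ring] at h
  have : 0 ≤ 1 / d := by positivity
  linarith

/-- The potential is a supermartingale for the stitching loop. If the token leaves `v`, the load of
`v` loses `1 / deg v`, which pays for the growth of the exponential; if the token finds no walk at
`v`, the summand of `v` is at least `1`. -/
theorem tokKernel_tokPot_le (hG : ∀ x, ∃ y, G.Adj x y) (hlam : 1 ≤ lam G ℓ)
    (hε : ∀ v x, kap * (visits G v (ℓ + 1) x / lam G ℓ) ≤ G.degree v) (t : Tok n) :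
    tokKernel G ℓ (fun t => ENNReal.ofReal (tokPot G ℓ t)) t ≤ ENNReal.ofReal (tokPot G ℓ t) := by
  rw [tokKernel]
  split_ifs with hs hu
  · exact le_rfl
  · simp only [Tok.Stopped, not_or, Bool.not_eq_true, not_lt] at hs
    rw [shortAvg_ofReal hlam fun _ _ => tokPot_nonneg _]
    refine ENNReal.ofReal_le_ofReal ?_
    simp only [tokPot, hs.1, Bool.false_eq_true, if_false]
    rw [shortAvgReal_sum]
    refine Finset.sum_le_sum fun v _ => ?_
    simp only [shortAvgReal_const_mul, shortAvgReal_add, shortAvgReal_const hG hlam]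
    have hd := degree_pos hG v
    have hd1 : (1 : ℝ) ≤ G.degree v := by exact_mod_cast (by exact_mod_cast hd : 0 < G.degree v)
    have hk := kap_pos
    have havg := shortAvgReal_load_le hG hlam hs.2 v t.pos
    set a := shortAvgReal G ℓ (fun L y => load G ℓ v (t.len + L) y) t.pos with ha
    set f := farLoad G ℓ v t.len t.pos with hf
    have hf0 : 0 ≤ f := farLoad_nonneg _ _ _
    have hfe : kap * f ≤ 1 := by
      have h1 := farLoad_le_visits (G := G) (ℓ := ℓ) v t.len t.pos
      calc kap * f ≤ kap * (visits G v (ℓ + 1) t.pos / lam G ℓ / G.degree v) :=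
            mul_le_mul_of_nonneg_left h1 hk.le
        _ = kap * (visits G v (ℓ + 1) t.pos / lam G ℓ) / G.degree v := by ring
        _ ≤ 1 := (div_le_one hd).2 (hε v t.pos)
    have hka : kap * a ≤ kap * f := mul_le_mul_of_nonneg_left havg hk.le
    rw [mul_assoc, mul_assoc]
    refine mul_le_mul_of_nonneg_left ?_ (Real.exp_pos _).le
    by_cases hv : v = t.pos
    · subst hv
      rw [Function.update_self, load, if_pos rfl, ← hf]
      have h1 : Real.exp (4 * ((t.used t.pos + 1 : ℕ) : ℝ) / G.degree t.pos) =
          Real.exp (4 * t.used t.pos / G.degree t.pos) * Real.exp (4 / G.degree t.pos) := by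
        rw [← Real.exp_add]
        congr 1
        push_cast
        ring
      rw [h1, mul_assoc]
      refine mul_le_mul_of_nonneg_left ?_ (Real.exp_pos _).le
      have h2 := exp_div_sub_one_le hd1
      have h3 : Real.exp (4 / G.degree t.pos) * (1 + kap * a) ≤
          Real.exp (4 / G.degree t.pos) * (1 + kap * f) :=
        mul_le_mul_of_nonneg_left (by linarith) (Real.exp_pos _).le
      have h4 : (Real.exp (4 / G.degree t.pos) - 1) * (1 + kap * f) ≤
          Real.exp 4 / G.degree t.pos * 2 :=
        mul_le_mul h2 (by linarith) (by positivity) (by positivity)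
      have h5 : Real.exp 4 / G.degree t.pos * 2 = kap * (1 / G.degree t.pos) := by
        rw [kap]; ring
      linarith
    · rw [Function.update_of_ne hv, load, if_neg (Ne.symm hv), ← hf, zero_div, zero_add]
      exact mul_le_mul_of_nonneg_left (by linarith) (Real.exp_pos _).le
  · simp only [Tok.Stopped, not_or, Bool.not_eq_true, not_lt] at hs
    refine ENNReal.ofReal_le_ofReal (le_trans ?_ (usedPot_le_tokPot hs.1))
    rw [tokPot, if_pos rfl, usedPot]
    refine le_trans ?_ (Finset.single_le_sum (fun v _ => by positivity) (Finset.mem_univ t.pos))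
    rw [← Real.exp_add, Real.one_le_exp_iff]
    have hd := degree_pos hG t.pos
    have h1 : (G.degree t.pos : ℝ) * Real.log n ≤ t.used t.pos :=
      (Nat.le_ceil _).trans (by exact_mod_cast not_lt.1 hu)
    have h2 : Real.log n ≤ t.used t.pos / G.degree t.pos := by
      rw [le_div_iff₀ hd]
      linarith
    rw [mul_div_assoc]
    linarith

theorem tokKernel_mono {Ψ Ψ' : Tok n → ℝ≥0∞} (h : Ψ ≤ Ψ') :
    tokKernel G ℓ Ψ ≤ tokKernel G ℓ Ψ' := by
  intro t
  simp only [tokKernel]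
  split_ifs
  · exact h t
  · unfold shortAvg
    gcongr
    exact h _
  · exact h _

theorem tokKernel_iterate_le {Ψ : Tok n → ℝ≥0∞} (h : tokKernel G ℓ Ψ ≤ Ψ) (i : ℕ) :
    (tokKernel G ℓ)^[i] Ψ ≤ Ψ := by
  induction i with
  | zero => exact le_rfl
  | succ i ih =>
    rw [Function.iterate_succ_apply']
    exact (tokKernel_mono ih).trans h

/-- State of the token at the end of the stitching part of a request with source `s`. -/
def tokAfter (ω : Coins G ℓ) (e : ℕ) (s : Fin n) (u : Fin n → ℕ) : Tok n :=
  (tokStep ω e)^[ℓ] ⟨s, 0, u, false⟩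

/-- If request `k` is begun with the walks `u` of table `e` used up, then the table fails in one of
`T` requests. -/
def FailsWithin (ω : Coins G ℓ) (e : ℕ) : ℕ → ℕ → (Fin n → ℕ) → Prop
  | 0, _, _ => False
  | T + 1, k, u => (tokAfter ω e (source ω k) u).failed = true ∨
      FailsWithin ω e T (k + 1) (tokAfter ω e (source ω k) u).used

/-- Growth of the potential in one request with a stationary source. -/
def growth (G : SimpleGraph (Fin n)) [DecidableRel G.Adj] (ℓ : ℕ) : ℝ :=
  1 + kap * ((1 + ℓ / lam G ℓ) / (2 * G.edgeFinset.card))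

theorem one_le_growth : 1 ≤ growth G ℓ := by
  have : 0 ≤ kap * ((1 + (ℓ : ℝ) / lam G ℓ) / (2 * (G.edgeFinset.card : ℕ))) := by
    have := kap_pos
    generalize G.edgeFinset.card = m
    positivity
  unfold growth
  linarith

theorem edges_pos (hG : ∀ x, ∃ y, G.Adj x y) : (0 : ℝ) < G.edgeFinset.card := by
  have : (0 : ℝ) < 2 * G.edgeFinset.card := by
    rw [← sum_degree_real]
    exact Finset.sum_pos (fun y _ => degree_pos hG y) Finset.univ_nonempty
  linarith

theorem stationary_nonneg (s : Fin n) : 0 ≤ stationary G s :=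
  div_nonneg (Nat.cast_nonneg _) (mul_nonneg zero_le_two (Nat.cast_nonneg _))

theorem sum_stationary (hG : ∀ x, ∃ y, G.Adj x y) : ∑ s, stationary G s = 1 := by
  have := edges_pos hG
  simp only [stationary, ← Finset.sum_div, sum_degree_real]
  field_simp

/-- From a stationary source every step is at `v` with probability `deg v / 2 m`. -/
theorem sum_stationary_mul_load_le (hG : ∀ x, ∃ y, G.Adj x y) (hlam : 1 ≤ lam G ℓ) (v : Fin n) :
    ∑ s, stationary G s * load G ℓ v 0 s ≤ (1 + ℓ / lam G ℓ) / (2 * G.edgeFinset.card) := by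
  have hpos : (0 : ℝ) < lam G ℓ := by exact_mod_cast hlam
  have hd := degree_pos hG v
  have hm := edges_pos hG
  have hst : ∀ t, ∑ s, stationary G s * (transition G ^ t) s v = stationary G v := by
    intro t
    simp only [stationary, div_mul_eq_mul_div, ← Finset.sum_div, sum_degree_mul_transition_pow hG]
  have h1 : ∀ s, stationary G s * load G ℓ v 0 s =
      (stationary G s * (if s = v then 1 else 0)) / G.degree v +
      (1 / (lam G ℓ : ℝ)) * (∑ t ∈ Finset.Ico (lam G ℓ) (ℓ - 0 + 1),
        stationary G s * (transition G ^ t) s v) / G.degree v := by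
    intro s
    rw [load, farLoad, ← Finset.mul_sum]
    ring
  simp only [h1, Finset.sum_add_distrib, ← Finset.sum_div]
  rw [← Finset.mul_sum, Finset.sum_comm]
  simp only [hst, mul_ite, mul_one, mul_zero, Finset.sum_ite_eq', Finset.mem_univ, if_true,
    Finset.sum_const, Nat.card_Ico, nsmul_eq_mul]
  have h2 : ((ℓ - 0 + 1 - lam G ℓ : ℕ) : ℝ) ≤ ℓ := by
    exact_mod_cast (by omega : ℓ - 0 + 1 - lam G ℓ ≤ ℓ)
  have h3 : stationary G v / G.degree v = 1 / (2 * G.edgeFinset.card) := by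
    rw [stationary]
    field_simp
  calc stationary G v / G.degree v +
        1 / (lam G ℓ : ℝ) * (((ℓ - 0 + 1 - lam G ℓ : ℕ) : ℝ) * stationary G v) / G.degree v
      = (1 + ((ℓ - 0 + 1 - lam G ℓ : ℕ) : ℝ) / lam G ℓ) * (stationary G v / G.degree v) := by ring
    _ ≤ (1 + ℓ / lam G ℓ) * (stationary G v / G.degree v) := by
        refine mul_le_mul_of_nonneg_right ?_ (by rw [h3]; positivity)
        gcongr
    _ = _ := by rw [h3]; ring

/-- When a request with a stationary source begins, the potential grows at most by the factor
`growth`. -/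
theorem sum_stationary_mul_tokPot_le (hG : ∀ x, ∃ y, G.Adj x y) (hlam : 1 ≤ lam G ℓ)
    (u : Fin n → ℕ) :
    ∑ s, stationary G s * tokPot G ℓ ⟨s, 0, u, false⟩ ≤ usedPot G u * growth G ℓ := by
  simp only [tokPot, Bool.false_eq_true, if_false, Finset.mul_sum, usedPot, Finset.sum_mul]
  rw [Finset.sum_comm]
  refine Finset.sum_le_sum fun v _ => ?_
  have h1 := sum_stationary_mul_load_le (ℓ := ℓ) hG hlam v
  calc _ = Real.exp (-4 * Real.log n) * Real.exp (4 * u v / G.degree v) *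
        (∑ s, stationary G s + kap * ∑ s, stationary G s * load G ℓ v 0 s) := by
        rw [Finset.mul_sum, ← Finset.sum_add_distrib, Finset.mul_sum]
        exact Finset.sum_congr rfl fun s _ => by ring
    _ ≤ _ := by
        refine mul_le_mul_of_nonneg_left ?_ (by positivity)
        rw [sum_stationary hG, growth]
        linarith [mul_le_mul_of_nonneg_left h1 kap_pos.le]

section FailsWithin

variable {k e : ℕ} {π : (x : Fin n) → Equiv.Perm (Fin (numWalks G x))} {u : Fin n → ℕ}

/-- Inductive step for a request with a given source: the bound `ih` for the later requests is
integrated over the state of the token after the stitching part. -/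
theorem measure_inter_failsWithin_succ_le (hG : ∀ x, ∃ y, G.Adj x y) (hlam : 1 ≤ lam G ℓ)
    (hε : ∀ v x, kap * (visits G v (ℓ + 1) x / lam G ℓ) ≤ G.degree v) {T : ℕ}
    (ih : ∀ (u : Fin n → ℕ) (A : Set (Coins G ℓ)),
      IsLocal (revealed (k + 1) e (usedShorts π u)) A → A ⊆ picksEq e π →
      coinMeasure G ℓ (A ∩ {ω | FailsWithin ω e T (k + 1) u}) ≤
        coinMeasure G ℓ A * ENNReal.ofReal (usedPot G u * growth G ℓ ^ T))
    {A : Set (Coins G ℓ)} (hA : IsLocal (revealed (k + 1) e (usedShorts π u)) A)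
    (hπ : A ⊆ picksEq e π) {s : Fin n} (hs : ∀ ω ∈ A, source ω k = s) :
    coinMeasure G ℓ (A ∩ {ω | FailsWithin ω e (T + 1) k u}) ≤
      coinMeasure G ℓ A * ENNReal.ofReal (tokPot G ℓ ⟨s, 0, u, false⟩ * growth G ℓ ^ T) := by
  set f : Coins G ℓ → Tok n := fun ω => (tokStep ω e)^[ℓ] ⟨s, 0, u, false⟩ with hf
  have hρ : 1 ≤ growth G ℓ ^ T := one_le_pow₀ one_le_growth
  have hfm : MeasFibers f := measFibers_tokStep_iterate hG e _ ℓ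
  have key : ∀ t, coinMeasure G ℓ (A ∩ {ω | FailsWithin ω e (T + 1) k u} ∩ f ⁻¹' {t}) ≤
      ENNReal.ofReal (growth G ℓ ^ T) *
        ∫⁻ ω in A ∩ f ⁻¹' {t}, ENNReal.ofReal (tokPot G ℓ (f ω)) ∂(coinMeasure G ℓ) := by
    intro t
    have hAt : IsLocal (revealed (k + 1) e (usedShorts π t.used)) (A ∩ f ⁻¹' {t}) :=
      hA.inter_tokStep_iterate (t := ⟨s, 0, u, false⟩) hG hπ ℓ t
    have hconst : ∫⁻ ω in A ∩ f ⁻¹' {t}, ENNReal.ofReal (tokPot G ℓ (f ω)) ∂(coinMeasure G ℓ) =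
        ENNReal.ofReal (tokPot G ℓ t) * coinMeasure G ℓ (A ∩ f ⁻¹' {t}) := by
      rw [← setLIntegral_const]
      refine setLIntegral_congr_fun hAt.meas ?_
      rintro ω ⟨_, rfl⟩
      rfl
    rw [hconst]
    by_cases ht : t.failed = true
    · have : tokPot G ℓ t = 1 := by rw [tokPot, if_pos ht]
      rw [this, ENNReal.ofReal_one, one_mul]
      refine le_trans (measure_mono ?_) (le_mul_of_one_le_left zero_le
        (by rw [← ENNReal.ofReal_one]; exact ENNReal.ofReal_le_ofReal hρ))
      rintro ω ⟨⟨h1, _⟩, h2⟩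
      exact ⟨h1, h2⟩
    · have hsub : A ∩ {ω | FailsWithin ω e (T + 1) k u} ∩ f ⁻¹' {t} ⊆
          (A ∩ f ⁻¹' {t}) ∩ {ω | FailsWithin ω e T (k + 1) t.used} := by
        rintro ω ⟨⟨h1, h2⟩, h3⟩
        refine ⟨⟨h1, h3⟩, ?_⟩
        have h4 : tokAfter ω e (source ω k) u = t := by
          rw [hs ω h1]
          exact h3
        rcases h2 with h2 | h2
        · rw [h4] at h2
          exact absurd h2 ht
        · rw [h4] at h2
          exact h2
      refine (measure_mono hsub).trans ((ih t.used _ hAt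
        (Set.inter_subset_left.trans hπ)).trans ?_)
      rw [ENNReal.ofReal_mul (usedPot_nonneg _), mul_comm, mul_comm (ENNReal.ofReal (usedPot _ _)),
        mul_assoc]
      gcongr
      exact usedPot_le_tokPot (by simpa using ht)
  calc coinMeasure G ℓ (A ∩ {ω | FailsWithin ω e (T + 1) k u})
      ≤ ∑' t, coinMeasure G ℓ (A ∩ {ω | FailsWithin ω e (T + 1) k u} ∩ f ⁻¹' {t}) :=
        measure_le_tsum_fiber _ _ _
    _ ≤ ∑' t, ENNReal.ofReal (growth G ℓ ^ T) *
        ∫⁻ ω in A ∩ f ⁻¹' {t}, ENNReal.ofReal (tokPot G ℓ (f ω)) ∂(coinMeasure G ℓ) :=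
        ENNReal.tsum_le_tsum key
    _ = ENNReal.ofReal (growth G ℓ ^ T) *
        ∫⁻ ω in A, ENNReal.ofReal (tokPot G ℓ (f ω)) ∂(coinMeasure G ℓ) := by
        rw [ENNReal.tsum_mul_left, ← setLIntegral_eq_tsum_fiber _ hA.meas hfm]
    _ = ENNReal.ofReal (growth G ℓ ^ T) * (coinMeasure G ℓ A *
        (tokKernel G ℓ)^[ℓ] (fun t => ENNReal.ofReal (tokPot G ℓ t)) ⟨s, 0, u, false⟩) := by
        rw [← hA.setLIntegral_tokStep_iterate (t := ⟨s, 0, u, false⟩) hG hπ]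
    _ ≤ ENNReal.ofReal (growth G ℓ ^ T) * (coinMeasure G ℓ A *
        ENNReal.ofReal (tokPot G ℓ ⟨s, 0, u, false⟩)) := by
        gcongr
        exact tokKernel_iterate_le (tokKernel_tokPot_le hG hlam hε) ℓ _
    _ = _ := by
        rw [ENNReal.ofReal_mul (tokPot_nonneg _)]
        ring

theorem src_notMem_revealed {U : Set (Short G)} : CoinIdx.src k ∉ revealed k e U :=
  fun h => lt_irrefl k h

theorem isLocal_source (s : Fin n) {U : Set (Short G)} :
    IsLocal (revealed (k + 1) e U) {ω : Coins G ℓ | source ω k = s} := by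
  refine (IsLocal.eval (X := CoinType G ℓ) (CoinIdx.src k) s).mono ?_
  rintro _ rfl
  exact Nat.lt_succ_self k

/-- Given the history, the table fails in the next `T` requests with probability at most the
potential of the numbers of walks used so far, times the growth. -/
theorem measure_inter_failsWithin_le (hG : ∀ x, ∃ y, G.Adj x y) (hlam : 1 ≤ lam G ℓ)
    (hε : ∀ v x, kap * (visits G v (ℓ + 1) x / lam G ℓ) ≤ G.degree v) (T k : ℕ)
    (u : Fin n → ℕ) (A : Set (Coins G ℓ)) (hA : IsLocal (revealed k e (usedShorts π u)) A)
    (hπ : A ⊆ picksEq e π) :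
    coinMeasure G ℓ (A ∩ {ω | FailsWithin ω e T k u}) ≤
      coinMeasure G ℓ A * ENNReal.ofReal (usedPot G u * growth G ℓ ^ T) := by
  induction T generalizing k u A with
  | zero => simp [FailsWithin]
  | succ T ih =>
    have hg : 0 ≤ growth G ℓ := zero_le_one.trans one_le_growth
    calc coinMeasure G ℓ (A ∩ {ω | FailsWithin ω e (T + 1) k u})
        ≤ ∑' s, coinMeasure G ℓ (A ∩ {ω | FailsWithin ω e (T + 1) k u} ∩
            (fun ω => source ω k) ⁻¹' {s}) := measure_le_tsum_fiber _ _ _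
      _ ≤ ∑' s, coinMeasure G ℓ (A ∩ {ω | source ω k = s}) *
            ENNReal.ofReal (tokPot G ℓ ⟨s, 0, u, false⟩ * growth G ℓ ^ T) := by
          refine ENNReal.tsum_le_tsum fun s => ?_
          refine le_trans (measure_mono ?_) (measure_inter_failsWithin_succ_le hG hlam hε
            (fun u A hA hπ => ih (k + 1) u A hA hπ)
            ((hA.mono (revealed_mono (Nat.le_succ k) subset_rfl)).inter (isLocal_source s))
            (Set.inter_subset_left.trans hπ) fun ω hω => hω.2)
          rintro ω ⟨⟨h1, h2⟩, h3⟩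
          exact ⟨⟨h1, h3⟩, h2⟩
      _ = coinMeasure G ℓ A * ENNReal.ofReal
            ((∑ s, stationary G s * tokPot G ℓ ⟨s, 0, u, false⟩) * growth G ℓ ^ T) := by
          rw [tsum_fintype, Finset.sum_mul, ENNReal.ofReal_sum_of_nonneg fun s _ =>
            mul_nonneg (mul_nonneg (stationary_nonneg s) (tokPot_nonneg _)) (pow_nonneg hg _),
            Finset.mul_sum]
          refine Finset.sum_congr rfl fun s _ => ?_
          rw [hA.measure_inter_source hG src_notMem_revealed, mul_assoc _ _ (growth G ℓ ^ T),
            ENNReal.ofReal_mul (stationary_nonneg s), mul_assoc]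
      _ ≤ _ := by
          refine mul_le_mul_right (ENNReal.ofReal_le_ofReal ?_) _
          rw [pow_succ', ← mul_assoc]
          exact mul_le_mul_of_nonneg_right (sum_stationary_mul_tokPot_le hG hlam u)
            (pow_nonneg hg _)

end FailsWithin

/-- Bound for the probability that a new table fails in one of the first `T` requests. -/
def failBound (G : SimpleGraph (Fin n)) [DecidableRel G.Adj] (ℓ T : ℕ) : ℝ :=
  n * Real.exp (-4 * Real.log n) * (2 + kap) * growth G ℓ ^ T

theorem tokPot_fresh_le (hG : ∀ x, ∃ y, G.Adj x y)
    (hε : ∀ v x, kap * (visits G v (ℓ + 1) x / lam G ℓ) ≤ G.degree v) (s : Fin n) :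
    tokPot G ℓ ⟨s, 0, fun _ => 0, false⟩ ≤ n * Real.exp (-4 * Real.log n) * (2 + kap) := by
  simp only [tokPot, Bool.false_eq_true, if_false]
  have hk := kap_pos
  have : ∀ v : Fin n, Real.exp (-4 * Real.log n) * Real.exp (4 * (0 : ℕ) / G.degree v) *
      (1 + kap * load G ℓ v 0 s) ≤ Real.exp (-4 * Real.log n) * (2 + kap) := by
    intro v
    have hd := degree_pos hG v
    have hd1 : (1 : ℝ) ≤ G.degree v := by exact_mod_cast (by exact_mod_cast hd : 0 < G.degree v)
    rw [Nat.cast_zero, mul_zero, zero_div, Real.exp_zero, mul_one]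
    refine mul_le_mul_of_nonneg_left ?_ (Real.exp_pos _).le
    have h1 := farLoad_le_visits (G := G) (ℓ := ℓ) v 0 s
    have h2 : kap * farLoad G ℓ v 0 s ≤ 1 := by
      calc kap * farLoad G ℓ v 0 s ≤ kap * (visits G v (ℓ + 1) s / lam G ℓ / G.degree v) :=
            mul_le_mul_of_nonneg_left h1 hk.le
        _ = kap * (visits G v (ℓ + 1) s / lam G ℓ) / G.degree v := by ring
        _ ≤ 1 := (div_le_one hd).2 (hε v s)
    have h3 : (if s = v then (1 : ℝ) else 0) / G.degree v ≤ 1 := by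
      rw [div_le_one hd]
      split_ifs <;> linarith
    rw [load, mul_add]
    linarith [mul_le_mul_of_nonneg_left h3 hk.le]
  refine (Finset.sum_le_sum fun v _ => this v).trans (le_of_eq ?_)
  rw [Finset.sum_const, Finset.card_univ, Fintype.card_fin, nsmul_eq_mul, mul_assoc]

/-- A new table is unlikely to fail soon, whatever happened before and whatever the source of the
first request is. -/
theorem measure_inter_fresh_failsWithin_le (hG : ∀ x, ∃ y, G.Adj x y) (hlam : 1 ≤ lam G ℓ)
    (hε : ∀ v x, kap * (visits G v (ℓ + 1) x / lam G ℓ) ≤ G.degree v) (T k e : ℕ)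
    {A : Set (Coins G ℓ)} (hA : IsLocal (revealed (k + 1) e ∅) A) :
    coinMeasure G ℓ (A ∩ {ω | FailsWithin ω e T k fun _ => 0}) ≤
      coinMeasure G ℓ A * ENNReal.ofReal (failBound G ℓ T) := by
  have hg : 0 ≤ growth G ℓ := zero_le_one.trans one_le_growth
  cases T with
  | zero => simp [FailsWithin]
  | succ T =>
    set f : Coins G ℓ → Fin n × ((x : Fin n) → Equiv.Perm (Fin (numWalks G x))) :=
      fun ω => (source ω k, fun x => pickCoin ω e x) with hf
    have hfib : ∀ p, f ⁻¹' {p} = {ω | source ω k = p.1} ∩ picksEq e p.2 := by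
      rintro ⟨s, π⟩
      ext ω
      simp [hf, picksEq, funext_iff]
    have hloc : ∀ p, IsLocal (revealed (k + 1) e ∅) (f ⁻¹' {p}) := by
      intro p
      rw [hfib]
      exact (isLocal_source _).inter (isLocal_picksEq _ _ _ _)
    calc _ ≤ ∑' p, coinMeasure G ℓ (A ∩ {ω | FailsWithin ω e (T + 1) k fun _ => 0} ∩ f ⁻¹' {p}) :=
          measure_le_tsum_fiber _ _ _
      _ ≤ ∑' p, coinMeasure G ℓ (A ∩ f ⁻¹' {p}) * ENNReal.ofReal (failBound G ℓ (T + 1)) := by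
          refine ENNReal.tsum_le_tsum fun p => ?_
          refine le_trans (measure_mono ?_) ((measure_inter_failsWithin_succ_le (π := p.2)
            (u := fun _ => 0) (T := T) (k := k) (e := e) (A := A ∩ f ⁻¹' {p}) hG hlam hε
            (fun u A hA hπ => measure_inter_failsWithin_le hG hlam hε T (k + 1) u A hA hπ)
            ((hA.inter (hloc p)).mono (revealed_mono le_rfl (Set.empty_subset _)))
            (fun ω hω => ((hfib p).subset hω.2).2)
            fun ω hω => ((hfib p).subset hω.2).1).trans ?_)
          · rintro ω ⟨⟨h1, h2⟩, h3⟩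
            exact ⟨⟨h1, h3⟩, h2⟩
          · gcongr
            rw [failBound]
            have h1 := tokPot_fresh_le hG hε p.1
            have h2 : growth G ℓ ^ T ≤ growth G ℓ ^ (T + 1) :=
              pow_le_pow_right₀ one_le_growth (Nat.le_succ T)
            exact mul_le_mul h1 h2 (pow_nonneg hg _) ((tokPot_nonneg _).trans h1)
      _ = _ := by
          rw [ENNReal.tsum_mul_right, ← measure_eq_tsum_fiber _ hA.meas fun p => (hloc p).meas]

end Potential

/-! ### A martingale for the end of the walk -/

section Run

variable {n : ℕ} [NeZero n] {G : SimpleGraph (Fin n)} [DecidableRel G.Adj] {ℓ : ℕ}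

/-- Chapman–Kolmogorov: a short walk followed by an exact walk for the remaining length. -/
theorem shortAvgReal_transition_pow (hG : ∀ x, ∃ y, G.Adj x y) (hlam : 1 ≤ lam G ℓ) {l : ℕ}
    (hl : l + 2 * lam G ℓ ≤ ℓ) (v x : Fin n) :
    shortAvgReal G ℓ (fun L y => (transition G ^ (ℓ - (l + L))) y v) x =
      (transition G ^ (ℓ - l)) x v := by
  rw [← shortAvgReal_const hG hlam ((transition G ^ (ℓ - l)) x v) x]
  simp only [shortAvgReal]
  refine Finset.sum_congr rfl fun r hr => ?_
  have := Finset.mem_range.1 hr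
  rw [← Matrix.mul_apply, ← pow_add, ← Finset.sum_mul, sum_transition_pow hG, one_mul,
    show lam G ℓ + r + (ℓ - (l + (lam G ℓ + r))) = ℓ - l by omega]

/-- The probability that the walk, continued exactly, ends at `v`, is a martingale for the stitching
loop. -/
theorem tokKernel_transition (hG : ∀ x, ∃ y, G.Adj x y) (hlam : 1 ≤ lam G ℓ) (v : Fin n) :
    tokKernel G ℓ (fun t => ENNReal.ofReal ((transition G ^ (ℓ - t.len)) t.pos v)) =
      fun t => ENNReal.ofReal ((transition G ^ (ℓ - t.len)) t.pos v) := by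
  funext t
  rw [tokKernel]
  split_ifs with hs hu
  · rfl
  · simp only [Tok.Stopped, not_or, not_lt] at hs
    rw [shortAvg_ofReal hlam fun _ _ => transition_pow_nonneg _ _ _,
      shortAvgReal_transition_pow hG hlam hs.2]
  · rfl

theorem IsLocal.setLIntegral_transition_tokAfter (hG : ∀ x, ∃ y, G.Adj x y) (hlam : 1 ≤ lam G ℓ)
    {k e : ℕ} {π : (x : Fin n) → Equiv.Perm (Fin (numWalks G x))} {u : Fin n → ℕ}
    {A : Set (Coins G ℓ)} (hA : IsLocal (revealed k e (usedShorts π u)) A) (hπ : A ⊆ picksEq e π)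
    (s v : Fin n) :
    ∫⁻ ω in A, ENNReal.ofReal ((transition G ^ (ℓ - (tokAfter ω e s u).len))
      (tokAfter ω e s u).pos v) ∂(coinMeasure G ℓ) =
      coinMeasure G ℓ A * ENNReal.ofReal ((transition G ^ ℓ) s v) := by
  have := hA.setLIntegral_tokStep_iterate (t := ⟨s, 0, u, false⟩) hG hπ ℓ
    fun t => ENNReal.ofReal ((transition G ^ (ℓ - t.len)) t.pos v)
  rw [Function.iterate_fixed (tokKernel_transition hG hlam v)] at this
  exact this

theorem IsLocal.measure_inter_naivePos (hG : ∀ x, ∃ y, G.Adj x y) {k e : ℕ} {U : Set (Short G)}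
    {A : Set (Coins G ℓ)} (hA : IsLocal (revealed k e U) A) (e' k' : ℕ) (x : Fin n) (T : ℕ)
    (y : Fin n) :
    coinMeasure G ℓ (A ∩ {ω | naivePos ω e' k' x T = y}) =
      coinMeasure G ℓ A * ENNReal.ofReal ((transition G ^ T) x y) :=
  (isCoinWalk_naivePos hG e' k' x).measure_inter hA T (fun _ _ _ h => h) y

theorem measurableSet_naivePos (hG : ∀ x, ∃ y, G.Adj x y) (e k : ℕ) (x : Fin n) (T : ℕ)
    (y : Fin n) : MeasurableSet {ω : Coins G ℓ | naivePos ω e k x T = y} :=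
  ((isCoinWalk_naivePos hG e k x).isLocal T y).meas

/-! ### The sequence of attempts -/

/-- The transcript forgotten. -/
def TokenState.toTok (st : TokenState G) : Tok n := ⟨st.pos, st.len, st.used, st.failed⟩

theorem toTok_stitch (ω : Coins G ℓ) (e : ℕ) (s : Fin n) (st : TokenState G) :
    (stitch ω e s st).toTok = tokStep ω e st.toTok := by
  by_cases hs : st.failed = true ∨ ℓ < st.len + 2 * lam G ℓ
  · have hs' : st.toTok.Stopped ℓ G := hs
    rw [stitch, tokStep, if_pos hs, if_pos hs']
  · have hs' : ¬ st.toTok.Stopped ℓ G := hs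
    rw [stitch, tokStep, if_neg hs, if_neg hs']
    by_cases hu : st.used st.pos < numWalks G st.pos
    · rw [dif_pos hu, dif_pos (show st.toTok.used st.toTok.pos < numWalks G st.toTok.pos from hu)]
      rfl
    · rw [dif_neg hu, dif_neg (show ¬ st.toTok.used st.toTok.pos < numWalks G st.toTok.pos from hu)]
      rfl

theorem toTok_stitched (ω : Coins G ℓ) (st : RunState n) :
    (stitched ω st).toTok = tokAfter ω st.table (source ω st.req) st.used := by
  have : ∀ i (t : TokenState G), ((stitch ω st.table (source ω st.req))^[i] t).toTok =
      (tokStep ω st.table)^[i] t.toTok := by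
    intro i
    induction i with
    | zero => exact fun t => rfl
    | succ i ih =>
      intro t
      rw [Function.iterate_succ_apply, Function.iterate_succ_apply, ih, toTok_stitch]
  exact this ℓ _

theorem fails_iff (ω : Coins G ℓ) (st : RunState n) :
    Fails ω st ↔ (tokAfter ω st.table (source ω st.req) st.used).failed = true := by
  rw [← toTok_stitched]
  rfl

theorem endpoint_eq (ω : Coins G ℓ) (st : RunState n) :
    endpoint ω st = naivePos ω st.table st.req (tokAfter ω st.table (source ω st.req) st.used).pos
      (ℓ - (tokAfter ω st.table (source ω st.req) st.used).len) := by
  rw [← toTok_stitched]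
  rfl

instance : Countable (RunState n) := by
  refine Function.Injective.countable (f := fun t : RunState n => (t.req, t.table, t.used)) ?_
  rintro ⟨⟩ ⟨⟩ h
  simpa using h

/-- The state after an attempt that begins in the state `st`, if the token ends in the state `t`. -/
def RunState.next (st : RunState n) (t : Tok n) : RunState n :=
  if t.failed = true then ⟨st.req, st.table + 1, fun _ => 0⟩ else ⟨st.req + 1, st.table, t.used⟩

theorem runNext_eq (ω : Coins G ℓ) (st : RunState n) :
    runNext ω st = st.next (tokAfter ω st.table (source ω st.req) st.used) := by
  rw [runNext, RunState.next, fails_iff, ← toTok_stitched]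
  congr

theorem runNext_of_fails {ω : Coins G ℓ} {st : RunState n} (h : Fails ω st) :
    runNext ω st = ⟨st.req, st.table + 1, fun _ => 0⟩ := if_pos h

theorem runNext_of_not_fails {ω : Coins G ℓ} {st : RunState n} (h : ¬ Fails ω st) :
    runNext ω st = ⟨st.req + 1, st.table, (stitched ω st).used⟩ := if_neg h

/-- Every attempt advances either the request or the table. -/
theorem req_add_table_iterate (ω : Coins G ℓ) (st : RunState n) (a : ℕ) :
    ((runNext ω)^[a] st).req + ((runNext ω)^[a] st).table = st.req + st.table + a := by
  induction a with
  | zero => rfl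
  | succ a ih =>
    rw [Function.iterate_succ_apply']
    by_cases h : Fails ω ((runNext ω)^[a] st)
    · rw [runNext_of_fails h]
      simp only
      omega
    · rw [runNext_of_not_fails h]
      simp only
      omega

theorem req_mono (ω : Coins G ℓ) (st : RunState n) :
    Monotone fun a => ((runNext ω)^[a] st).req := by
  refine monotone_nat_of_le_succ fun a => ?_
  rw [Function.iterate_succ_apply']
  by_cases h : Fails ω ((runNext ω)^[a] st)
  · rw [runNext_of_fails h]
  · rw [runNext_of_not_fails h]
    exact Nat.le_succ _

theorem table_mono (ω : Coins G ℓ) (st : RunState n) :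
    Monotone fun a => ((runNext ω)^[a] st).table := by
  refine monotone_nat_of_le_succ fun a => ?_
  rw [Function.iterate_succ_apply']
  by_cases h : Fails ω ((runNext ω)^[a] st)
  · rw [runNext_of_fails h]
    exact Nat.le_succ _
  · rw [runNext_of_not_fails h]

/-- Up to the choice of the orders, the event `A` is decided by the coins seen before the state `st`
and the source of the request of `st`. -/
def RunLocal (st : RunState n) (A : Set (Coins G ℓ)) : Prop :=
  ∀ π, IsLocal (revealed (st.req + 1) st.table (usedShorts π st.used)) (A ∩ picksEq st.table π)

/-- The same without the source of the request of `st`. -/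
def RunStart (st : RunState n) (A : Set (Coins G ℓ)) : Prop :=
  ∀ π, IsLocal (revealed st.req st.table (usedShorts π st.used)) (A ∩ picksEq st.table π)

theorem RunStart.runLocal {st : RunState n} {A : Set (Coins G ℓ)} (h : RunStart st A) :
    RunLocal st A := fun π => (h π).mono (revealed_mono (Nat.le_succ _) subset_rfl)

theorem iUnion_inter_picksEq (e : ℕ) (A : Set (Coins G ℓ)) : ⋃ π, A ∩ picksEq e π = A := by
  ext ω
  simp only [Set.mem_iUnion, Set.mem_inter_iff]
  exact ⟨fun ⟨_, h⟩ => h.1, fun h => ⟨fun x => pickCoin ω e x, h, fun _ => rfl⟩⟩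

theorem RunLocal.meas {st : RunState n} {A : Set (Coins G ℓ)} (h : RunLocal st A) :
    MeasurableSet A := by
  rw [← iUnion_inter_picksEq st.table A]
  exact .iUnion fun π => (h π).meas

theorem usedShorts_zero (π : (x : Fin n) → Equiv.Perm (Fin (numWalks G x))) :
    usedShorts π (fun _ => 0) = ∅ := by
  ext w
  simp [usedShorts]

/-- For a new table no short walk is revealed, so the orders in it need not be fixed. -/
theorem RunLocal.isLocal_fresh {k e : ℕ} {A : Set (Coins G ℓ)}
    (h : RunLocal ⟨k, e, fun _ => 0⟩ A) : IsLocal (revealed (k + 1) e ∅) A := by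
  rw [← iUnion_inter_picksEq e A]
  refine IsLocal.iUnion fun π => ?_
  have := h π
  rwa [usedShorts_zero] at this

theorem runStart_univ : RunStart (ℓ := ℓ) (G := G) ⟨0, 0, fun _ => 0⟩ Set.univ := by
  intro π
  rw [Set.univ_inter]
  exact isLocal_picksEq _ _ _ _

/-- The attempt from `st` with given orders, source and final state of the token. -/
theorem RunLocal.cell (hG : ∀ x, ∃ y, G.Adj x y) {st : RunState n} {A : Set (Coins G ℓ)}
    (h : RunLocal st A) (π : (x : Fin n) → Equiv.Perm (Fin (numWalks G x))) (s : Fin n)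
    (t : Tok n) :
    IsLocal (revealed (st.req + 1) st.table (usedShorts π t.used))
      (A ∩ picksEq st.table π ∩ {ω | source ω st.req = s} ∩
        {ω | tokAfter ω st.table s st.used = t}) :=
  IsLocal.inter_tokStep_iterate (t := ⟨s, 0, st.used, false⟩) hG
    ((h π).inter (isLocal_source s)) (Set.inter_subset_left.trans Set.inter_subset_right) ℓ t

/-- The history after one attempt is local again. If the attempt succeeds, the source of the next
request is still unknown; if it fails, the request and its source stay, and the new table is
untouched. -/
theorem RunLocal.inter_runNext (hG : ∀ x, ∃ y, G.Adj x y) {st : RunState n} {A : Set (Coins G ℓ)}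
    (h : RunLocal st A) (st' : RunState n) :
    RunLocal st' (A ∩ {ω | runNext ω st = st'}) ∧
      (st.req < st'.req → RunStart st' (A ∩ {ω | runNext ω st = st'})) := by
  have hempty : (∀ t : Tok n, st.next t ≠ st') →
      A ∩ {ω | runNext ω st = st'} = ∅ := by
    intro hne
    ext ω
    simp only [Set.mem_inter_iff, Set.mem_ofPred_eq, Set.mem_empty_iff_false, iff_false, not_and,
      runNext_eq]
    exact fun _ => hne _
  by_cases h1 : ∃ u, st' = ⟨st.req + 1, st.table, u⟩
  · obtain ⟨u, rfl⟩ := h1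
    have : RunStart (ℓ := ℓ) (G := G) ⟨st.req + 1, st.table, u⟩
        (A ∩ {ω | runNext ω st = ⟨st.req + 1, st.table, u⟩}) := by
      intro π
      have hU : A ∩ {ω | runNext ω st = ⟨st.req + 1, st.table, u⟩} ∩ picksEq st.table π =
          ⋃ s, ⋃ t : {t : Tok n // t.used = u ∧ t.failed = false}, A ∩ picksEq st.table π ∩
            {ω | source ω st.req = s} ∩ {ω | tokAfter ω st.table s st.used = t.1} := by
        ext ω
        simp only [Set.mem_inter_iff, Set.mem_ofPred_eq, Set.mem_iUnion, runNext_eq,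
          RunState.next]
        constructor
        · rintro ⟨⟨h1, h2⟩, h3⟩
          refine ⟨_, ⟨tokAfter ω st.table (source ω st.req) st.used, ?_⟩, ⟨⟨h1, h3⟩, rfl⟩, rfl⟩
          split_ifs at h2 with h4
          · simp at h2
          · simp only [RunState.mk.injEq, true_and] at h2
            exact ⟨h2, by simpa using h4⟩
        · rintro ⟨s, ⟨t, ht, ht'⟩, ⟨⟨h1, h3⟩, rfl⟩, rfl⟩
          refine ⟨⟨h1, ?_⟩, h3⟩
          rw [if_neg (by simp [ht']), ht]
      rw [hU]
      refine IsLocal.iUnion fun s => IsLocal.iUnion fun t => ?_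
      have := h.cell hG π s t.1
      rwa [t.2.1] at this
    exact ⟨this.runLocal, fun _ => this⟩
  by_cases h2 : st' = ⟨st.req, st.table + 1, fun _ => 0⟩
  · subst h2
    refine ⟨?_, fun h => absurd h (lt_irrefl _)⟩
    intro π'
    have hU : A ∩ {ω | runNext ω st = ⟨st.req, st.table + 1, fun _ => 0⟩} =
        ⋃ π, ⋃ s, ⋃ t : {t : Tok n // t.failed = true}, A ∩ picksEq st.table π ∩
            {ω | source ω st.req = s} ∩ {ω | tokAfter ω st.table s st.used = t.1} := by
      ext ω
      simp only [Set.mem_inter_iff, Set.mem_ofPred_eq, Set.mem_iUnion, runNext_eq,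
        RunState.next]
      constructor
      · rintro ⟨h1, h2⟩
        refine ⟨fun x => pickCoin ω st.table x, _,
          ⟨tokAfter ω st.table (source ω st.req) st.used, ?_⟩, ⟨⟨h1, fun x => rfl⟩, rfl⟩, rfl⟩
        split_ifs at h2 with h4
        · exact h4
        · simp at h2
      · rintro ⟨π, s, ⟨t, ht⟩, ⟨⟨h1, h3⟩, rfl⟩, rfl⟩
        refine ⟨h1, ?_⟩
        rw [if_pos ht]
    refine IsLocal.inter ?_ (isLocal_picksEq _ _ _ _)
    rw [hU]
    refine IsLocal.iUnion fun π => IsLocal.iUnion fun s => IsLocal.iUnion fun t => ?_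
    exact (h.cell hG π s t.1).mono (revealed_table_mono le_rfl (Nat.lt_succ_self _))
  · rw [hempty]
    · exact ⟨fun π => by simpa using IsLocal.univ.compl,
        fun _ π => by simpa using IsLocal.univ.compl⟩
    · intro t ht
      rw [RunState.next] at ht
      split_ifs at ht
      · exact h2 ht.symm
      · exact h1 ⟨_, ht.symm⟩

theorem RunLocal.inter_iterate (hG : ∀ x, ∃ y, G.Adj x y) {st : RunState n} {A : Set (Coins G ℓ)}
    (h : RunLocal st A) (a : ℕ) (st' : RunState n) :
    RunLocal st' (A ∩ {ω | (runNext ω)^[a] st = st'}) := by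
  induction a generalizing st A with
  | zero =>
    by_cases hst : st = st'
    · subst hst
      simpa using h
    · intro π
      simpa [hst] using IsLocal.univ.compl
  | succ a ih =>
    have : A ∩ {ω | (runNext ω)^[a + 1] st = st'} =
        ⋃ st₁, (A ∩ {ω | runNext ω st = st₁}) ∩ {ω | (runNext ω)^[a] st₁ = st'} := by
      ext ω
      simp
    rw [this]
    intro π
    rw [Set.iUnion_inter]
    exact IsLocal.iUnion fun st₁ => ih (h.inter_runNext hG st₁).1 π

theorem runLocal_run (hG : ∀ x, ∃ y, G.Adj x y) (a : ℕ) (st : RunState n) :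
    RunLocal st {ω : Coins G ℓ | run ω a = st} := by
  have := runStart_univ.runLocal.inter_iterate (ℓ := ℓ) hG a st
  rwa [Set.univ_inter] at this

theorem measFibers_run (hG : ∀ x, ∃ y, G.Adj x y) (a : ℕ) :
    MeasFibers fun ω : Coins G ℓ => run ω a := fun st => (runLocal_run hG a st).meas

theorem run_succ (ω : Coins G ℓ) (a : ℕ) : run ω (a + 1) = runNext ω (run ω a) :=
  Function.iterate_succ_apply' _ _ _

/-- Attempt `a` is the first one for request `k`. -/
def FirstAt (ω : Coins G ℓ) (k : ℕ) : ℕ → Prop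
  | 0 => k = 0
  | a + 1 => (run ω a).req < k ∧ (run ω (a + 1)).req = k

theorem FirstAt.req {ω : Coins G ℓ} {k a : ℕ} (h : FirstAt ω k a) : (run ω a).req = k := by
  cases a with
  | zero => exact h.symm
  | succ a => exact h.2

theorem FirstAt.le {ω : Coins G ℓ} {k a a' : ℕ} (h : FirstAt ω k a) (h' : (run ω a').req = k) :
    a ≤ a' := by
  cases a with
  | zero => exact Nat.zero_le _
  | succ a =>
    by_contra hlt
    have := req_mono ω ⟨0, 0, fun _ => 0⟩ (show a' ≤ a by omega)
    have h1 := h.1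
    change (run ω a').req ≤ (run ω a).req at this
    omega

theorem FirstAt.unique {ω : Coins G ℓ} {k a a' : ℕ} (h : FirstAt ω k a) (h' : FirstAt ω k a') :
    a = a' := le_antisymm (h.le h'.req) (h'.le h.req)

theorem exists_firstAt {ω : Coins G ℓ} {k a : ℕ} (h : (run ω a).req = k) :
    ∃ a', FirstAt ω k a' := by
  have hex : ∃ a, (run ω a).req = k := ⟨a, h⟩
  refine ⟨Nat.find hex, ?_⟩
  have h1 := Nat.find_spec hex
  have h2 := fun b hb => Nat.find_min hex (m := b) hb
  generalize Nat.find hex = b at h1 h2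
  cases b with
  | zero => exact h1.symm
  | succ b =>
    refine ⟨lt_of_le_of_ne ?_ (h2 b (Nat.lt_succ_self b)), h1⟩
    rw [← h1]
    exact req_mono ω ⟨0, 0, fun _ => 0⟩ (Nat.le_succ b)

/-- What precedes the first attempt for a request is independent of its source. -/
theorem runStart_firstAt (hG : ∀ x, ∃ y, G.Adj x y) (k a : ℕ) (st : RunState n)
    (hst : st.req = k) :
    RunStart st {ω : Coins G ℓ | FirstAt ω k a ∧ run ω a = st} := by
  cases a with
  | zero =>
    by_cases h : k = 0 ∧ (⟨0, 0, fun _ => 0⟩ : RunState n) = st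
    · obtain ⟨rfl, rfl⟩ := h
      convert runStart_univ (ℓ := ℓ) (G := G) using 1
      ext ω
      simp only [Set.mem_ofPred_eq, Set.mem_univ, iff_true]
      exact ⟨rfl, rfl⟩
    · have : {ω : Coins G ℓ | FirstAt ω k 0 ∧ run ω 0 = st} = ∅ := by
        ext ω
        simp only [Set.mem_ofPred_eq, Set.mem_empty_iff_false, iff_false]
        exact h
      rw [this]
      intro π
      simpa using IsLocal.univ.compl
  | succ a =>
    have : {ω : Coins G ℓ | FirstAt ω k (a + 1) ∧ run ω (a + 1) = st} =
        ⋃ st₁ : {st₁ : RunState n // st₁.req < st.req},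
          {ω | run ω a = st₁.1} ∩ {ω | runNext ω st₁.1 = st} := by
      ext ω
      simp only [Set.mem_ofPred_eq, FirstAt, run_succ, Set.mem_iUnion, Set.mem_inter_iff]
      constructor
      · rintro ⟨⟨h1, h2⟩, h3⟩
        exact ⟨⟨run ω a, by omega⟩, rfl, h3⟩
      · rintro ⟨⟨st₁, h1⟩, rfl, h3⟩
        refine ⟨⟨by simpa [← hst] using h1, by rw [h3, hst]⟩, h3⟩
    rw [this]
    intro π
    rw [Set.iUnion_inter]
    exact IsLocal.iUnion fun st₁ => ((runLocal_run hG a st₁.1).inter_runNext hG st).2 st₁.2 π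

end Run

/-! ### The number of tables -/

section Tables

variable {n : ℕ} [NeZero n] {G : SimpleGraph (Fin n)} [DecidableRel G.Adj] {ℓ : ℕ}

/-- Starting from `st`, at least `E` more tables are built before request `K` is begun. -/
def Reaches (ω : Coins G ℓ) (st : RunState n) (E K : ℕ) : Prop :=
  ∃ a, st.table + E ≤ ((runNext ω)^[a] st).table ∧ ((runNext ω)^[a] st).req < K

theorem Reaches.anti {ω : Coins G ℓ} {st : RunState n} {E E' K : ℕ} (h : Reaches ω st E K)
    (hE : E' ≤ E) : Reaches ω st E' K := by
  obtain ⟨a, h1, h2⟩ := h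
  exact ⟨a, by omega, h2⟩

/-- A table that is given up after at most `T` attempts fails within `T` requests. -/
theorem failsWithin_of_table_ne {ω : Coins G ℓ} {e i T k : ℕ} {u : Fin n → ℕ} (hi : i < T)
    (h : ((runNext ω)^[i + 1] ⟨k, e, u⟩).table ≠ e) : FailsWithin ω e T k u := by
  induction T generalizing i k u with
  | zero => omega
  | succ T ih =>
    by_cases hf : Fails ω ⟨k, e, u⟩
    · exact Or.inl ((fails_iff ω _).1 hf)
    · right
      rw [Function.iterate_succ_apply, runNext_of_not_fails hf] at h
      cases i with
      | zero => exact absurd rfl h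
      | succ i =>
        have := ih (by omega) h
        convert this using 1
        exact congrArg Tok.used (toTok_stitched ω ⟨k, e, u⟩).symm

/-- If a later table is reached, the table `e` is given up after some `i` successful requests. -/
theorem exists_first_rebuild {ω : Coins G ℓ} {k e a : ℕ} {u : Fin n → ℕ}
    (h : e < ((runNext ω)^[a] ⟨k, e, u⟩).table) :
    ∃ i < a, ((runNext ω)^[i] ⟨k, e, u⟩).table = e ∧
      (runNext ω)^[i + 1] ⟨k, e, u⟩ = ⟨k + i, e + 1, fun _ => 0⟩ := by
  induction a with
  | zero => exact absurd h (lt_irrefl _)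
  | succ a ih =>
    by_cases h' : e < ((runNext ω)^[a] ⟨k, e, u⟩).table
    · obtain ⟨i, hi, h⟩ := ih h'
      exact ⟨i, by omega, h⟩
    · refine ⟨a, Nat.lt_succ_self a, ?_⟩
      have h1 := req_add_table_iterate ω ⟨k, e, u⟩ a
      have h2 := table_mono ω ⟨k, e, u⟩ (Nat.zero_le a)
      change e ≤ ((runNext ω)^[a] ⟨k, e, u⟩).table at h2
      simp only at h1
      refine ⟨by omega, ?_⟩
      rw [Function.iterate_succ_apply'] at h ⊢
      by_cases hf : Fails ω ((runNext ω)^[a] ⟨k, e, u⟩)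
      · rw [runNext_of_fails hf]
        have h3 : ((runNext ω)^[a] ⟨k, e, u⟩).table = e := by omega
        rw [h3, show ((runNext ω)^[a] ⟨k, e, u⟩).req = k + a by omega]
      · rw [runNext_of_not_fails hf] at h
        exact absurd h h'

/-- Tables are split off one by one. A table that serves `i` requests gets the weight `z ^ i`,
which makes a short life expensive: the expected weight of one table is at most
`q + z ^ T ≤ 1 / 4`, from the cases that it fails within `T` requests or survives them. -/
theorem measure_inter_reaches_le (hG : ∀ x, ∃ y, G.Adj x y) {T : ℕ} {q z : ℝ≥0∞} (hz : z ≤ 1)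
    (hq : ∀ (e k : ℕ) (A : Set (Coins G ℓ)), IsLocal (revealed (k + 1) e ∅) A →
      coinMeasure G ℓ (A ∩ {ω | FailsWithin ω e T k fun _ => 0}) ≤ coinMeasure G ℓ A * q)
    (hqz : q + z ^ T ≤ 1 / 4) (E K k e : ℕ) {A : Set (Coins G ℓ)}
    (hA : RunLocal ⟨k, e, fun _ => 0⟩ A) :
    coinMeasure G ℓ (A ∩ {ω | Reaches ω ⟨k, e, fun _ => 0⟩ E K}) * z ^ K ≤
      coinMeasure G ℓ A * ((1 / 4) ^ E * z ^ k) := by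
  induction E generalizing k e A with
  | zero =>
    by_cases hk : k < K
    · rw [pow_zero, one_mul]
      exact mul_le_mul' (measure_mono Set.inter_subset_left) (pow_le_pow_right_of_le_one' hz hk.le)
    · have : A ∩ {ω | Reaches ω ⟨k, e, fun _ => 0⟩ 0 K} = ∅ := by
        ext ω
        simp only [Set.mem_inter_iff, Set.mem_ofPred_eq, Set.mem_empty_iff_false, iff_false,
          not_and]
        rintro _ ⟨a, _, h⟩
        have := req_mono ω ⟨k, e, fun _ => 0⟩ (Nat.zero_le a)
        change k ≤ ((runNext ω)^[a] ⟨k, e, fun _ => 0⟩).req at this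
        omega
      rw [this, measure_empty, zero_mul]
      exact zero_le
  | succ E ih =>
    set st : RunState n := ⟨k, e, fun _ => 0⟩ with hst
    -- `B i`: the table `e` is given up after it has served exactly `i` requests.
    set B : ℕ → Set (Coins G ℓ) := fun i => A ∩ {ω | ((runNext ω)^[i] st).table = e ∧
      (runNext ω)^[i + 1] st = ⟨k + i, e + 1, fun _ => 0⟩} with hB
    have hBl : ∀ i, RunLocal ⟨k + i, e + 1, fun _ => 0⟩ (B i) := by
      intro i π
      have : B i = ⋃ st₁ : {st₁ : RunState n // st₁.table = e},
          A ∩ {ω | (runNext ω)^[i] st = st₁.1} ∩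
            {ω | runNext ω st₁.1 = ⟨k + i, e + 1, fun _ => 0⟩} := by
        ext ω
        simp only [hB, Set.mem_inter_iff, Set.mem_ofPred_eq, Set.mem_iUnion,
          Function.iterate_succ_apply']
        constructor
        · rintro ⟨h1, h2, h3⟩
          exact ⟨⟨_, h2⟩, ⟨h1, rfl⟩, h3⟩
        · rintro ⟨⟨st₁, h2⟩, ⟨h1, rfl⟩, h3⟩
          exact ⟨h1, h2, h3⟩
      rw [this, Set.iUnion_inter]
      exact IsLocal.iUnion fun st₁ => ((hA.inter_iterate hG i st₁.1).inter_runNext hG _).1 π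
    have hdisj : Pairwise (Function.onFun Disjoint B) := by
      have hlt : ∀ i j ω, i < j → ω ∈ B i → ω ∉ B j := by
        rintro i j ω hij ⟨_, _, h1⟩ ⟨_, h2, _⟩
        have h3 := table_mono ω st (show i + 1 ≤ j from hij)
        simp only [h1, h2] at h3
        omega
      intro i j hij
      rw [Function.onFun, Set.disjoint_left]
      intro ω h1 h2
      rcases Nat.lt_or_gt_of_ne hij with h | h
      · exact hlt i j ω h h1 h2
      · exact hlt j i ω h h2 h1
    have hBm : ∀ i, MeasurableSet (B i) := fun i => (hBl i).meas
    have hsub : A ∩ {ω | Reaches ω st (E + 1) K} ⊆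
        ⋃ i, B i ∩ {ω | Reaches ω ⟨k + i, e + 1, fun _ => 0⟩ E K} := by
      rintro ω ⟨h1, a, h2, h3⟩
      obtain ⟨i, hi, h4', h4⟩ := exists_first_rebuild (ω := ω) (k := k) (e := e) (a := a)
        (u := fun _ => 0) (lt_of_lt_of_le (by change e < e + (E + 1); omega) h2)
      refine Set.mem_iUnion.2 ⟨i, ⟨h1, h4', h4⟩, a - (i + 1), ?_⟩
      have h5 : (runNext ω)^[a] st =
          (runNext ω)^[a - (i + 1)] ⟨k + i, e + 1, fun _ => 0⟩ := by
        rw [← h4, ← Function.iterate_add_apply, Nat.sub_add_cancel hi]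
      rw [h5] at h2 h3
      refine ⟨?_, h3⟩
      change e + (E + 1) ≤ _ at h2
      change e + 1 + E ≤ _
      omega
    have hsum : ∑' i, coinMeasure G ℓ (B i) * z ^ i ≤ coinMeasure G ℓ A * (1 / 4) := by
      have h1 : ∀ i, coinMeasure G ℓ (B i) * z ^ i ≤
          coinMeasure G ℓ (B i ∩ {ω | FailsWithin ω e T k fun _ => 0}) +
            coinMeasure G ℓ (B i) * z ^ T := by
        intro i
        rcases lt_or_ge i T with h | h
        · have : B i ⊆ {ω | FailsWithin ω e T k fun _ => 0} := by
            rintro ω ⟨_, _, h2⟩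
            refine failsWithin_of_table_ne h ?_
            rw [show ((⟨k, e, fun _ => 0⟩ : RunState n)) = st from rfl,
              show (runNext ω)^[i + 1] st = _ from h2]
            simp
          rw [Set.inter_eq_left.2 this]
          exact le_add_right (mul_le_of_le_one_right' (pow_le_one' hz i))
        · exact le_add_left (mul_le_mul_right (pow_le_pow_right_of_le_one' hz h) _)
      have hBA : ⋃ i, B i ⊆ A := Set.iUnion_subset fun i => Set.inter_subset_left
      calc ∑' i, coinMeasure G ℓ (B i) * z ^ i
          ≤ ∑' i, (coinMeasure G ℓ (B i ∩ {ω | FailsWithin ω e T k fun _ => 0}) +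
            coinMeasure G ℓ (B i) * z ^ T) := ENNReal.tsum_le_tsum h1
        _ = ∑' i, coinMeasure G ℓ (B i ∩ {ω | FailsWithin ω e T k fun _ => 0}) +
            (∑' i, coinMeasure G ℓ (B i)) * z ^ T := by
            rw [ENNReal.tsum_add, ENNReal.tsum_mul_right]
        _ ≤ coinMeasure G ℓ (A ∩ {ω | FailsWithin ω e T k fun _ => 0}) +
            coinMeasure G ℓ A * z ^ T := by
            gcongr
            · have h2 : ∀ i, coinMeasure G ℓ (B i ∩ {ω | FailsWithin ω e T k fun _ => 0}) =
                  (coinMeasure G ℓ).restrict {ω | FailsWithin ω e T k fun _ => 0} (B i) :=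
                fun i => (Measure.restrict_apply (hBm i)).symm
              simp only [h2]
              rw [← measure_iUnion hdisj hBm, Measure.restrict_apply (.iUnion hBm)]
              exact measure_mono (Set.inter_subset_inter_left _ hBA)
            · rw [← measure_iUnion hdisj hBm]
              exact measure_mono hBA
        _ ≤ coinMeasure G ℓ A * q + coinMeasure G ℓ A * z ^ T := by
            gcongr
            exact hq e k A hA.isLocal_fresh
        _ ≤ _ := by
            rw [← mul_add]
            gcongr
    calc coinMeasure G ℓ (A ∩ {ω | Reaches ω st (E + 1) K}) * z ^ K
        ≤ (∑' i, coinMeasure G ℓ (B i ∩ {ω | Reaches ω ⟨k + i, e + 1, fun _ => 0⟩ E K})) *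
            z ^ K := by
          gcongr
          exact (measure_mono hsub).trans (measure_iUnion_le _)
      _ = ∑' i, coinMeasure G ℓ (B i ∩ {ω | Reaches ω ⟨k + i, e + 1, fun _ => 0⟩ E K}) *
            z ^ K := by rw [ENNReal.tsum_mul_right]
      _ ≤ ∑' i, coinMeasure G ℓ (B i) * ((1 / 4) ^ E * z ^ (k + i)) :=
          ENNReal.tsum_le_tsum fun i => ih (k + i) (e + 1) (hBl i)
      _ = (∑' i, coinMeasure G ℓ (B i) * z ^ i) * ((1 / 4) ^ E * z ^ k) := by
          rw [← ENNReal.tsum_mul_right]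
          refine tsum_congr fun i => ?_
          rw [pow_add]
          ring
      _ ≤ coinMeasure G ℓ A * (1 / 4) * ((1 / 4) ^ E * z ^ k) := by gcongr
      _ = _ := by
          rw [pow_succ]
          ring

/-- At least `E` tables have been given up before request `K` is begun. -/
def ManyTables (ω : Coins G ℓ) (E K : ℕ) : Prop := Reaches ω ⟨0, 0, fun _ => 0⟩ E K

theorem manyTables_iff {ω : Coins G ℓ} {E K : ℕ} :
    ManyTables ω E K ↔ ∃ a, E ≤ (run ω a).table ∧ (run ω a).req < K := by
  unfold ManyTables Reaches
  simp only [zero_add]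
  rfl

theorem measurableSet_manyTables (hG : ∀ x, ∃ y, G.Adj x y) (E K : ℕ) :
    MeasurableSet {ω : Coins G ℓ | ManyTables ω E K} := by
  simp only [manyTables_iff, Set.ofPred_exists]
  exact .iUnion fun a => (measFibers_run hG a).setOf fun st => E ≤ st.table ∧ st.req < K

/-- Number of failed attempts for the requests before `K`. -/
def failCount (ω : Coins G ℓ) (K : ℕ) : ℝ≥0∞ :=
  ∑' a, if (run ω a).req < K ∧ Fails ω (run ω a) then 1 else 0

/-- Every failed attempt leads to another table. -/
theorem failCount_le (ω : Coins G ℓ) (K : ℕ) :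
    failCount ω K ≤ ∑' E, if ManyTables ω (E + 1) K then 1 else 0 := by
  set S : Set ℕ := {a | (run ω a).req < K ∧ Fails ω (run ω a)} with hS
  have h1 : failCount ω K = ∑' a : S, (1 : ℝ≥0∞) := by
    rw [tsum_subtype S fun _ => (1 : ℝ≥0∞)]
    exact tsum_congr fun a => by simp [Set.indicator, hS]
  have hstep : ∀ a ∈ S, (run ω (a + 1)).table = (run ω a).table + 1 ∧
      (run ω (a + 1)).req < K := by
    rintro a ⟨h1, h2⟩
    rw [run_succ, runNext_of_fails h2]
    exact ⟨rfl, h1⟩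
  have hinj : Function.Injective fun a : S => (run ω a.1).table := by
    have hlt : ∀ a ∈ S, ∀ b, a < b → (run ω a).table < (run ω b).table := by
      intro a ha b hab
      have := table_mono ω ⟨0, 0, fun _ => 0⟩ (show a + 1 ≤ b from hab)
      change (run ω (a + 1)).table ≤ (run ω b).table at this
      rw [(hstep a ha).1] at this
      omega
    rintro ⟨a, ha⟩ ⟨b, hb⟩ h
    simp only at h
    rcases lt_trichotomy a b with h' | h' | h'
    · exact absurd h (hlt a ha b h').ne
    · exact Subtype.ext h'
    · exact absurd h (hlt b hb a h').ne'
  rw [h1]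
  refine le_trans (ENNReal.tsum_le_tsum fun a => ?_) (ENNReal.tsum_comp_le_tsum_of_injective hinj
    fun E => if ManyTables ω (E + 1) K then (1 : ℝ≥0∞) else 0)
  rw [if_pos]
  rw [manyTables_iff]
  exact ⟨a.1 + 1, (hstep a.1 a.2).1.ge, (hstep a.1 a.2).2⟩

theorem failCount_le_of_not_manyTables {ω : Coins G ℓ} {E K : ℕ} (h : ¬ ManyTables ω E K) :
    failCount ω K ≤ E := by
  refine (failCount_le ω K).trans ?_
  rw [tsum_eq_sum (s := Finset.range E)]
  · refine (Finset.sum_le_card_nsmul _ _ 1 fun i _ => by split_ifs <;> simp).trans ?_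
    simp
  · intro i hi
    rw [if_neg]
    intro h'
    exact h (Reaches.anti h' (by simp at hi; omega))

/-- Bounds for the number of tables that hold for a new table that survives `T` requests with
high probability. -/
structure TableBounds (G : SimpleGraph (Fin n)) [DecidableRel G.Adj] (ℓ T : ℕ) : Prop where
  lintegral_failCount : ∀ K,
    ∫⁻ ω, failCount ω K ∂(coinMeasure G ℓ) ≤ ENNReal.ofReal (3 * K / T + 3)
  eventually_failCount : ∀ᵐ ω ∂(coinMeasure G ℓ), ∀ᶠ K : ℕ in Filter.atTop,
    failCount ω K ≤ ENNReal.ofReal (3 * K / T + 1)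
  reached : ∀ᵐ ω ∂(coinMeasure G ℓ), ∀ k, ∃ a, (run ω a).req = k ∧ ¬ Fails ω (run ω a)

theorem measure_manyTables_le (hG : ∀ x, ∃ y, G.Adj x y) {T : ℕ} {q z : ℝ≥0∞} (hz : z ≤ 1)
    (hq : ∀ (e k : ℕ) (A : Set (Coins G ℓ)), IsLocal (revealed (k + 1) e ∅) A →
      coinMeasure G ℓ (A ∩ {ω | FailsWithin ω e T k fun _ => 0}) ≤ coinMeasure G ℓ A * q)
    (hqz : q + z ^ T ≤ 1 / 4) (E K : ℕ) :
    coinMeasure G ℓ {ω | ManyTables ω E K} * z ^ K ≤ (1 / 4) ^ E := by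
  have := measure_inter_reaches_le hG hz hq hqz E K 0 0 (runStart_univ (ℓ := ℓ) (G := G)).runLocal
  rw [Set.univ_inter, measure_univ, one_mul, pow_zero, mul_one] at this
  exact this

theorem exists_answer_of_not_manyTables {ω : Coins G ℓ} {k E : ℕ}
    (h : ¬ ManyTables ω E (k + 1)) : ∃ a, (run ω a).req = k ∧ ¬ Fails ω (run ω a) := by
  rw [manyTables_iff] at h
  push Not at h
  have hsum : ∀ a, (run ω a).req + (run ω a).table = a := fun a => by
    have := req_add_table_iterate ω ⟨0, 0, fun _ => 0⟩ a
    simpa [run] using this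
  have hex : ∃ a, k < (run ω a).req := by
    refine ⟨E + k + 1, ?_⟩
    by_contra hle
    have h1 := hsum (E + k + 1)
    have := h (E + k + 1) (by omega)
    omega
  have h1 := Nat.find_spec hex
  have h2 := fun b hb => Nat.find_min hex (m := b) hb
  generalize Nat.find hex = b at h1 h2
  cases b with
  | zero => exact absurd h1 (by simp [run])
  | succ b =>
    have h3 := h2 b (Nat.lt_succ_self b)
    rw [run_succ] at h1
    by_cases hf : Fails ω (run ω b)
    · rw [runNext_of_fails hf] at h1
      exact absurd h1 h3
    · rw [runNext_of_not_fails hf] at h1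
      refine ⟨b, ?_, hf⟩
      simp only at h1
      omega

/-- With `z ^ T = 1 / 8`, the event that `3 K / T + i` tables have been given up before request `K`
has probability at most `z ^ K / 4 ^ i`. Its sum over `i` bounds the expectation, and its sum over
`K` is finite, so that the Borel–Cantelli lemma applies. -/
theorem tableBounds (hG : ∀ x, ∃ y, G.Adj x y) {T : ℕ} (hT : 1 ≤ T) {q : ℝ≥0∞} (hq8 : q ≤ 1 / 8)
    (hq : ∀ (e k : ℕ) (A : Set (Coins G ℓ)), IsLocal (revealed (k + 1) e ∅) A →
      coinMeasure G ℓ (A ∩ {ω | FailsWithin ω e T k fun _ => 0}) ≤ coinMeasure G ℓ A * q) :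
    TableBounds G ℓ T := by
  have hT0 : (0 : ℝ) < T := by exact_mod_cast hT
  set y : ℝ := (1 / 8 : ℝ) ^ (1 / (T : ℝ)) with hy
  have hy0 : 0 < y := Real.rpow_pos_of_pos (by norm_num) _
  have hyT : y ^ T = 1 / 8 := by
    rw [hy, one_div (T : ℝ), Real.rpow_inv_natCast_pow (by norm_num) (by omega)]
  have hy1 : y < 1 := Real.rpow_lt_one (by norm_num) (by norm_num) (by positivity)
  -- `z ^ T = 1 / 8`, so that `q + z ^ T ≤ 1 / 4`.
  set z : ℝ≥0∞ := ENNReal.ofReal y with hz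
  have hz1 : z < 1 := by
    rw [hz, ← ENNReal.ofReal_one]
    exact (ENNReal.ofReal_lt_ofReal_iff one_pos).2 hy1
  have hz0 : z ≠ 0 := by simpa [hz] using hy0
  have hztop : z ≠ ⊤ := ENNReal.ofReal_ne_top
  have hzpow : ∀ i, z ^ i = ENNReal.ofReal (y ^ i) := fun i => (ENNReal.ofReal_pow hy0.le i).symm
  have h48 : (1 / 8 : ℝ≥0∞) + 1 / 8 = 1 / 4 := by
    rw [ENNReal.div_add_div_same, one_add_one_eq_two]
    rw [ENNReal.div_eq_div_iff] <;> norm_num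
  have h18 : ENNReal.ofReal (1 / 8) = 1 / 8 := by
    rw [ENNReal.ofReal_div_of_pos (by norm_num)]
    norm_num
  have h14 : ENNReal.ofReal (1 / 4) = 1 / 4 := by
    rw [ENNReal.ofReal_div_of_pos (by norm_num)]
    norm_num
  have hqz : q + z ^ T ≤ 1 / 4 := by
    rw [hzpow, hyT, h18, ← h48]
    gcongr
  have hmain := measure_manyTables_le hG hz1.le hq hqz
  set E₀ : ℕ → ℕ := fun K => ⌈3 * (K : ℝ) / T⌉₊ with hE₀
  have hE₀le : ∀ K, (E₀ K : ℝ) ≤ 3 * K / T + 1 := fun K =>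
    (Nat.ceil_lt_add_one (by positivity)).le
  -- With `E₀ T ≥ 3 K`, the `T`-th power of the claim is `4 ^ (-3 K) = 8 ^ (-2 K)`. One factor
  -- `z ^ K` cancels the weight in `hmain`, the other one is the gain.
  have hquart : ∀ K, (1 / 4 : ℝ≥0∞) ^ E₀ K ≤ z ^ K * z ^ K := by
    intro K
    rw [← pow_add, hzpow, ← h14, ← ENNReal.ofReal_pow (by norm_num)]
    refine ENNReal.ofReal_le_ofReal ?_
    refine le_of_pow_le_pow_left₀ (n := T) (by omega) (by positivity) ?_
    rw [← pow_mul, ← pow_mul, mul_comm (K + K) T, pow_mul y, hyT]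
    have h1 : 3 * K ≤ E₀ K * T := by
      have : 3 * (K : ℝ) / T ≤ E₀ K := Nat.le_ceil _
      rw [div_le_iff₀ hT0] at this
      exact_mod_cast this
    calc (1 / 4 : ℝ) ^ (E₀ K * T) ≤ (1 / 4) ^ (3 * K) :=
          pow_le_pow_of_le_one (by norm_num) (by norm_num) h1
      _ = (1 / 8) ^ (K + K) := by
          rw [pow_mul, ← two_mul, pow_mul]
          norm_num
  have hbound : ∀ K i, coinMeasure G ℓ {ω | ManyTables ω (E₀ K + i) K} ≤ z ^ K * (1 / 4) ^ i := by
    intro K i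
    refine (ENNReal.mul_le_mul_iff_left (pow_ne_zero K hz0) (ENNReal.pow_ne_top hztop)).1
      ((hmain (E₀ K + i) K).trans ?_)
    rw [pow_add, mul_right_comm]
    gcongr
    exact hquart K
  refine ⟨fun K => ?_, ?_, ?_⟩
  · calc ∫⁻ ω, failCount ω K ∂(coinMeasure G ℓ)
        ≤ ∫⁻ ω, ∑' E, {ω | ManyTables ω (E + 1) K}.indicator 1 ω ∂(coinMeasure G ℓ) := by
          refine lintegral_mono fun ω => (failCount_le ω K).trans (le_of_eq ?_)
          exact tsum_congr fun E => by simp [Set.indicator]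
      _ = ∑' E, coinMeasure G ℓ {ω | ManyTables ω (E + 1) K} := by
          rw [lintegral_tsum fun E =>
            (measurable_one.indicator (measurableSet_manyTables hG _ _)).aemeasurable]
          exact tsum_congr fun E => lintegral_indicator_one (measurableSet_manyTables hG _ _)
      _ = ∑ E ∈ Finset.range (E₀ K), coinMeasure G ℓ {ω | ManyTables ω (E + 1) K} +
            ∑' i, coinMeasure G ℓ {ω | ManyTables ω (i + E₀ K + 1) K} :=
          (ENNReal.summable.sum_add_tsum_nat_add' (k := E₀ K)).symm
      _ ≤ E₀ K + ∑' i, (1 / 4) ^ i := by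
          gcongr with i
          · refine (Finset.sum_le_card_nsmul _ _ 1 fun i _ => prob_le_one).trans ?_
            simp
          · refine le_trans (measure_mono fun ω h => ?_) ((hbound K i).trans
              (mul_le_of_le_one_left' (pow_le_one' hz1.le K)))
            exact Reaches.anti h (by omega)
      _ ≤ E₀ K + 2 := by
          gcongr
          rw [ENNReal.tsum_geometric, ENNReal.inv_le_iff_inv_le]
          refine ENNReal.le_sub_of_add_le_left (by norm_num) ?_
          have h42 : (1 / 4 : ℝ≥0∞) ≤ 2⁻¹ := by
            rw [one_div]
            exact ENNReal.inv_le_inv.2 (by norm_num)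
          exact (add_le_add_left h42 _).trans ENNReal.inv_two_add_inv_two.le
      _ ≤ ENNReal.ofReal (3 * K / T + 3) := by
          rw [show (3 : ℝ) * K / T + 3 = (3 * K / T + 1) + 2 by ring,
            ENNReal.ofReal_add (by positivity) (by norm_num)]
          gcongr
          · rw [← ENNReal.ofReal_natCast]
            exact ENNReal.ofReal_le_ofReal (hE₀le K)
          · simp
  · have hsum : ∑' K, coinMeasure G ℓ {ω | ManyTables ω (E₀ K) K} ≠ ⊤ := by
      refine ne_top_of_le_ne_top ?_ (ENNReal.tsum_le_tsum fun K => by simpa using hbound K 0)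
      rw [ENNReal.tsum_geometric, ENNReal.inv_ne_top]
      exact (tsub_pos_of_lt hz1).ne'
    filter_upwards [ae_eventually_notMem hsum] with ω hω
    filter_upwards [hω] with K hK
    refine (failCount_le_of_not_manyTables hK).trans ?_
    rw [← ENNReal.ofReal_natCast]
    exact ENNReal.ofReal_le_ofReal (hE₀le K)
  · rw [ae_all_iff]
    intro k
    have hzero : coinMeasure G ℓ {ω | ∀ E, ManyTables ω E (k + 1)} = 0 := by
      have hlim : Filter.Tendsto (fun i : ℕ => (1 / 4 : ℝ≥0∞) ^ i) Filter.atTop (nhds 0) :=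
        ENNReal.tendsto_pow_atTop_nhds_zero_of_lt_one (by norm_num)
      refine le_antisymm (ge_of_tendsto' hlim fun i => ?_) zero_le
      refine le_trans (measure_mono fun ω h => h (E₀ (k + 1) + i)) ((hbound (k + 1) i).trans
        (mul_le_of_le_one_left' (pow_le_one' hz1.le _)))
    rw [ae_iff]
    refine measure_mono_null (t := {ω | ∀ E, ManyTables ω E (k + 1)}) ?_ hzero
    intro ω h E
    by_contra hE
    exact h (exists_answer_of_not_manyTables hE)

end Tables

/-! ### The law of the answers -/

section Answers

variable {n : ℕ} [NeZero n] {G : SimpleGraph (Fin n)} [DecidableRel G.Adj] {ℓ : ℕ}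

theorem exists_walk_walkPos (hG : ∀ x, ∃ y, G.Adj x y) (ω : Coins G ℓ) (e : ℕ) (w : Short G)
    (T : ℕ) : ∃ p : G.Walk w.1 (walkPos ω e w T), p.length = T := by
  induction T with
  | zero => exact ⟨.nil, rfl⟩
  | succ T ih =>
    obtain ⟨p, hp⟩ := ih
    exact ⟨p.concat (adj_of_next hG (hopCoin ω e w T (walkPos ω e w T))),
      (SimpleGraph.Walk.length_concat _ _).trans (congrArg (· + 1) hp)⟩

theorem exists_walk_naivePos (hG : ∀ x, ∃ y, G.Adj x y) (ω : Coins G ℓ) (e k : ℕ) (x : Fin n)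
    (T : ℕ) : ∃ p : G.Walk x (naivePos ω e k x T), p.length = T := by
  induction T with
  | zero => exact ⟨.nil, rfl⟩
  | succ T ih =>
    obtain ⟨p, hp⟩ := ih
    exact ⟨p.concat (adj_of_next hG (stepCoin ω e k T (naivePos ω e k x T))),
      (SimpleGraph.Walk.length_concat _ _).trans (congrArg (· + 1) hp)⟩

theorem walkLen_lt (ω : Coins G ℓ) (e : ℕ) (w : Short G) (hlam : 1 ≤ lam G ℓ) :
    walkLen ω e w < 2 * lam G ℓ := by
  have := (lenCoin ω e w).2
  unfold walkLen
  omega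

theorem lam_le_walkLen (ω : Coins G ℓ) (e : ℕ) (w : Short G) : lam G ℓ ≤ walkLen ω e w :=
  Nat.le_add_right _ _

theorem tokStep_len_le (ω : Coins G ℓ) (e : ℕ) (hlam : 1 ≤ lam G ℓ) {t : Tok n} (ht : t.len ≤ ℓ) :
    (tokStep ω e t).len ≤ ℓ := by
  rw [tokStep]
  split_ifs with hs hu
  · exact ht
  · simp only [Tok.Stopped, not_or, not_lt] at hs
    have := walkLen_lt ω e (nextShort ω e t.pos _ hu) hlam
    simp only
    omega
  · exact ht

theorem exists_walk_tokStep (hG : ∀ x, ∃ y, G.Adj x y) (ω : Coins G ℓ) (e : ℕ) {s : Fin n}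
    (t : Tok n) (h : ∃ p : G.Walk s t.pos, p.length = t.len) :
    ∃ p : G.Walk s (tokStep ω e t).pos, p.length = (tokStep ω e t).len := by
  obtain ⟨p, hp⟩ := h
  by_cases hs : t.Stopped ℓ G
  · rw [show tokStep ω e t = t by rw [tokStep, if_pos hs]]
    exact ⟨p, hp⟩
  · by_cases hu : t.used t.pos < numWalks G t.pos
    · have h1 : tokStep ω e t = ⟨walkEnd ω e (nextShort ω e t.pos _ hu),
          t.len + walkLen ω e (nextShort ω e t.pos _ hu),
          Function.update t.used t.pos (t.used t.pos + 1), false⟩ := by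
        rw [tokStep, if_neg hs, dif_pos hu]
      obtain ⟨p', hp'⟩ := exists_walk_walkPos hG ω e (nextShort ω e t.pos _ hu)
        (walkLen ω e (nextShort ω e t.pos _ hu))
      rw [h1]
      exact ⟨p.append p', (SimpleGraph.Walk.length_append _ _).trans (congrArg₂ (· + ·) hp hp')⟩
    · have h1 : tokStep ω e t = { t with failed := true } := by
        rw [tokStep, if_neg hs, dif_neg hu]
      rw [h1]
      exact ⟨p, hp⟩

/-- The token has walked exactly the length that it has completed, and never too far: it uses a
short walk only if `2 λ` steps are left. -/
theorem tokAfter_spec (hG : ∀ x, ∃ y, G.Adj x y) (hlam : 1 ≤ lam G ℓ) (ω : Coins G ℓ) (e : ℕ)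
    (s : Fin n) (u : Fin n → ℕ) :
    (tokAfter ω e s u).len ≤ ℓ ∧
      ∃ p : G.Walk s (tokAfter ω e s u).pos, p.length = (tokAfter ω e s u).len := by
  have : ∀ i, ((tokStep ω e)^[i] ⟨s, 0, u, false⟩).len ≤ ℓ ∧
      ∃ p : G.Walk s ((tokStep ω e)^[i] ⟨s, 0, u, false⟩).pos,
        p.length = ((tokStep ω e)^[i] ⟨s, 0, u, false⟩).len := by
    intro i
    induction i with
    | zero => exact ⟨Nat.zero_le _, .nil, rfl⟩
    | succ i ih =>
      rw [Function.iterate_succ_apply']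
      exact ⟨tokStep_len_le ω e hlam ih.1, exists_walk_tokStep hG ω e _ ih.2⟩
  exact this ℓ

theorem exists_walk_of_answers (hG : ∀ x, ∃ y, G.Adj x y) (hlam : 1 ≤ lam G ℓ) {ω : Coins G ℓ}
    {k : ℕ} {v : Fin n} (h : Answers ω k v) : ∃ p : G.Walk (source ω k) v, p.length = ℓ := by
  obtain ⟨a, rfl, -, rfl⟩ := h
  rw [endpoint_eq]
  obtain ⟨h1, p, hp⟩ := tokAfter_spec hG hlam ω (run ω a).table (source ω (run ω a).req)
    (run ω a).used
  obtain ⟨p', hp'⟩ := exists_walk_naivePos hG ω (run ω a).table (run ω a).req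
    (tokAfter ω (run ω a).table (source ω (run ω a).req) (run ω a).used).pos
    (ℓ - (tokAfter ω (run ω a).table (source ω (run ω a).req) (run ω a).used).len)
  refine ⟨p.append p', ?_⟩
  rw [SimpleGraph.Walk.length_append, hp, hp']
  omega

/-- No attempt for a request follows a successful one. -/
theorem success_unique {ω : Coins G ℓ} {k a a' : ℕ} (h : (run ω a).req = k)
    (hf : ¬ Fails ω (run ω a)) (h' : (run ω a').req = k) : a' ≤ a := by
  by_contra hlt
  have h1 := req_mono ω ⟨0, 0, fun _ => 0⟩ (show a + 1 ≤ a' by omega)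
  change (run ω (a + 1)).req ≤ (run ω a').req at h1
  rw [run_succ, runNext_of_not_fails hf] at h1
  simp only at h1
  omega

theorem existsUnique_answers {ω : Coins G ℓ} {k : ℕ}
    (h : ∃ a, (run ω a).req = k ∧ ¬ Fails ω (run ω a)) : ∃! v, Answers ω k v := by
  obtain ⟨a, h1, h2⟩ := h
  refine ⟨_, ⟨a, h1, h2, rfl⟩, ?_⟩
  rintro v ⟨a', h1', h2', rfl⟩
  rw [le_antisymm (success_unique h1 h2 h1') (success_unique h1' h2' h1)]

/-- Index of the cells into which the outcomes are divided: the first attempt for a request, the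
state before it, the orders of the table, and the state of the token after stitching. -/
abbrev CellIdx (G : SimpleGraph (Fin n)) [DecidableRel G.Adj] : Type :=
  (ℕ × RunState n × ((x : Fin n) → Equiv.Perm (Fin (numWalks G x)))) × Tok n

/-- The outcomes in which the first attempt for request `k` is described by `p` and the request has
the source `s`. -/
def firstCell (k : ℕ) (s : Fin n)
    (p : ℕ × RunState n × ((x : Fin n) → Equiv.Perm (Fin (numWalks G x)))) : Set (Coins G ℓ) :=
  {ω | FirstAt ω k p.1 ∧ run ω p.1 = p.2.1} ∩ picksEq p.2.1.table p.2.2 ∩ {ω | source ω k = s}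

/-- The outcomes in `firstCell` in which the token is in the state `q.2` after stitching. -/
def tokCell (k : ℕ) (s : Fin n) (q : CellIdx G) : Set (Coins G ℓ) :=
  firstCell k s q.1 ∩ {ω | tokAfter ω q.1.2.1.table s q.1.2.1.used = q.2}

theorem isLocal_firstCell (hG : ∀ x, ∃ y, G.Adj x y) (k : ℕ) (s : Fin n)
    (p : ℕ × RunState n × ((x : Fin n) → Equiv.Perm (Fin (numWalks G x)))) :
    IsLocal (revealed (k + 1) p.2.1.table (usedShorts p.2.2 p.2.1.used))
      (firstCell (ℓ := ℓ) k s p) := by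
  by_cases hk : p.2.1.req = k
  · have := runStart_firstAt (ℓ := ℓ) hG k p.1 p.2.1 hk p.2.2
    rw [hk] at this
    exact (this.mono (revealed_mono (Nat.le_succ k) subset_rfl)).inter (isLocal_source s)
  · have : firstCell (ℓ := ℓ) k s p = ∅ := by
      ext ω
      simp only [firstCell, Set.mem_inter_iff, Set.mem_ofPred_eq, Set.mem_empty_iff_false,
        iff_false]
      rintro ⟨⟨⟨h1, h2⟩, _⟩, _⟩
      exact hk (h2 ▸ h1.req)
    rw [this]
    simpa using IsLocal.univ.compl

theorem measure_firstCell (hG : ∀ x, ∃ y, G.Adj x y) (k : ℕ) (s : Fin n)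
    (p : ℕ × RunState n × ((x : Fin n) → Equiv.Perm (Fin (numWalks G x)))) :
    coinMeasure G ℓ (firstCell k s p) =
      coinMeasure G ℓ ({ω | FirstAt ω k p.1 ∧ run ω p.1 = p.2.1} ∩ picksEq p.2.1.table p.2.2) *
        ENNReal.ofReal (stationary G s) := by
  by_cases hk : p.2.1.req = k
  · have := runStart_firstAt (ℓ := ℓ) hG k p.1 p.2.1 hk p.2.2
    rw [hk] at this
    exact this.measure_inter_source hG src_notMem_revealed s
  · have : {ω : Coins G ℓ | FirstAt ω k p.1 ∧ run ω p.1 = p.2.1} = ∅ := by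
      ext ω
      simp only [Set.mem_ofPred_eq, Set.mem_empty_iff_false, iff_false]
      rintro ⟨h1, h2⟩
      exact hk (h2 ▸ h1.req)
    simp [firstCell, this]

theorem isLocal_tokCell (hG : ∀ x, ∃ y, G.Adj x y) (k : ℕ) (s : Fin n) (q : CellIdx G) :
    IsLocal (revealed (k + 1) q.1.2.1.table (usedShorts q.1.2.2 q.2.used))
      (tokCell (ℓ := ℓ) k s q) :=
  IsLocal.inter_tokStep_iterate (t := ⟨s, 0, q.1.2.1.used, false⟩) hG (isLocal_firstCell hG k s q.1)
    (Set.inter_subset_left.trans Set.inter_subset_right) ℓ q.2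

theorem pairwise_disjoint_tokCell (k : ℕ) (s : Fin n) :
    Pairwise (Function.onFun Disjoint (tokCell (G := G) (ℓ := ℓ) k s)) := by
  rintro ⟨⟨a, st, π⟩, t⟩ ⟨⟨a', st', π'⟩, t'⟩ hne
  rw [Function.onFun, Set.disjoint_left]
  rintro ω ⟨⟨⟨⟨h1, h2⟩, h3⟩, _⟩, h4⟩ ⟨⟨⟨⟨h1', h2'⟩, h3'⟩, _⟩, h4'⟩
  apply hne
  simp only at h1 h2 h3 h1' h2' h3'
  obtain rfl := h1.unique h1'
  obtain rfl := h2.symm.trans h2'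
  obtain rfl : π = π' := funext fun x => (h3 x).symm.trans (h3' x)
  obtain rfl := Eq.trans (Eq.symm h4) h4'
  rfl

theorem exists_mem_tokCell {ω : Coins G ℓ} {k a : ℕ} (h : (run ω a).req = k) :
    ∃ q, ω ∈ tokCell k (source ω k) q := by
  obtain ⟨a, ha⟩ := exists_firstAt h
  exact ⟨((a, run ω a, fun x => pickCoin ω (run ω a).table x),
    tokAfter ω (run ω a).table (source ω k) (run ω a).used), ⟨⟨⟨ha, rfl⟩, fun _ => rfl⟩, rfl⟩, rfl⟩

/-- If every cell is continued by an exact walk, the end has the law `P ^ ℓ`, since the probability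
to end at `v` is a martingale. -/
theorem tsum_tokCell (hG : ∀ x, ∃ y, G.Adj x y) (hlam : 1 ≤ lam G ℓ) {k : ℕ}
    (hreach : ∀ᵐ ω ∂(coinMeasure G ℓ), ∃ a, (run ω a).req = k) (s v : Fin n) :
    ∑' q : CellIdx G, coinMeasure G ℓ (tokCell k s q) *
        ENNReal.ofReal ((transition G ^ (ℓ - q.2.len)) q.2.pos v) =
      ENNReal.ofReal (stationary G s) * ENNReal.ofReal ((transition G ^ ℓ) s v) := by
  have h1 : ∀ p : ℕ × RunState n × ((x : Fin n) → Equiv.Perm (Fin (numWalks G x))),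
      ∑' t, coinMeasure G ℓ (tokCell k s (p, t)) *
        ENNReal.ofReal ((transition G ^ (ℓ - t.len)) t.pos v) =
      coinMeasure G ℓ (firstCell k s p) * ENNReal.ofReal ((transition G ^ ℓ) s v) := by
    intro p
    rw [← (isLocal_firstCell hG k s p).setLIntegral_transition_tokAfter hG hlam
      (Set.inter_subset_left.trans Set.inter_subset_right) s v,
      setLIntegral_eq_tsum_fiber _ (isLocal_firstCell hG k s p).meas
        (measFibers_tokStep_iterate hG p.2.1.table ⟨s, 0, p.2.1.used, false⟩ ℓ)]
    refine tsum_congr fun t => ?_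
    rw [mul_comm, ← setLIntegral_const]
    refine setLIntegral_congr_fun (isLocal_tokCell hG k s (p, t)).meas ?_
    rintro ω ⟨_, h⟩
    simp only [Set.mem_ofPred_eq] at h ⊢
    rw [h]
  rw [ENNReal.tsum_prod']
  simp only [h1, measure_firstCell hG]
  rw [ENNReal.tsum_mul_right, ENNReal.tsum_mul_right]
  suffices h : ∑' p : ℕ × RunState n × ((x : Fin n) → Equiv.Perm (Fin (numWalks G x))),
      coinMeasure G ℓ ({ω | FirstAt ω k p.1 ∧ run ω p.1 = p.2.1} ∩ picksEq p.2.1.table p.2.2) = 1 by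
    rw [h, one_mul]
  rw [← measure_iUnion]
  · rw [← measure_univ (μ := coinMeasure G ℓ)]
    refine measure_congr ?_
    filter_upwards [hreach] with ω hω
    obtain ⟨a, ha⟩ := hω
    obtain ⟨a, ha⟩ := exists_firstAt ha
    refine propext ⟨fun _ => trivial, fun _ => Set.mem_iUnion.2
      ⟨(a, run ω a, fun x => pickCoin ω (run ω a).table x), ⟨ha, rfl⟩, fun _ => rfl⟩⟩
  · rintro ⟨a, st, π⟩ ⟨a', st', π'⟩ hne
    rw [Function.onFun, Set.disjoint_left]
    rintro ω ⟨⟨h1, h2⟩, h3⟩ ⟨⟨h1', h2'⟩, h3'⟩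
    apply hne
    simp only at h1 h2 h3 h1' h2' h3'
    obtain rfl := h1.unique h1'
    obtain rfl := h2.symm.trans h2'
    obtain rfl : π = π' := funext fun x => (h3 x).symm.trans (h3' x)
    rfl
  · intro p
    by_cases hk : p.2.1.req = k
    · exact (runStart_firstAt (ℓ := ℓ) hG k p.1 p.2.1 hk p.2.2).meas
    · have : {ω : Coins G ℓ | FirstAt ω k p.1 ∧ run ω p.1 = p.2.1} = ∅ := by
        ext ω
        simp only [Set.mem_ofPred_eq, Set.mem_empty_iff_false, iff_false]
        rintro ⟨h1, h2⟩
        exact hk (h2 ▸ h1.req)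
      simp [this]

/-- In a cell, the steps made one by one are still an exact random walk from the position of the
token. The statement includes the cells of failed attempts, in which these steps are not made. -/
theorem measure_tokCell_inter_naive (hG : ∀ x, ∃ y, G.Adj x y) (k : ℕ) (s v : Fin n)
    (q : CellIdx G) :
    coinMeasure G ℓ (tokCell k s q ∩
        {ω | naivePos ω q.1.2.1.table k q.2.pos (ℓ - q.2.len) = v}) =
      coinMeasure G ℓ (tokCell k s q) *
        ENNReal.ofReal ((transition G ^ (ℓ - q.2.len)) q.2.pos v) :=
  (isLocal_tokCell hG k s q).measure_inter_naivePos hG _ _ _ _ _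

theorem measure_source_eq (hG : ∀ x, ∃ y, G.Adj x y) (k : ℕ) (s : Fin n) :
    coinMeasure G ℓ {ω | source ω k = s} = ENNReal.ofReal (stationary G s) := by
  have := (IsLocal.univ (S := (∅ : Set (CoinIdx G)))).measure_inter_source (ℓ := ℓ) hG
    (k := k) (fun h => h) s
  rwa [Set.univ_inter, measure_univ, one_mul] at this

theorem transition_pow_le_one (hG : ∀ x, ∃ y, G.Adj x y) (t : ℕ) (x y : Fin n) :
    (transition G ^ t) x y ≤ 1 := by
  rw [← sum_transition_pow hG t x]
  exact Finset.single_le_sum (fun z _ => transition_pow_nonneg t x z) (Finset.mem_univ y)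

/-- The outcomes are divided into the cells. In a cell without failure, the answer is the end of an
exact walk from the position of the token. A cell with failure contributes to the answer, and to
the law of the exact walk, at most its own probability. -/
theorem answers_law (hG : ∀ x, ∃ y, G.Adj x y) (hlam : 1 ≤ lam G ℓ) {k : ℕ}
    (hreach : ∀ᵐ ω ∂(coinMeasure G ℓ), ∃ a, (run ω a).req = k) (s v : Fin n) :
    |(coinMeasure G ℓ).real {ω | source ω k = s ∧ Answers ω k v} -
      (coinMeasure G ℓ).real {ω | source ω k = s} * (transition G ^ ℓ) s v| ≤
      (coinMeasure G ℓ).real {ω | source ω k = s ∧ Rebuilds ω k} := by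
  set μ := coinMeasure G ℓ with hμ
  set SA : Set (Coins G ℓ) := {ω | source ω k = s ∧ Answers ω k v} with hSA
  set SR : Set (Coins G ℓ) := {ω | source ω k = s ∧ Rebuilds ω k} with hSR
  set Φ : CellIdx G → ℝ≥0∞ := fun q =>
    ENNReal.ofReal ((transition G ^ (ℓ - q.2.len)) q.2.pos v) with hΦ
  set good : CellIdx G → Set (Coins G ℓ) := fun q => if q.2.failed = true then ∅ else
    tokCell k s q ∩ {ω | naivePos ω q.1.2.1.table k q.2.pos (ℓ - q.2.len) = v} with hgood
  set bad : CellIdx G → Set (Coins G ℓ) := fun q => if q.2.failed = true then tokCell k s q else ∅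
    with hbad
  have hcell : ∀ (q : CellIdx G) (ω : Coins G ℓ), ω ∈ tokCell k s q →
      source ω k = s ∧ (run ω q.1.1).req = k ∧
      (Fails ω (run ω q.1.1) ↔ q.2.failed = true) ∧
      (endpoint ω (run ω q.1.1) = naivePos ω q.1.2.1.table k q.2.pos (ℓ - q.2.len)) := by
    rintro ⟨⟨a, st, π⟩, t⟩ ω ⟨⟨⟨⟨h1, h2⟩, _⟩, h3⟩, h4⟩
    simp only at h1 h2 h4 ⊢
    have h5 : st.req = k := h2 ▸ h1.req
    have h3' : source ω st.req = s := by rw [h5]; exact h3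
    refine ⟨h3, h1.req, ?_, ?_⟩
    · rw [h2, fails_iff, h3']
      simp only [Set.mem_ofPred_eq] at h4
      rw [h4]
    · rw [h2, endpoint_eq, h3']
      simp only [Set.mem_ofPred_eq] at h4
      rw [h4, h5]
  have hgoodm : ∀ q, MeasurableSet (good q) := by
    intro q
    simp only [hgood]
    split_ifs
    · exact .empty
    · exact (isLocal_tokCell hG k s q).meas.inter (measurableSet_naivePos hG _ _ _ _ _)
  have hbadm : ∀ q, MeasurableSet (bad q) := by
    intro q
    simp only [hbad]
    split_ifs
    · exact (isLocal_tokCell hG k s q).meas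
    · exact .empty
  have hgoodsub : ∀ q, good q ⊆ tokCell k s q := by
    intro q
    simp only [hgood]
    split_ifs
    · exact Set.empty_subset _
    · exact Set.inter_subset_left
  have hbadsub : ∀ q, bad q ⊆ tokCell k s q := by
    intro q
    simp only [hbad]
    split_ifs
    · exact subset_rfl
    · exact Set.empty_subset _
  have hgooddisj : Pairwise (Function.onFun Disjoint good) := fun q q' h =>
    (pairwise_disjoint_tokCell k s h).mono (hgoodsub q) (hgoodsub q')
  have hbaddisj : Pairwise (Function.onFun Disjoint bad) := fun q q' h =>
    (pairwise_disjoint_tokCell k s h).mono (hbadsub q) (hbadsub q')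
  have hgoodSA : ⋃ q, good q ⊆ SA := by
    refine Set.iUnion_subset fun q ω hω => ?_
    have hc := hcell q ω (hgoodsub q hω)
    simp only [hgood] at hω
    split_ifs at hω with hf
    · exact hω.elim
    · exact ⟨hc.1, q.1.1, hc.2.1, fun h => hf (hc.2.2.1.1 h), hc.2.2.2.trans hω.2⟩
  have hbadSR : ⋃ q, bad q ⊆ SR := by
    refine Set.iUnion_subset fun q ω hω => ?_
    have hc := hcell q ω (hbadsub q hω)
    simp only [hbad] at hω
    split_ifs at hω with hf
    · exact ⟨hc.1, q.1.1, hc.2.1, hc.2.2.1.2 hf⟩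
    · exact hω.elim
  have hSAsub : ∀ᵐ ω ∂μ, ω ∈ SA → ω ∈ (⋃ q, good q) ∪ ⋃ q, bad q := by
    filter_upwards [hreach] with ω hω h
    obtain ⟨a, ha⟩ := hω
    obtain ⟨q, hq⟩ := exists_mem_tokCell ha
    obtain ⟨hs, a', h1, h2, h3⟩ := h
    rw [hs] at hq
    have hc := hcell q ω hq
    by_cases hf : q.2.failed = true
    · right
      refine Set.mem_iUnion.2 ⟨q, ?_⟩
      simp only [hbad, if_pos hf]
      exact hq
    · left
      refine Set.mem_iUnion.2 ⟨q, ?_⟩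
      simp only [hgood, if_neg hf]
      refine ⟨hq, ?_⟩
      have hf' : ¬ Fails ω (run ω q.1.1) := fun h => hf (hc.2.2.1.1 h)
      have : q.1.1 = a' := le_antisymm (success_unique h1 h2 hc.2.1)
        (success_unique hc.2.1 hf' h1)
      exact (hc.2.2.2.symm.trans (by rw [this])).trans h3
  have hpt : ∀ q, μ (good q) ≤ μ (tokCell k s q) * Φ q ∧
      μ (tokCell k s q) * Φ q ≤ μ (good q) + μ (bad q) := by
    intro q
    by_cases hf : q.2.failed = true
    · simp only [hgood, hbad, if_pos hf, measure_empty, zero_add, zero_le, true_and]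
      refine mul_le_of_le_one_right' ?_
      rw [hΦ, ← ENNReal.ofReal_one]
      exact ENNReal.ofReal_le_ofReal (transition_pow_le_one hG _ _ _)
    · simp only [hgood, hbad, if_neg hf, measure_empty, add_zero]
      rw [hμ, measure_tokCell_inter_naive hG]
      exact ⟨le_rfl, le_rfl⟩
  have htot := tsum_tokCell hG hlam hreach s v
  have hlow : μ (⋃ q, good q) ≤
      ENNReal.ofReal (stationary G s) * ENNReal.ofReal ((transition G ^ ℓ) s v) := by
    rw [measure_iUnion hgooddisj hgoodm, ← htot]
    exact ENNReal.tsum_le_tsum fun q => (hpt q).1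
  have hup : ENNReal.ofReal (stationary G s) * ENNReal.ofReal ((transition G ^ ℓ) s v) ≤
      μ (⋃ q, good q) + μ (⋃ q, bad q) := by
    rw [measure_iUnion hgooddisj hgoodm, measure_iUnion hbaddisj hbadm, ← ENNReal.tsum_add, ← htot]
    exact ENNReal.tsum_le_tsum fun q => (hpt q).2
  have h1 : μ SA ≤ ENNReal.ofReal (stationary G s) * ENNReal.ofReal ((transition G ^ ℓ) s v) +
      μ SR := by
    calc μ SA ≤ μ ((⋃ q, good q) ∪ ⋃ q, bad q) := measure_mono_ae hSAsub
      _ ≤ μ (⋃ q, good q) + μ (⋃ q, bad q) := measure_union_le _ _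
      _ ≤ _ := add_le_add hlow (measure_mono hbadSR)
  have h2 : ENNReal.ofReal (stationary G s) * ENNReal.ofReal ((transition G ^ ℓ) s v) ≤
      μ SA + μ SR := hup.trans (add_le_add (measure_mono hgoodSA) (measure_mono hbadSR))
  have hs0 := stationary_nonneg (G := G) s
  have hP0 := transition_pow_nonneg (G := G) ℓ s v
  have hsrc : μ.real {ω | source ω k = s} = stationary G s := by
    rw [Measure.real, hμ, measure_source_eq hG, ENNReal.toReal_ofReal hs0]
  have hprod : (ENNReal.ofReal (stationary G s) * ENNReal.ofReal ((transition G ^ ℓ) s v)).toReal =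
      stationary G s * (transition G ^ ℓ) s v := by
    rw [← ENNReal.ofReal_mul hs0, ENNReal.toReal_ofReal (mul_nonneg hs0 hP0)]
  have hfin : ENNReal.ofReal (stationary G s) * ENNReal.ofReal ((transition G ^ ℓ) s v) ≠ ⊤ :=
    ENNReal.mul_ne_top ENNReal.ofReal_ne_top ENNReal.ofReal_ne_top
  rw [hsrc, abs_le]
  have h1' := ENNReal.toReal_mono (ENNReal.add_ne_top.2 ⟨hfin, measure_ne_top _ _⟩) h1
  have h2' := ENNReal.toReal_mono (ENNReal.add_ne_top.2 ⟨measure_ne_top _ _, measure_ne_top _ _⟩) h2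
  rw [ENNReal.toReal_add hfin (measure_ne_top _ _), hprod] at h1'
  rw [ENNReal.toReal_add (measure_ne_top _ _) (measure_ne_top _ _), hprod] at h2'
  simp only [Measure.real]
  constructor <;> linarith

end Answers

/-! ### The tree and its routes -/

section Tree

variable {n : ℕ} [NeZero n] {G : SimpleGraph (Fin n)} [DecidableRel G.Adj]

theorem dist_le_diam (hconn : G.Connected) (u v : Fin n) : G.dist u v ≤ G.diam :=
  SimpleGraph.dist_le_diam (SimpleGraph.connected_iff_ediam_ne_top.1 hconn)

theorem depth_le_diam (hconn : G.Connected) (v : Fin n) : depth G v ≤ G.diam :=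
  dist_le_diam hconn 0 v

theorem exists_dist_eq_diam (G : SimpleGraph (Fin n)) : ∃ u v, G.dist u v = G.diam :=
  SimpleGraph.exists_dist_eq_diam

theorem diam_lt (hconn : G.Connected) : G.diam < n := by
  obtain ⟨u, v, h⟩ := exists_dist_eq_diam G
  obtain ⟨p, hp, hp'⟩ := hconn.exists_path_of_dist u v
  rw [← h, ← hp']
  simpa using hp.length_lt

theorem depth_zero : depth G 0 = 0 := SimpleGraph.dist_self

theorem depth_eq_zero (hconn : G.Connected) {v : Fin n} : depth G v = 0 ↔ v = 0 :=
  hconn.dist_eq_zero_iff.trans eq_comm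

theorem exists_adj_depth (hconn : G.Connected) {v : Fin n} (hv : v ≠ 0) :
    ∃ w, G.Adj v w ∧ depth G w + 1 = depth G v := by
  obtain ⟨p, hp⟩ := hconn.exists_walk_length_eq_dist v 0
  cases p with
  | nil => exact absurd rfl hv
  | cons h q =>
    rename_i w
    refine ⟨w, h, ?_⟩
    rw [SimpleGraph.Walk.length_cons] at hp
    have h1 := SimpleGraph.dist_le q
    have h2 := hconn.dist_triangle (u := v) (v := w) (w := 0)
    have h3 := SimpleGraph.dist_eq_one_iff_adj.2 h
    rw [depth, depth, G.dist_comm (u := 0) (v := w), G.dist_comm (u := 0) (v := v)]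
    omega

theorem parent_spec (hconn : G.Connected) {v : Fin n} (hv : v ≠ 0) :
    G.Adj v (parent G v) ∧ depth G (parent G v) + 1 = depth G v := by
  have h : (Finset.univ.filter fun w => G.Adj v w ∧ depth G w + 1 = depth G v).Nonempty := by
    obtain ⟨w, hw⟩ := exists_adj_depth hconn hv
    exact ⟨w, by simpa using hw⟩
  rw [parent, dif_pos h]
  simpa using Finset.min'_mem _ h

theorem parent_zero : parent G 0 = 0 := by
  rw [parent, dif_neg]
  rintro ⟨w, hw⟩
  simp [depth_zero] at hw

theorem depth_parent (hconn : G.Connected) (v : Fin n) :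
    depth G (parent G v) = depth G v - 1 := by
  by_cases hv : v = 0
  · rw [hv, parent_zero, depth_zero]
  · have := (parent_spec hconn hv).2
    omega

theorem depth_parent_iterate (hconn : G.Connected) (v : Fin n) (j : ℕ) :
    depth G ((parent G)^[j] v) = depth G v - j := by
  induction j with
  | zero => rfl
  | succ j ih =>
    rw [Function.iterate_succ_apply', depth_parent hconn, ih]
    omega

theorem mem_subtree {v w : Fin n} : w ∈ subtree G v ↔ ∃ j : ℕ, (parent G)^[j] w = v := by
  simp [subtree]

theorem mem_subtree_zero (hconn : G.Connected) (w : Fin n) : w ∈ subtree G 0 := by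
  refine mem_subtree.2 ⟨depth G w, ?_⟩
  rw [← depth_eq_zero hconn, depth_parent_iterate hconn, Nat.sub_self]

theorem depth_lt_of_mem_subtree (hconn : G.Connected) {x y : Fin n} (h : y ∈ subtree G x)
    (hne : x ≠ y) : depth G x < depth G y := by
  obtain ⟨j, rfl⟩ := mem_subtree.1 h
  rw [depth_parent_iterate hconn]
  have hj : j ≠ 0 := by
    rintro rfl
    exact hne rfl
  have hy : depth G y ≠ 0 := by
    intro h0
    rw [depth_eq_zero hconn] at h0
    subst h0
    exact hne (Function.iterate_fixed parent_zero j)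
  omega

/-- Routing within a subtree goes down one level in each hop. -/
theorem exists_hop_iterate_down (hconn : G.Connected) (y : Fin n) (N : ℕ) (x : Fin n)
    (hN : depth G y - depth G x ≤ N) (h : y ∈ subtree G x) : ∃ j ≤ N, (hop G y)^[j] x = y := by
  induction N generalizing x with
  | zero =>
    refine ⟨0, le_rfl, ?_⟩
    by_contra hne
    have := depth_lt_of_mem_subtree hconn h hne
    omega
  | succ N ih =>
    by_cases hne : x = y
    · exact ⟨0, Nat.zero_le _, hne⟩
    · have hlt := depth_lt_of_mem_subtree hconn h hne
      have hh : hop G y x = (parent G)^[depth G y - depth G x - 1] y := by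
        rw [hop, if_neg hne, if_pos h]
      obtain ⟨j, hj, hj'⟩ := ih (hop G y x)
        (by rw [hh, depth_parent_iterate hconn]; omega) (by rw [hh]; exact mem_subtree.2 ⟨_, rfl⟩)
      exact ⟨j + 1, by omega, by rw [Function.iterate_succ_apply, hj']⟩

/-- Routing goes up to the first ancestor of `x` whose subtree contains `y`, and then down. -/
theorem exists_hop_iterate (hconn : G.Connected) (y : Fin n) (N : ℕ) (x : Fin n)
    (hN : depth G x = N) : ∃ j ≤ N + depth G y, (hop G y)^[j] x = y := by
  induction N generalizing x with
  | zero =>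
    rw [depth_eq_zero hconn] at hN
    subst hN
    obtain ⟨j, hj, hj'⟩ := exists_hop_iterate_down hconn y (depth G y) 0 (Nat.sub_le _ _)
      (mem_subtree_zero hconn y)
    exact ⟨j, by omega, hj'⟩
  | succ N ih =>
    by_cases h : y ∈ subtree G x
    · obtain ⟨j, hj, hj'⟩ := exists_hop_iterate_down hconn y (depth G y) x (Nat.sub_le _ _) h
      exact ⟨j, by omega, hj'⟩
    · have hne : x ≠ y := by
        rintro rfl
        exact h (mem_subtree.2 ⟨0, rfl⟩)
      have hh : hop G y x = parent G x := by rw [hop, if_neg hne, if_neg h]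
      obtain ⟨j, hj, hj'⟩ := ih (hop G y x) (by rw [hh, depth_parent hconn]; omega)
      exact ⟨j + 1, by omega, by rw [Function.iterate_succ_apply, hj']⟩

theorem length_route_le (hconn : G.Connected) (x y : Fin n) (msg : Msg) :
    (route G x y msg).length ≤ 2 * G.diam := by
  rw [route, List.length_map, List.length_range]
  obtain ⟨j, hj, hj'⟩ := exists_hop_iterate hconn y _ x rfl
  have h1 : sInf {j : ℕ | (hop G y)^[j] x = y} ≤ j := Nat.sInf_le hj'
  have h2 := depth_le_diam hconn x
  have h3 := depth_le_diam hconn y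
  omega

end Tree

/-! ### Counting messages -/

section Count

variable {n : ℕ} [NeZero n] {G : SimpleGraph (Fin n)} [DecidableRel G.Adj] {ℓ : ℕ}

theorem messages_append (t t' : List (Round G)) :
    messages (t ++ t') = messages t + messages t' := by
  simp [messages]

theorem count_single_le (x y : Fin n) (msg : Msg) : (single G x y msg).count ≤ 1 := by
  refine Finset.card_le_one.2 fun d hd d' hd' => ?_
  replace hd := (Finset.mem_filter.1 hd).2
  replace hd' := (Finset.mem_filter.1 hd').2
  rw [single] at hd hd'
  split_ifs at hd hd' with h h'
  · exact SimpleGraph.Dart.ext _ _ (Prod.ext (h.1.trans h'.1.symm) (h.2.trans h'.2.symm))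
  all_goals simp at hd hd'

theorem messages_le_length {t : List (Round G)} (h : ∀ r ∈ t, r.count ≤ 1) :
    messages t ≤ t.length := by
  have := List.sum_le_card_nsmul (t.map Round.count) 1 (by simpa using h)
  simpa [messages] using this

theorem messages_map_single_le (N : ℕ) (x y : ℕ → Fin n) (msg : ℕ → Msg) :
    messages ((List.range N).map fun t => single G (x t) (y t) (msg t)) ≤ N := by
  refine (messages_le_length ?_).trans (by simp)
  intro r hr
  obtain ⟨t, _, rfl⟩ := List.mem_map.1 hr
  exact count_single_le _ _ _

theorem messages_route_le (x y : Fin n) (msg : Msg) :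
    messages (route G x y msg) ≤ (route G x y msg).length := by
  refine (messages_map_single_le _ _ _ _).trans (le_of_eq ?_)
  rw [route, List.length_map, List.length_range]

theorem messages_map_range (N : ℕ) (f : ℕ → Round G) :
    messages ((List.range N).map f) = ∑ t ∈ Finset.range N, (f t).count := by
  induction N with
  | zero => rfl
  | succ N ih =>
    rw [List.range_succ, List.map_append, messages_append, ih, Finset.sum_range_succ]
    simp [messages]

theorem card_dart : Fintype.card G.Dart = 2 * G.edgeFinset.card := G.dart_card_eq_twice_card_edges

/-- If every directed edge is used at most once, there are at most `2 m` messages. -/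
theorem messages_le_card_dart {N : ℕ} {f : ℕ → Round G}
    (h : ∀ d t t', t < N → t' < N → (f t d).isSome → (f t' d).isSome → t = t') :
    messages ((List.range N).map f) ≤ 2 * G.edgeFinset.card := by
  rw [messages_map_range, ← card_dart]
  simp only [Round.count]
  rw [← Finset.card_sigma]
  refine Finset.card_le_card_of_injOn (fun p => p.2) (fun _ _ => Finset.mem_univ _) ?_
  rintro ⟨t, d⟩ hp ⟨t', d'⟩ hp' hd
  simp only [Finset.coe_sigma, Set.mem_sigma_iff, Finset.coe_range, Set.mem_Iio, Finset.mem_coe,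
    Finset.mem_filter, Finset.mem_univ, true_and] at hp hp' hd
  subst hd
  rw [h d t t' hp.1 hp'.1 hp.2 hp'.2]

theorem length_downWave (msg : Fin n → Msg) : (downWave G msg).length = G.diam := by
  simp [downWave]

theorem messages_downWave_le (msg : Fin n → Msg) :
    messages (downWave G msg) ≤ 2 * G.edgeFinset.card := by
  refine messages_le_card_dart fun d t t' _ _ h h' => ?_
  split_ifs at h h' with h1 h2
  · exact h1.2.symm.trans h2.2
  all_goals simp at h h'

theorem length_setup : (setup G).length = 3 * G.diam + 1 := by
  simp only [setup, List.length_append, List.length_map, List.length_range, length_downWave]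
  ring

theorem messages_setup_le : messages (setup G) ≤ 6 * G.edgeFinset.card := by
  have h1 : messages ((List.range (G.diam + 1)).map fun t (d : G.Dart) =>
      if depth G d.fst = t then some Msg.explore else none) ≤ 2 * G.edgeFinset.card := by
    refine messages_le_card_dart fun d t t' _ _ h h' => ?_
    split_ifs at h h' with h1 h2
    · exact h1.symm.trans h2
    all_goals simp at h h'
  have h2 : messages ((List.range G.diam).map fun t (d : G.Dart) =>
      if d.snd = parent G d.fst ∧ depth G d.fst = G.diam - t then
        some (Msg.size (subtree G d.fst).card) else none) ≤ 2 * G.edgeFinset.card := by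
    refine messages_le_card_dart fun d t t' ht ht' h h' => ?_
    split_ifs at h h' with h1 h2
    · have := h1.2.symm.trans h2.2
      omega
    all_goals simp at h h'
  rw [setup, messages_append, messages_append]
  have h3 := messages_downWave_le (G := G) fun y => .label (label G y)
  omega

theorem length_failRounds_le (hconn : G.Connected) (ω : Coins G ℓ) (st : RunState n) :
    (failRounds ω st).length ≤ 2 * G.diam := by
  have := depth_le_diam hconn (stitched ω st).pos
  rw [failRounds, List.length_append, List.length_map, List.length_range, length_downWave]
  omega

theorem messages_failRounds_le (hconn : G.Connected) (ω : Coins G ℓ) (st : RunState n) :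
    messages (failRounds ω st) ≤ G.diam + 2 * G.edgeFinset.card := by
  rw [failRounds, messages_append]
  exact add_le_add ((messages_map_single_le _ _ _ _).trans (depth_le_diam hconn _))
    (messages_downWave_le _)

theorem length_naiveRounds (ω : Coins G ℓ) (st : RunState n) :
    (naiveRounds ω st).length = ℓ - (stitched ω st).len := by
  simp [naiveRounds]

theorem messages_naiveRounds_le (ω : Coins G ℓ) (st : RunState n) :
    messages (naiveRounds ω st) ≤ ℓ - (stitched ω st).len :=
  messages_map_single_le _ _ _ _

/-! ### The rounds of an attempt -/

theorem stitch_cases (ω : Coins G ℓ) (e : ℕ) (s : Fin n) (st : TokenState G) :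
    (st.toTok.Stopped ℓ G ∧ stitch ω e s st = st) ∨
      (stitch ω e s st = { st with failed := true }) ∨
      (¬ st.toTok.Stopped ℓ G ∧ ∃ w : Short G,
        (stitch ω e s st).len = st.len + walkLen ω e w ∧
        (stitch ω e s st).log = st.log ++ route G st.pos (walkEnd ω e w)
          (.token s (label G (walkEnd ω e w)) (st.len + walkLen ω e w))) := by
  by_cases hs : st.failed = true ∨ ℓ < st.len + 2 * lam G ℓ
  · exact Or.inl ⟨hs, by rw [stitch, if_pos hs]⟩
  · right
    by_cases hu : st.used st.pos < numWalks G st.pos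
    · right
      refine ⟨hs, ⟨st.pos, pickCoin ω e st.pos ⟨st.used st.pos, hu⟩⟩, ?_⟩
      rw [stitch, if_neg hs, dif_pos hu]
      exact ⟨rfl, rfl⟩
    · left
      rw [stitch, if_neg hs, dif_neg hu]

/-- An invariant of the stitching loop holds at its end. -/
theorem stitched_induction {ω : Coins G ℓ} {st : RunState n} (p : TokenState G → Prop)
    (h0 : p ⟨source ω st.req, 0, st.used, false, []⟩)
    (hs : ∀ t, p t → p (stitch ω st.table (source ω st.req) t)) : p (stitched ω st) := by
  suffices h : ∀ i, p ((stitch ω st.table (source ω st.req))^[i]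
      ⟨source ω st.req, 0, st.used, false, []⟩) from h ℓ
  intro i
  induction i with
  | zero => exact h0
  | succ i ih =>
    rw [Function.iterate_succ_apply']
    exact hs _ ih

/-- Every short walk adds at least `λ` to the length and costs at most `2 D` rounds on the tree. -/
theorem length_log_mul_lam_le (hconn : G.Connected) (ω : Coins G ℓ) (st : RunState n) :
    (stitched ω st).log.length * lam G ℓ ≤ (stitched ω st).len * (2 * G.diam) := by
  refine stitched_induction (fun t => t.log.length * lam G ℓ ≤ t.len * (2 * G.diam)) (by simp) ?_
  intro t ht
  rcases stitch_cases ω st.table (source ω st.req) t with ⟨_, h⟩ | h | ⟨_, w, h1, h2⟩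
  · rwa [h]
  · rwa [h]
  · rw [h1, h2, List.length_append, add_mul, add_mul]
    refine add_le_add ht ?_
    rw [mul_comm]
    exact Nat.mul_le_mul (lam_le_walkLen ω _ w) (length_route_le hconn _ _ _)

theorem messages_log_le (ω : Coins G ℓ) (st : RunState n) :
    messages (stitched ω st).log ≤ (stitched ω st).log.length := by
  refine stitched_induction (fun t => messages t.log ≤ t.log.length) (by simp [messages]) ?_
  intro t ht
  rcases stitch_cases ω st.table (source ω st.req) t with ⟨_, h⟩ | h | ⟨_, w, h1, h2⟩
  · rwa [h]
  · rwa [h]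
  · rw [h2, List.length_append, messages_append]
    exact add_le_add ht (messages_route_le _ _ _)

theorem stitched_len_le (hlam : 1 ≤ lam G ℓ) (ω : Coins G ℓ) (st : RunState n) :
    (stitched ω st).len ≤ ℓ := by
  refine stitched_induction (fun t => t.len ≤ ℓ) (Nat.zero_le _) ?_
  intro t ht
  have := tokStep_len_le ω st.table hlam (t := t.toTok) ht
  rw [← toTok_stitch _ _ (source ω st.req)] at this
  exact this

/-- `ℓ` passes suffice for the stitching loop, since each adds at least `λ ≥ 1` to the length. -/
theorem stopped_stitched (hlam : 1 ≤ lam G ℓ) (ω : Coins G ℓ) (st : RunState n) :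
    (stitched ω st).toTok.Stopped ℓ G := by
  have : ∀ i, ((stitch ω st.table (source ω st.req))^[i]
      ⟨source ω st.req, 0, st.used, false, []⟩).toTok.Stopped ℓ G ∨
        i ≤ ((stitch ω st.table (source ω st.req))^[i]
          ⟨source ω st.req, 0, st.used, false, []⟩).len := by
    intro i
    induction i with
    | zero => exact Or.inr le_rfl
    | succ i ih =>
      rw [Function.iterate_succ_apply']
      generalize (stitch ω st.table (source ω st.req))^[i]
        ⟨source ω st.req, 0, st.used, false, []⟩ = t at ih ⊢
      rcases stitch_cases ω st.table (source ω st.req) t with ⟨h', h⟩ | h | ⟨h', w, h1, _⟩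
      · rw [h]
        exact Or.inl h'
      · rw [h]
        exact Or.inl (Or.inl rfl)
      · right
        have := lam_le_walkLen ω st.table w
        have := ih.resolve_left h'
        omega
  rcases this ℓ with h | h
  · exact h
  · right
    change ℓ < (stitched ω st).len + _
    change ℓ ≤ (stitched ω st).len at h
    omega

/-- The stitching part stops with less than `2 λ` steps left. -/
theorem length_attemptRounds_of_not_fails (hlam : 1 ≤ lam G ℓ) {ω : Coins G ℓ} {st : RunState n}
    (h : ¬ Fails ω st) :
    (attemptRounds ω st).length ≤ (stitched ω st).log.length + 2 * lam G ℓ := by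
  have : ℓ < (stitched ω st).len + 2 * lam G ℓ := (stopped_stitched hlam ω st).resolve_left h
  rw [attemptRounds, if_neg h, List.length_append, length_naiveRounds]
  omega

theorem length_attemptRounds_of_fails (hconn : G.Connected) {ω : Coins G ℓ} {st : RunState n}
    (h : Fails ω st) :
    (attemptRounds ω st).length ≤ (stitched ω st).log.length + 2 * G.diam +
      (preProcessing ω (st.table + 1)).length := by
  rw [attemptRounds, if_pos h, List.length_append, List.length_append]
  have := length_failRounds_le hconn ω st
  omega

theorem messages_attemptRounds_le (hconn : G.Connected) (ω : Coins G ℓ)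
    (st : RunState n) :
    messages (attemptRounds ω st) ≤ (stitched ω st).log.length + ℓ + G.diam +
      if Fails ω st then 2 * G.edgeFinset.card + messages (preProcessing ω (st.table + 1))
      else 0 := by
  have h0 := messages_log_le ω st
  rw [attemptRounds, messages_append]
  split_ifs with h
  · rw [messages_append]
    have := messages_failRounds_le hconn ω st
    omega
  · have := messages_naiveRounds_le ω st
    omega

end Count

/-! ### The messages of the pre-processing -/

section PreProcessing

variable {n : ℕ} [NeZero n] {G : SimpleGraph (Fin n)} [DecidableRel G.Adj] {ℓ : ℕ}
variable {ω : Coins G ℓ} {e : ℕ}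

/-- The order in which short walks cross an edge. -/
def priority (st : PreState G) (w : Short G) : ℕ ×ₗ (Fin n ×ₗ ℕ) :=
  toLex (st.hops w, toLex (w.1, (w.2 : ℕ)))

/-- The precedence of waiting messages is a comparison of priorities in a linear order, so that
among finitely many there is a first one. -/
theorem before_iff {st : PreState G} {w' w : Short G} :
    Before st w' w ↔ priority st w' < priority st w := by
  simp [Before, priority, Prod.Lex.toLex_lt_toLex]

theorem Crosses.edge_unique {st : PreState G} {w : Short G} {d d' : G.Dart}
    (h : Crosses ω e st w d) (h' : Crosses ω e st w d') : d = d' :=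
  SimpleGraph.Dart.ext _ _ (Prod.ext (h.1.2.1.symm.trans h'.1.2.1) (h.1.2.2.symm.trans h'.1.2.2))

/-- If a message waits for an edge, then some message crosses it, with no more hops so far. -/
theorem Waits.exists_crosses {st : PreState G} {w : Short G} {d : G.Dart}
    (h : Waits ω e st w d) : ∃ w', Crosses ω e st w' d ∧ st.hops w' ≤ st.hops w := by
  obtain ⟨w', hw', hmin⟩ := Finset.exists_min_image
    (Finset.univ.filter fun w => Waits ω e st w d) (priority st) ⟨w, by simpa using h⟩
  simp only [Finset.mem_filter, Finset.mem_univ, true_and] at hw' hmin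
  refine ⟨w', ⟨hw', fun w'' h'' => by rw [before_iff, not_lt]; exact hmin w'' h''⟩, ?_⟩
  by_contra hlt
  exact (not_lt.2 (hmin w h)) (before_iff.1 (Or.inl (not_le.1 hlt)))

theorem preState_succ (t : ℕ) : preState ω e (t + 1) = preNext ω e (preState ω e t) :=
  Function.iterate_succ_apply' _ _ _

theorem hops_preNext_of_crosses {st : PreState G} {w : Short G} {d : G.Dart}
    (h : Crosses ω e st w d) : (preNext ω e st).hops w = st.hops w + 1 := if_pos ⟨d, h⟩

theorem hops_le_preNext (st : PreState G) (w : Short G) :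
    st.hops w ≤ (preNext ω e st).hops w := by
  rw [preNext]
  dsimp only
  split_ifs
  · exact Nat.le_succ _
  · exact le_rfl

theorem hops_mono (w : Short G) : Monotone fun t => (preState ω e t).hops w :=
  monotone_nat_of_le_succ fun t => by
    rw [preState_succ]
    exact hops_le_preNext _ _

theorem hops_le (t : ℕ) (w : Short G) : (preState ω e t).hops w ≤ 2 * walkLen ω e w := by
  induction t with
  | zero => exact Nat.zero_le _
  | succ t ih =>
    rw [preState_succ, preNext]
    dsimp only
    split_ifs with h
    · obtain ⟨d, hd⟩ := h
      exact hd.1.1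
    · exact ih

/-- Each message of a short walk raises the number of hops of this walk by one. -/
theorem card_crossed_add_sum_hops_le (st : PreState G) :
    (Finset.univ.filter fun d : G.Dart => ∃ w, Crosses ω e st w d).card + ∑ w, st.hops w ≤
      ∑ w, (preNext ω e st).hops w := by
  have h1 : ∑ w, (preNext ω e st).hops w =
      (Finset.univ.filter fun w : Short G => ∃ d, Crosses ω e st w d).card + ∑ w, st.hops w := by
    rw [Finset.card_filter, ← Finset.sum_add_distrib]
    refine Finset.sum_congr rfl fun w _ => ?_
    rw [preNext]
    dsimp only
    split_ifs <;> ring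
  rw [h1]
  refine Nat.add_le_add_right ?_ _
  have hc : ∀ d ∈ Finset.univ.filter fun d : G.Dart => ∃ w, Crosses ω e st w d,
      ∃ w, Crosses ω e st w d := fun d hd => (Finset.mem_filter.1 hd).2
  refine Finset.card_le_card_of_forall_subsingleton (fun d w => Crosses ω e st w d) ?_ ?_
  · intro d hd
    obtain ⟨w, hw⟩ := hc d hd
    exact ⟨w, Finset.mem_filter.2 ⟨Finset.mem_univ _, d, hw⟩, hw⟩
  · rintro w - d ⟨_, hd⟩ d' ⟨_, hd'⟩
    exact hd.edge_unique hd'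

/-- Every node reports to its parent only once. -/
theorem card_reports_add_card_reported_le (st : PreState G) :
    (Finset.univ.filter fun d : G.Dart => Reports ω e st d).card + st.reported.card ≤
      (preNext ω e st).reported.card := by
  rw [preNext]
  dsimp only
  rw [Finset.card_union_of_disjoint, add_comm]
  · refine Nat.add_le_add_left (Finset.card_le_card_of_injOn (fun d => d.fst) ?_ ?_) _
    · intro d hd
      simp only [Finset.coe_filter, Finset.mem_univ, true_and, Set.mem_ofPred_eq] at hd ⊢
      exact ⟨d, rfl, hd⟩
    · intro d hd d' hd' h
      simp only [Finset.coe_filter, Finset.mem_univ, true_and, Set.mem_ofPred_eq] at hd hd' h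
      refine SimpleGraph.Dart.ext _ _ (Prod.ext h ?_)
      rw [hd.1, hd'.1, h]
  · rw [Finset.disjoint_left]
    intro v hv hv'
    simp only [Finset.mem_filter, Finset.mem_univ, true_and] at hv'
    obtain ⟨d, rfl, hd⟩ := hv'
    exact hd.2.1 hv

theorem count_preRound_le (st : PreState G) :
    (preRound ω e st).count ≤
      (Finset.univ.filter fun d : G.Dart => ∃ w, Crosses ω e st w d).card +
        (Finset.univ.filter fun d : G.Dart => Reports ω e st d).card := by
  refine le_trans (Finset.card_le_card ?_) (Finset.card_union_le _ _)
  intro d hd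
  replace hd := (Finset.mem_filter.1 hd).2
  rw [preRound] at hd
  simp only [Finset.mem_union, Finset.mem_filter, Finset.mem_univ, true_and]
  split_ifs at hd with h1 h2
  · exact Or.inl h1
  · exact Or.inr h2
  · simp at hd

/-- The hops made and the reports sent bound the messages, at any time. -/
theorem sum_count_preRound_le (N : ℕ) :
    ∑ t ∈ Finset.range N, (preRound ω e (preState ω e t)).count ≤
      ∑ w, (preState ω e N).hops w + (preState ω e N).reported.card := by
  induction N with
  | zero => simp
  | succ N ih =>
    rw [Finset.sum_range_succ, preState_succ]
    have h1 := count_preRound_le (ω := ω) (e := e) (preState ω e N)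
    have h2 := card_crossed_add_sum_hops_le (ω := ω) (e := e) (preState ω e N)
    have h3 := card_reports_add_card_reported_le (ω := ω) (e := e) (preState ω e N)
    omega

theorem messages_preProcessing_le (hlam : 1 ≤ lam G ℓ) (ω : Coins G ℓ) (e : ℕ) :
    messages (preProcessing ω e) ≤
      4 * lam G ℓ * Fintype.card (Short G) + n + 2 * G.edgeFinset.card := by
  rw [preProcessing, messages_append, messages_map_range]
  refine add_le_add ((sum_count_preRound_le _).trans (add_le_add ?_ ?_)) (messages_downWave_le _)
  · refine (Finset.sum_le_card_nsmul _ _ (4 * lam G ℓ) fun w _ => ?_).trans (le_of_eq ?_)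
    · have := hops_le (ω := ω) (e := e) (sInf {t : ℕ | Ready ω e (preState ω e t) 0}) w
      have := walkLen_lt ω e w hlam
      omega
    · rw [smul_eq_mul, mul_comm, Finset.card_univ]
  · exact (Finset.card_le_univ _).trans (by simp)

/-! ### Congestion -/

/-- The short walks that cross the directed edge `d` at hop `h`. -/
def crossers (ω : Coins G ℓ) (e h : ℕ) (d : G.Dart) : Finset (Short G) :=
  Finset.univ.filter fun w =>
    h < 2 * walkLen ω e w ∧ trip ω e w h = d.fst ∧ trip ω e w (h + 1) = d.snd

theorem adj_walkPos (hG : ∀ x, ∃ y, G.Adj x y) (ω : Coins G ℓ) (e : ℕ) (w : Short G) (T : ℕ) :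
    G.Adj (walkPos ω e w T) (walkPos ω e w (T + 1)) :=
  adj_of_next hG (hopCoin ω e w T (walkPos ω e w T))

theorem adj_trip (hG : ∀ x, ∃ y, G.Adj x y) (ω : Coins G ℓ) (e : ℕ) (w : Short G) {h : ℕ}
    (hh : h < 2 * walkLen ω e w) : G.Adj (trip ω e w h) (trip ω e w (h + 1)) := by
  rw [trip, trip]
  split_ifs with h1 h2 h3
  · exact adj_walkPos hG ω e w h
  · obtain rfl : h = walkLen ω e w := by omega
    have := adj_walkPos hG ω e w (2 * walkLen ω e w - (walkLen ω e w + 1))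
    rw [show 2 * walkLen ω e w - (walkLen ω e w + 1) + 1 = walkLen ω e w by omega] at this
    exact this.symm
  · omega
  · have := adj_walkPos hG ω e w (2 * walkLen ω e w - (h + 1))
    rw [show 2 * walkLen ω e w - (h + 1) + 1 = 2 * walkLen ω e w - h by omega] at this
    exact this.symm

/-- If no directed edge is crossed by more than `B` short walks at the same hop, every short walk
has made `h` hops after `h * B` rounds: at this time, the walks with fewer hops have arrived, and
the at most `B` walks that cross an edge at hop `h` go before all others. -/
theorem min_le_hops (hG : ∀ x, ∃ y, G.Adj x y) {B : ℕ}
    (hB : ∀ h d, (crossers ω e h d).card ≤ B) (h : ℕ) (w : Short G) :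
    min h (2 * walkLen ω e w) ≤ (preState ω e (h * B)).hops w := by
  induction h generalizing w with
  | zero => simp
  | succ h ih =>
    by_cases hw : h < 2 * walkLen ω e w
    swap
    · have h1 := ih w
      have h2 := hops_mono (ω := ω) (e := e) w (show h * B ≤ (h + 1) * B by gcongr; omega)
      simp only at h2
      omega
    have hge : ∀ w', min h (2 * walkLen ω e w') ≤ (preState ω e (h * B)).hops w' := ih
    by_contra hlt
    have hlt' : (preState ω e ((h + 1) * B)).hops w ≤ h := by omega
    set d : G.Dart := ⟨(trip ω e w h, trip ω e w (h + 1)), adj_trip hG ω e w hw⟩ with hd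
    -- As long as `w` waits at hop `h`, in each round one of the at most `B` competitors gets
    -- through.
    have key : ∀ i ≤ B, ((crossers ω e h d).filter fun w' =>
        (preState ω e (h * B + i)).hops w' ≤ h).card + i ≤ B := by
      intro i
      induction i with
      | zero => exact fun _ => (Finset.card_filter_le _ _).trans (hB h d)
      | succ i ihi =>
        intro hi
        have h1 := ihi (by omega)
        set t := h * B + i with ht
        have hmono : ∀ w', (preState ω e (h * B)).hops w' ≤ (preState ω e t).hops w' :=
          fun w' => hops_mono w' (by omega)
        have hwt : (preState ω e t).hops w = h := by
          have h2 := hops_mono (ω := ω) (e := e) w (show t ≤ (h + 1) * B by rw [add_mul]; omega)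
          simp only at h2
          have h3 := hmono w
          have h4 := hge w
          omega
        have hwait : Waits ω e (preState ω e t) w d := by
          refine ⟨by rw [hwt]; exact hw, ?_, ?_⟩ <;> rw [hwt]
        obtain ⟨w', hc, hle⟩ := hwait.exists_crosses
        have hw' : (preState ω e t).hops w' = h := by
          have h3 := hmono w'
          have h4 := hge w'
          have h5 := hc.1.1
          omega
        have hmem : w' ∈ crossers ω e h d := by
          have := hc.1
          rw [Waits, hw'] at this
          simpa [crossers] using this
        have hss : ((crossers ω e h d).filter fun w' =>
              (preState ω e (h * B + (i + 1))).hops w' ≤ h)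
            ⊂ ((crossers ω e h d).filter fun w' => (preState ω e t).hops w' ≤ h) := by
          rw [Finset.ssubset_iff_of_subset]
          · refine ⟨w', by simp [hmem, hw'], ?_⟩
            rw [Finset.mem_filter, not_and, ← add_assoc, ← ht, preState_succ,
              hops_preNext_of_crosses hc, hw']
            omega
          · intro w'' hw''
            rw [Finset.mem_filter] at hw'' ⊢
            exact ⟨hw''.1, (hops_mono w'' (show t ≤ h * B + (i + 1) by omega)).trans hw''.2⟩
        have := Finset.card_lt_card hss
        omega
    have h1 := key B le_rfl
    rw [show h * B + B = (h + 1) * B by ring] at h1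
    have h2 : 0 < ((crossers ω e h d).filter fun w' =>
        (preState ω e ((h + 1) * B)).hops w' ≤ h).card := by
      refine Finset.card_pos.2 ⟨w, ?_⟩
      simp [crossers, hw, hlt', hd]
    omega

/-- A short walk and the answer to it have less than `4 λ` hops. -/
theorem hops_eq (hG : ∀ x, ∃ y, G.Adj x y) (hlam : 1 ≤ lam G ℓ) {B : ℕ}
    (hB : ∀ h d, (crossers ω e h d).card ≤ B) {t : ℕ} (ht : 4 * lam G ℓ * B ≤ t) (w : Short G) :
    (preState ω e t).hops w = 2 * walkLen ω e w := by
  have h1 := min_le_hops hG hB (4 * lam G ℓ) w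
  have h2 := hops_mono (ω := ω) (e := e) w ht
  have h3 := hops_le (ω := ω) (e := e) t w
  have h4 := walkLen_lt ω e w hlam
  simp only at h2
  omega

/-- When all short walks are completed, the reports climb one level of the tree in each round. -/
theorem mem_reported (hconn : G.Connected) {t₀ : ℕ}
    (h : ∀ t, t₀ ≤ t → ∀ w, (preState ω e t).hops w = 2 * walkLen ω e w) (j : ℕ) {v : Fin n}
    (hv : v ≠ 0) (hj : G.diam + 1 ≤ depth G v + j) : v ∈ (preState ω e (t₀ + j)).reported := by
  induction j generalizing v with
  | zero =>
    have := depth_le_diam hconn v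
    omega
  | succ j ih =>
    rw [← add_assoc, preState_succ, preNext]
    dsimp only
    rw [Finset.mem_union]
    by_cases hr : v ∈ (preState ω e (t₀ + j)).reported
    · exact Or.inl hr
    · right
      simp only [Finset.mem_filter, Finset.mem_univ, true_and]
      refine ⟨⟨(v, parent G v), (parent_spec hconn hv).1⟩, rfl, rfl, hr, ⟨?_, ?_⟩, ?_⟩
      · exact fun i => h _ (Nat.le_add_right _ _) _
      · intro y hy hpy
        refine ih hy ?_
        have := (parent_spec hconn hy).2
        rw [show parent G y = v from hpy] at this
        omega
      · intro w hw
        have := hw.1.1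
        rw [h _ (Nat.le_add_right _ _)] at this
        exact lt_irrefl _ this

theorem length_preProcessing_le (hG : ∀ x, ∃ y, G.Adj x y) (hconn : G.Connected)
    (hlam : 1 ≤ lam G ℓ) {B : ℕ} (hB : ∀ h d, (crossers ω e h d).card ≤ B) :
    (preProcessing ω e).length ≤ 4 * lam G ℓ * B + 2 * G.diam := by
  have hr : Ready ω e (preState ω e (4 * lam G ℓ * B + G.diam)) 0 := by
    refine ⟨fun i => hops_eq hG hlam hB (Nat.le_add_right _ _) _, fun y hy hpy => ?_⟩
    refine mem_reported hconn (fun t ht w => hops_eq hG hlam hB ht w) _ hy ?_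
    have := (parent_spec hconn hy).2
    rw [hpy, depth_zero] at this
    omega
  have h1 : sInf {t : ℕ | Ready ω e (preState ω e t) 0} ≤ _ := Nat.sInf_le hr
  rw [preProcessing, List.length_append, List.length_map, List.length_range, length_downWave]
  omega

end PreProcessing

/-! ### Congestion is unlikely -/

section Congestion

variable {n : ℕ} [NeZero n] {G : SimpleGraph (Fin n)} [DecidableRel G.Adj] {ℓ : ℕ}

theorem disjoint_shortCoins {e : ℕ} {w w' : Short G} (h : w ≠ w') :
    Disjoint (shortCoins e w) (shortCoins e w') := by
  rw [Set.disjoint_left]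
  rintro _ (rfl | ⟨t, x, rfl⟩) (h' | ⟨t', x', h'⟩)
  · injection h' with _ h'; exact h h'
  · cases h'
  · cases h'
  · injection h' with _ h'; exact h h'

/-- Time, start and end of the step of a short walk of length `L` that makes it, or the answer to
it, cross the directed edge `d` at hop `h`. -/
def stepOf (L h : ℕ) (d : G.Dart) : ℕ × Fin n × Fin n :=
  if h < L then (h, d.fst, d.snd) else (2 * L - (h + 1), d.snd, d.fst)

theorem mem_crossers_iff {ω : Coins G ℓ} {e h : ℕ} {d : G.Dart} {w : Short G} :
    w ∈ crossers ω e h d ↔ h < 2 * walkLen ω e w ∧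
      walkPos ω e w (stepOf (walkLen ω e w) h d).1 = (stepOf (walkLen ω e w) h d).2.1 ∧
      walkPos ω e w ((stepOf (walkLen ω e w) h d).1 + 1) = (stepOf (walkLen ω e w) h d).2.2 := by
  simp only [crossers, Finset.mem_filter, Finset.mem_univ, true_and]
  refine and_congr_right fun hh => ?_
  rw [stepOf, trip, trip]
  by_cases h1 : h < walkLen ω e w
  · rw [if_pos h1, if_pos h1.le, if_pos (by omega)]
  · rw [if_neg h1, if_neg (show ¬ h + 1 ≤ walkLen ω e w by omega), and_comm,
      show 2 * walkLen ω e w - (h + 1) + 1 = 2 * walkLen ω e w - h by omega]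
    by_cases h2 : h ≤ walkLen ω e w
    · obtain rfl : h = walkLen ω e w := by omega
      rw [if_pos le_rfl, show 2 * walkLen ω e w - walkLen ω e w = walkLen ω e w by omega]
    · rw [if_neg h2]

/-- The part of the event that `w` crosses `d` at hop `h` in which the random part of its length
is `r`. -/
def crossCell (e h : ℕ) (d : G.Dart) (w : Short G) (r : Fin (lam G ℓ - 1 + 1)) :
    Set (Coins G ℓ) :=
  {ω | lenCoin ω e w = r ∧ walkPos ω e w (stepOf (lam G ℓ + r) h d).1 =
      (stepOf (lam G ℓ + r) h d).2.1} ∩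
    {ω | (walkPos ω e w ((stepOf (lam G ℓ + r) h d).1 + 1)) = (stepOf (lam G ℓ + r) h d).2.2}

theorem isLocal_crossCell (hG : ∀ x, ∃ y, G.Adj x y) (e h : ℕ) (d : G.Dart) (w : Short G)
    (r : Fin (lam G ℓ - 1 + 1)) : IsLocal (shortCoins e w) (crossCell (ℓ := ℓ) e h d w r) := by
  refine (isLocal_len_walkPos hG e w r _ _).inter
    (((isCoinWalk_walkPos hG e w).isLocal _ _).mono ?_)
  rintro _ ⟨t, _, x, rfl⟩
  exact Or.inr ⟨t, x, rfl⟩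

theorem setOf_mem_crossers (e h : ℕ) (d : G.Dart) (w : Short G) :
    {ω : Coins G ℓ | w ∈ crossers ω e h d} =
      ⋃ r : {r : Fin (lam G ℓ - 1 + 1) // h < 2 * (lam G ℓ + r)}, crossCell e h d w r := by
  ext ω
  rw [Set.mem_ofPred_eq, mem_crossers_iff, Set.mem_iUnion]
  constructor
  · rintro ⟨h1, h2, h3⟩
    exact ⟨⟨lenCoin ω e w, h1⟩, ⟨rfl, h2⟩, h3⟩
  · rintro ⟨⟨r, h1⟩, ⟨rfl, h2⟩, h3⟩
    exact ⟨h1, h2, h3⟩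

theorem isLocal_mem_crossers (hG : ∀ x, ∃ y, G.Adj x y) (e h : ℕ) (d : G.Dart) (w : Short G) :
    IsLocal (shortCoins e w) {ω : Coins G ℓ | w ∈ crossers ω e h d} := by
  rw [setOf_mem_crossers]
  exact IsLocal.iUnion fun r => isLocal_crossCell hG e h d w r.1

/-- Given its length, a walk makes the relevant step at a fixed time. -/
theorem measure_crossCell (hG : ∀ x, ∃ y, G.Adj x y) (e h : ℕ) (d : G.Dart) (w : Short G)
    (r : Fin (lam G ℓ - 1 + 1)) :
    coinMeasure G ℓ (crossCell e h d w r) =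
      ((lam G ℓ - 1 + 1 : ℕ) : ℝ≥0∞)⁻¹ * ENNReal.ofReal
        ((transition G ^ (stepOf (lam G ℓ + r) h d).1) w.1 (stepOf (lam G ℓ + r) h d).2.1 *
          transition G (stepOf (lam G ℓ + r) h d).2.1 (stepOf (lam G ℓ + r) h d).2.2) := by
  rcases hs : stepOf (lam G ℓ + r) h d with ⟨T, x, y⟩
  have hA : IsLocal ({CoinIdx.len e w} ∪ {i | ∃ t < T, ∃ x, i = CoinIdx.hop e w t x})
      {ω : Coins G ℓ | lenCoin ω e w = r ∧ walkPos ω e w T = x} :=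
    ((isLocal_lenCoin e w r).mono Set.subset_union_left).inter
      (((isCoinWalk_walkPos hG e w).isLocal T x).mono Set.subset_union_right)
  have h1 := (measure_inter_next hG (CoinIdx.hop e w T x) (fun ω => hopCoin ω e w T x)
    (fun c => IsLocal.eval (X := CoinType G ℓ) (CoinIdx.hop e w T x) c)
    (fun c S A hA hi => hA.measure_inter_coin (i := (CoinIdx.hop e w T x)) hi c) y).2 _ _ hA (by
      rintro (h | ⟨t, ht, x', h⟩)
      · cases h
      · injection h with _ _ h _
        omega)
  have h2 := (IsLocal.univ (S := (∅ : Set (CoinIdx G)))).measure_inter_len_walkPos (ℓ := ℓ) hG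
    (e := e) (w := w) (Set.empty_disjoint _) r T x
  rw [Set.univ_inter, measure_univ, one_mul] at h2
  rw [h2, mul_assoc, ← ENNReal.ofReal_mul (transition_pow_nonneg _ _ _)] at h1
  rw [← h1, crossCell, hs]
  congr 1
  ext ω
  simp only [Set.mem_inter_iff, Set.mem_ofPred_eq]
  refine and_congr_right fun hω => ?_
  rw [← hω.2]
  rfl

theorem numWalks_le (hG : ∀ x, ∃ y, G.Adj x y) (hn : 1 ≤ n) (v : Fin n) :
    (numWalks G v : ℝ) ≤ (Real.log n + 1) * G.degree v := by
  have h1 : (1 : ℝ) ≤ G.degree v := by exact_mod_cast degree_pos hG v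
  have h2 : 0 ≤ Real.log n := Real.log_nonneg (by exact_mod_cast hn)
  have h3 := Nat.ceil_lt_add_one (mul_nonneg (Nat.cast_nonneg (G.degree v)) h2)
  rw [numWalks]
  linarith

/-- The expected number of short walks that go from `x` to `y` at time `T` is at most `log n + 1`,
because the numbers of walks started are nearly proportional to the stationary distribution. -/
theorem sum_numWalks_mul_transition_le (hG : ∀ x, ∃ y, G.Adj x y) (hn : 1 ≤ n) (T : ℕ)
    (x y : Fin n) :
    ∑ w : Short G, (transition G ^ T) w.1 x * transition G x y ≤ Real.log n + 1 := by
  have hL : 0 ≤ Real.log n := Real.log_nonneg (by exact_mod_cast hn)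
  have hx : (0 : ℝ) < G.degree x := by exact_mod_cast degree_pos hG x
  have h1 : transition G x y ≤ 1 / G.degree x := by
    rw [transition, Matrix.of_apply]
    split_ifs
    · exact le_rfl
    · positivity
  calc ∑ w : Short G, (transition G ^ T) w.1 x * transition G x y
      = (∑ v, (numWalks G v : ℝ) * (transition G ^ T) v x) * transition G x y := by
        rw [Fintype.sum_sigma, Finset.sum_mul]
        refine Finset.sum_congr rfl fun v _ => ?_
        simp [mul_assoc]
    _ ≤ (∑ v, (Real.log n + 1) * G.degree v * (transition G ^ T) v x) * (1 / G.degree x) := by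
        refine mul_le_mul (Finset.sum_le_sum fun v _ => mul_le_mul_of_nonneg_right
          (numWalks_le hG hn v) (transition_pow_nonneg _ _ _)) h1 (transition_nonneg _ _) ?_
        exact Finset.sum_nonneg fun v _ => mul_nonneg (by positivity) (transition_pow_nonneg _ _ _)
    _ = Real.log n + 1 := by
        simp only [mul_assoc]
        rw [← Finset.mul_sum, sum_degree_mul_transition_pow hG]
        field_simp

theorem sum_measure_mem_crossers_le (hG : ∀ x, ∃ y, G.Adj x y) (hn : 1 ≤ n) (e h : ℕ)
    (d : G.Dart) :
    ∑ w, coinMeasure G ℓ {ω | w ∈ crossers ω e h d} ≤ ENNReal.ofReal (Real.log n + 1) := by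
  have h1 : ∀ w, coinMeasure G ℓ {ω | w ∈ crossers ω e h d} ≤
      ∑ r, coinMeasure G ℓ (crossCell e h d w r) := by
    intro w
    refine (measure_mono ?_).trans (measure_iUnion_fintype_le _ _)
    rw [setOf_mem_crossers]
    exact Set.iUnion_subset fun r => Set.subset_iUnion (fun r => crossCell e h d w r) r.1
  refine (Finset.sum_le_sum fun w _ => h1 w).trans ?_
  rw [Finset.sum_comm]
  have h2 : ∀ r, ∑ w, coinMeasure G ℓ (crossCell e h d w r) ≤
      ((lam G ℓ - 1 + 1 : ℕ) : ℝ≥0∞)⁻¹ * ENNReal.ofReal (Real.log n + 1) := by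
    intro r
    simp only [measure_crossCell hG]
    rw [← Finset.mul_sum, ← ENNReal.ofReal_sum_of_nonneg
      fun w _ => mul_nonneg (transition_pow_nonneg _ _ _) (transition_nonneg _ _)]
    exact mul_le_mul' le_rfl (ENNReal.ofReal_le_ofReal (sum_numWalks_mul_transition_le hG hn _ _ _))
  refine (Finset.sum_le_card_nsmul _ _ _ fun r _ => h2 r).trans (le_of_eq ?_)
  rw [Finset.card_univ, Fintype.card_fin, nsmul_eq_mul, ← mul_assoc,
    ENNReal.mul_inv_cancel (by simp) (ENNReal.natCast_ne_top _), one_mul]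

/-- `2` if the short walk crosses the edge at the hop, and else `1`. -/
def crossWeight (e h : ℕ) (d : G.Dart) (w : Short G) (ω : Coins G ℓ) : ℝ≥0∞ :=
  1 + {ω : Coins G ℓ | w ∈ crossers ω e h d}.indicator 1 ω

theorem measurable_crossWeight (hG : ∀ x, ∃ y, G.Adj x y) (e h : ℕ) (d : G.Dart) (w : Short G) :
    Measurable (crossWeight (ℓ := ℓ) e h d w) :=
  (measurable_one.indicator (isLocal_mem_crossers hG e h d w).meas).const_add 1

theorem lintegral_crossWeight (hG : ∀ x, ∃ y, G.Adj x y) (e h : ℕ) (d : G.Dart) (w : Short G) :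
    ∫⁻ ω, crossWeight e h d w ω ∂(coinMeasure G ℓ) =
      1 + coinMeasure G ℓ {ω | w ∈ crossers ω e h d} := by
  simp only [crossWeight]
  rw [lintegral_add_left measurable_const, lintegral_one, measure_univ,
    lintegral_indicator_one (isLocal_mem_crossers hG e h d w).meas]

theorem dependsOn_prod_crossWeight (hG : ∀ x, ∃ y, G.Adj x y) (e h : ℕ) (d : G.Dart)
    (s : Finset (Short G)) :
    DependsOn (fun ω : Coins G ℓ => ∏ w ∈ s, crossWeight e h d w ω)
      (⋃ w ∈ s, shortCoins e w) := by
  intro x y hxy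
  refine Finset.prod_congr rfl fun w hw => ?_
  have := (isLocal_mem_crossers (ℓ := ℓ) hG e h d w).dependsOn_indicator
    (x := x) (y := y) fun i hi => hxy i (Set.mem_biUnion hw hi)
  rw [crossWeight, crossWeight, this]

/-- The short walks of a table are independent. -/
theorem lintegral_prod_crossWeight (hG : ∀ x, ∃ y, G.Adj x y) (e h : ℕ) (d : G.Dart)
    (s : Finset (Short G)) :
    ∫⁻ ω, ∏ w ∈ s, crossWeight e h d w ω ∂(coinMeasure G ℓ) =
      ∏ w ∈ s, (1 + coinMeasure G ℓ {ω | w ∈ crossers ω e h d}) := by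
  induction s using Finset.induction_on with
  | empty => simp
  | insert w s hw ih =>
    simp only [Finset.prod_insert hw]
    rw [← ih, ← lintegral_crossWeight hG]
    refine lintegral_mul_of_dependsOn _ (S := shortCoins e w) (T := ⋃ w ∈ s, shortCoins e w) ?_
      (measurable_crossWeight hG e h d w)
      (Finset.measurable_prod _ fun w _ => measurable_crossWeight hG e h d w) ?_
      (dependsOn_prod_crossWeight hG e h d s)
    · refine Set.disjoint_iUnion₂_right.2 fun w' hw' => disjoint_shortCoins ?_
      rintro rfl
      exact hw hw'
    · simpa using dependsOn_prod_crossWeight (ℓ := ℓ) hG e h d {w}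

theorem prod_crossWeight (e h : ℕ) (d : G.Dart) (ω : Coins G ℓ) :
    ∏ w, crossWeight e h d w ω = 2 ^ (crossers ω e h d).card := by
  have : ∀ w, crossWeight e h d w ω = if w ∈ crossers ω e h d then 2 else 1 := by
    intro w
    rw [crossWeight, Set.indicator_apply]
    simp only [Set.mem_ofPred_eq, Pi.one_apply]
    split_ifs
    · norm_num
    · simp
  simp [this]

/-- Chernoff bound for the number of short walks that cross an edge at a given hop. -/
theorem measure_card_crossers_le (hG : ∀ x, ∃ y, G.Adj x y) (hn : 1 ≤ n) (e h : ℕ) (d : G.Dart)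
    (B : ℕ) :
    coinMeasure G ℓ {ω | B ≤ (crossers ω e h d).card} ≤
      ENNReal.ofReal (Real.exp (Real.log n + 1) / 2 ^ B) := by
  have h1 : ∫⁻ ω, 2 ^ (crossers ω e h d).card ∂(coinMeasure G ℓ) ≤
      ENNReal.ofReal (Real.exp (Real.log n + 1)) := by
    simp only [← prod_crossWeight]
    rw [lintegral_prod_crossWeight hG]
    have hs := sum_measure_mem_crossers_le (ℓ := ℓ) hG hn e h d
    -- Markov's inequality for `2 ^ card`, with `1 + p ≤ exp p` for the factors.
    have hp : ∀ w, 1 + coinMeasure G ℓ {ω | w ∈ crossers ω e h d} ≤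
        ENNReal.ofReal (Real.exp ((coinMeasure G ℓ).real {ω | w ∈ crossers ω e h d})) := by
      intro w
      rw [← ofReal_measureReal, ← ENNReal.ofReal_one, ← ENNReal.ofReal_add zero_le_one
        measureReal_nonneg]
      refine ENNReal.ofReal_le_ofReal ?_
      rw [add_comm]
      exact Real.add_one_le_exp _
    refine (Finset.prod_le_prod' fun w _ => hp w).trans ?_
    rw [← ENNReal.ofReal_prod_of_nonneg fun w _ => (Real.exp_pos _).le, ← Real.exp_sum]
    refine ENNReal.ofReal_le_ofReal (Real.exp_le_exp.2 ?_)
    simp only [Measure.real]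
    rw [← ENNReal.toReal_sum fun w _ => measure_ne_top _ _]
    exact ENNReal.toReal_le_of_le_ofReal
      (add_nonneg (Real.log_nonneg (by exact_mod_cast hn)) zero_le_one) hs
  have hm : Measurable fun ω : Coins G ℓ => (2 : ℝ≥0∞) ^ (crossers ω e h d).card := by
    simp only [← prod_crossWeight]
    exact Finset.measurable_prod _ fun w _ => measurable_crossWeight hG e h d w
  have h2 := mul_meas_ge_le_lintegral (μ := coinMeasure G ℓ) hm (2 ^ B)
  have h3 : {ω : Coins G ℓ | (2 : ℝ≥0∞) ^ B ≤ 2 ^ (crossers ω e h d).card} =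
      {ω | B ≤ (crossers ω e h d).card} := by
    ext ω
    simp only [Set.mem_ofPred_eq]
    constructor
    · intro hle
      by_contra hlt
      have : (2 : ℝ≥0∞) ^ (crossers ω e h d).card < 2 ^ B := by
        exact_mod_cast Nat.pow_lt_pow_right (by norm_num : 1 < 2) (not_le.1 hlt)
      exact absurd hle (not_le.2 this)
    · intro hle
      exact pow_le_pow_right₀ (by norm_num) hle
  rw [h3] at h2
  rw [ENNReal.ofReal_div_of_pos (by positivity), ENNReal.ofReal_pow (by norm_num),
    ENNReal.ofReal_ofNat, ENNReal.le_div_iff_mul_le (by simp) (by simp), mul_comm]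
  exact h2.trans h1

/-- During the computation of table `e`, more than `B` short walks cross some directed edge at the
same hop. -/
def Congested (ω : Coins G ℓ) (e B : ℕ) : Prop :=
  ∃ h < 4 * lam G ℓ, ∃ d, B < (crossers ω e h d).card

/-- Congestion has to be excluded for hops below `4 λ` only. -/
theorem length_preProcessing_le_of_not_congested (hG : ∀ x, ∃ y, G.Adj x y) (hconn : G.Connected)
    (hlam : 1 ≤ lam G ℓ) {ω : Coins G ℓ} {e B : ℕ} (h : ¬ Congested ω e B) :
    (preProcessing ω e).length ≤ 4 * lam G ℓ * B + 2 * G.diam := by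
  refine length_preProcessing_le hG hconn hlam fun h' d => ?_
  by_cases hh : h' < 4 * lam G ℓ
  · by_contra hlt
    exact h ⟨h', hh, d, not_le.1 hlt⟩
  · have : crossers ω e h' d = ∅ := by
      refine Finset.filter_eq_empty_iff.2 fun w _ hw => ?_
      have := walkLen_lt ω e w hlam
      omega
    simp [this]

/-- The coins of the short walks of one table. -/
def tableCoins (G : SimpleGraph (Fin n)) [DecidableRel G.Adj] (e : ℕ) : Set (CoinIdx G) :=
  ⋃ w : Short G, shortCoins e w

theorem isLocal_congested (hG : ∀ x, ∃ y, G.Adj x y) (e B : ℕ) :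
    IsLocal (tableCoins G e) {ω : Coins G ℓ | Congested ω e B} := by
  have hS : ∀ h (d : G.Dart) (S : Finset (Short G)),
      IsLocal (tableCoins G e) {ω : Coins G ℓ | crossers ω e h d = S} := by
    intro h d S
    have : {ω : Coins G ℓ | crossers ω e h d = S} =
        (⋃ w : Short G, {ω : Coins G ℓ | ¬ (w ∈ crossers ω e h d ↔ w ∈ S)})ᶜ := by
      ext ω
      simp [Finset.ext_iff]
    rw [this]
    refine (IsLocal.iUnion fun w => ?_).compl
    have hw : IsLocal (tableCoins G e) {ω : Coins G ℓ | w ∈ crossers ω e h d} :=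
      (isLocal_mem_crossers hG e h d w).mono (Set.subset_iUnion (shortCoins e) w)
    by_cases hwS : w ∈ S
    · simp only [hwS, iff_true]
      exact hw.compl
    · simpa only [hwS, iff_false, not_not] using hw
  have : {ω : Coins G ℓ | Congested ω e B} =
      ⋃ p : {p : (Fin (4 * lam G ℓ) × G.Dart) × Finset (Short G) // B < p.2.card},
        {ω : Coins G ℓ | crossers ω e p.1.1.1 p.1.1.2 = p.1.2} := by
    ext ω
    simp only [Set.mem_ofPred_eq, Set.mem_iUnion, Congested]
    constructor
    · rintro ⟨h, hh, d, hB⟩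
      exact ⟨⟨((⟨h, hh⟩, d), _), hB⟩, rfl⟩
    · rintro ⟨⟨⟨⟨h, d⟩, S⟩, hB⟩, hS⟩
      simp only at hB hS
      exact ⟨h, h.2, d, hS ▸ hB⟩
  rw [this]
  exact IsLocal.iUnion fun p => hS _ _ _

theorem measure_congested_le (hG : ∀ x, ∃ y, G.Adj x y) (hn : 1 ≤ n) (e B : ℕ) :
    coinMeasure G ℓ {ω | Congested ω e B} ≤ ENNReal.ofReal
      (4 * lam G ℓ * (2 * G.edgeFinset.card) * (Real.exp (Real.log n + 1) / 2 ^ B)) := by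
  have h1 : {ω : Coins G ℓ | Congested ω e B} ⊆
      ⋃ p : Fin (4 * lam G ℓ) × G.Dart, {ω | B ≤ (crossers ω e p.1 p.2).card} := by
    rintro ω ⟨h, hh, d, hB⟩
    exact Set.mem_iUnion.2 ⟨(⟨h, hh⟩, d), hB.le⟩
  refine (measure_mono h1).trans ((measure_iUnion_fintype_le _ _).trans ?_)
  refine (Finset.sum_le_card_nsmul _ _ _ fun p _ =>
    measure_card_crossers_le hG hn e p.1 p.2 B).trans (le_of_eq ?_)
  rw [Finset.card_univ, Fintype.card_prod, Fintype.card_fin, card_dart, nsmul_eq_mul,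
    ENNReal.ofReal_mul (mul_nonneg (by positivity) (mul_nonneg zero_le_two (Nat.cast_nonneg _)))]
  congr 1
  rw [← ENNReal.ofReal_natCast]
  push_cast
  rfl

end Congestion

/-! ### Size of the messages -/

section Bits

variable {n : ℕ} [NeZero n] {G : SimpleGraph (Fin n)} [DecidableRel G.Adj] {ℓ : ℕ}

/-- Every number in a message is at most `B`. -/
structure FieldBound (G : SimpleGraph (Fin n)) [DecidableRel G.Adj] (ℓ B : ℕ) : Prop where
  card : n ≤ B
  label : ∀ v, label G v ≤ B
  numWalks : ∀ v, numWalks G v ≤ B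
  length : 4 * lam G ℓ ≤ B
  total : ℓ ≤ B

/-- All messages of the round have at most `N` bits. -/
def Round.Fits (N : ℕ) (r : Round G) : Prop := ∀ d msg, r d = some msg → msg.bits ≤ N

theorem fits_single {N : ℕ} {x y : Fin n} {msg : Msg} (h : msg.bits ≤ N) :
    (single G x y msg).Fits N := by
  intro d msg' h'
  rw [single] at h'
  split_ifs at h'
  · cases h'
    exact h

theorem fits_map_single {N M : ℕ} {x y : ℕ → Fin n} {msg : ℕ → Msg}
    (h : ∀ t < M, (msg t).bits ≤ N) :
    ∀ r ∈ (List.range M).map (fun t => single G (x t) (y t) (msg t)), r.Fits N := by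
  intro r hr
  obtain ⟨t, ht, rfl⟩ := List.mem_map.1 hr
  exact fits_single (h t (List.mem_range.1 ht))

theorem fits_downWave {N : ℕ} {msg : Fin n → Msg} (h : ∀ v, (msg v).bits ≤ N) :
    ∀ r ∈ downWave G msg, r.Fits N := by
  intro r hr d msg' h'
  obtain ⟨t, -, rfl⟩ := List.mem_map.1 hr
  dsimp only at h'
  split_ifs at h'
  · cases h'
    exact h _

theorem FieldBound.size_fin {B : ℕ} (hB : FieldBound G ℓ B) (s : Fin n) :
    Nat.size s ≤ B.size := Nat.size_le_size (s.2.le.trans hB.card)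

theorem FieldBound.fits_setup {B : ℕ} (hB : FieldBound G ℓ B) :
    ∀ r ∈ setup G, r.Fits (4 + 4 * B.size) := by
  intro r hr
  rw [setup, List.mem_append, List.mem_append] at hr
  rcases hr with (hr | hr) | hr
  · obtain ⟨t, -, rfl⟩ := List.mem_map.1 hr
    intro d msg h
    dsimp only at h
    split_ifs at h
    · cases h
      exact Nat.le_add_right _ _
  · obtain ⟨t, -, rfl⟩ := List.mem_map.1 hr
    intro d msg h
    dsimp only at h
    split_ifs at h
    · cases h
      have : (subtree G d.fst).card ≤ B :=
        ((Finset.card_le_univ _).trans (Fintype.card_fin n).le).trans hB.card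
      have := Nat.size_le_size this
      simp only [Msg.bits]
      omega
  · refine fits_downWave (fun v => ?_) r hr
    have := Nat.size_le_size (hB.label v)
    simp only [Msg.bits]
    omega

theorem FieldBound.bits_tripMsg_le {B : ℕ} (hB : FieldBound G ℓ B) (hlam : 1 ≤ lam G ℓ)
    (ω : Coins G ℓ) (e : ℕ) (w : Short G) (h : ℕ) :
    (tripMsg ω e w h).bits ≤ 4 + 4 * B.size := by
  have hw := walkLen_lt ω e w hlam
  have h4 := hB.length
  have h1 := hB.size_fin w.1
  have h2 : Nat.size w.2 ≤ B.size := Nat.size_le_size (w.2.2.le.trans (hB.numWalks w.1))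
  rw [tripMsg]
  split_ifs with hh
  · have h3 : Nat.size (walkLen ω e w) ≤ B.size := Nat.size_le_size (by omega)
    have h5 : Nat.size h ≤ B.size := Nat.size_le_size (by omega)
    simp only [Msg.bits]
    omega
  · have h3 : Nat.size (2 * walkLen ω e w - h) ≤ B.size := Nat.size_le_size (by omega)
    have h5 := Nat.size_le_size (hB.label (walkEnd ω e w))
    simp only [Msg.bits]
    omega

theorem FieldBound.fits_preProcessing {B : ℕ} (hB : FieldBound G ℓ B) (hlam : 1 ≤ lam G ℓ)
    (ω : Coins G ℓ) (e : ℕ) : ∀ r ∈ preProcessing ω e, r.Fits (4 + 4 * B.size) := by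
  intro r hr
  rw [preProcessing, List.mem_append] at hr
  rcases hr with hr | hr
  · obtain ⟨t, -, rfl⟩ := List.mem_map.1 hr
    intro d msg h
    rw [preRound] at h
    split_ifs at h
    · cases h
      exact hB.bits_tripMsg_le hlam ω e _ _
    · cases h
      exact Nat.le_add_right _ _
  · exact fits_downWave (fun v => Nat.le_add_right _ _) r hr

theorem FieldBound.fits_log {B : ℕ} (hB : FieldBound G ℓ B) (hlam : 1 ≤ lam G ℓ)
    (ω : Coins G ℓ) (st : RunState n) : ∀ r ∈ (stitched ω st).log, r.Fits (4 + 4 * B.size) := by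
  refine stitched_induction (fun t => ∀ r ∈ t.log, r.Fits (4 + 4 * B.size)) (by simp) ?_
  intro t ht
  rcases stitch_cases ω st.table (source ω st.req) t with ⟨_, h⟩ | h | ⟨hs, w, _, h2⟩
  · rwa [h]
  · rwa [h]
  · rw [h2]
    intro r hr
    rcases List.mem_append.1 hr with hr | hr
    · exact ht r hr
    · refine fits_map_single (fun _ _ => ?_) r hr
      have h1 := hB.size_fin (source ω st.req)
      have h2 := Nat.size_le_size (hB.label (walkEnd ω st.table w))
      have h3 : Nat.size (t.len + walkLen ω st.table w) ≤ B.size := by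
        refine Nat.size_le_size (le_trans ?_ hB.total)
        have := walkLen_lt ω st.table w hlam
        have h4 : ¬ ℓ < t.len + 2 * lam G ℓ := fun h => hs (Or.inr h)
        omega
      simp only [Msg.bits]
      omega

theorem FieldBound.fits_attemptRounds {B : ℕ} (hB : FieldBound G ℓ B) (hlam : 1 ≤ lam G ℓ)
    (ω : Coins G ℓ) (st : RunState n) : ∀ r ∈ attemptRounds ω st, r.Fits (4 + 4 * B.size) := by
  have hs := hB.size_fin (source ω st.req)
  have hfail : (Msg.fail (source ω st.req)).bits ≤ 4 + 4 * B.size := by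
    simp only [Msg.bits]
    omega
  intro r hr
  rw [attemptRounds, List.mem_append] at hr
  rcases hr with hr | hr
  · exact hB.fits_log hlam ω st r hr
  · split_ifs at hr with hf
    · rw [List.mem_append, failRounds, List.mem_append] at hr
      rcases hr with (hr | hr) | hr
      · exact fits_map_single (fun _ _ => hfail) r hr
      · exact fits_downWave (fun _ => hfail) r hr
      · exact hB.fits_preProcessing hlam ω _ r hr
    · refine fits_map_single (fun t ht => ?_) r hr
      have h3 : Nat.size ((stitched ω st).len + t) ≤ B.size :=
        Nat.size_le_size (le_trans (by omega) hB.total)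
      simp only [Msg.bits]
      omega

/-- A message has a tag and at most four numbers. -/
theorem FieldBound.fits_of_occurs {B : ℕ} (hB : FieldBound G ℓ B) (hlam : 1 ≤ lam G ℓ)
    {ω : Coins G ℓ} {r : Round G} (hr : Occurs ω r) : r.Fits (4 + 4 * B.size) := by
  rcases hr with hr | ⟨a, hr⟩
  · rcases List.mem_append.1 hr with hr | hr
    · exact hB.fits_setup r hr
    · exact hB.fits_preProcessing hlam ω 0 r hr
  · exact hB.fits_attemptRounds hlam ω _ r hr

/-- A crude bound for the labels, enough for `O(log n)` bits. -/
theorem label_le (hconn : G.Connected) (v : Fin n) : label G v ≤ n * (1 + n * n) := by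
  refine (Finset.sum_le_card_nsmul _ _ (1 + n * n) fun j _ => ?_).trans ?_
  · refine Nat.add_le_add_left ?_ _
    refine (Finset.sum_le_card_nsmul _ _ n fun y _ =>
      (Finset.card_le_univ _).trans (Fintype.card_fin n).le).trans ?_
    rw [smul_eq_mul]
    exact Nat.mul_le_mul_right n ((Finset.card_le_univ _).trans (Fintype.card_fin n).le)
  · rw [Finset.card_range, smul_eq_mul]
    exact Nat.mul_le_mul_right _ ((depth_le_diam hconn v).trans (diam_lt hconn).le)

theorem card_edgeFinset_le : G.edgeFinset.card ≤ n * n := by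
  refine G.card_edgeFinset_le_card_choose_two.trans ?_
  rw [Fintype.card_fin, Nat.choose_two_right]
  exact (Nat.div_le_self _ _).trans (Nat.mul_le_mul_left n (Nat.sub_le n 1))

theorem log_natCast_le (n : ℕ) : Real.log n ≤ n := Real.log_le_self (Nat.cast_nonneg n)

theorem lam_le_pow (hn : 2 ≤ n) (hconn : G.Connected) (hℓ : ℓ ≤ n ^ 3) : lam G ℓ ≤ 25 * n ^ 5 := by
  have hD : (G.diam : ℝ) ≤ n := by exact_mod_cast (diam_lt hconn).le
  have hℓ' : (ℓ : ℝ) ≤ (n : ℝ) ^ 3 := by exact_mod_cast hℓ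
  have hs : √((ℓ : ℝ) * G.diam) ≤ (n : ℝ) ^ 2 := by
    refine Real.sqrt_le_iff.2 ⟨by positivity, ?_⟩
    calc (ℓ : ℝ) * G.diam ≤ (n : ℝ) ^ 3 * n := by gcongr
      _ = _ := by ring
  have hL : 0 ≤ Real.log n := Real.log_natCast_nonneg n
  refine Nat.ceil_le.2 ?_
  calc 24 * √((ℓ : ℝ) * G.diam) * Real.log n ^ 3 ≤ 24 * (n : ℝ) ^ 2 * (n : ℝ) ^ 3 := by
        gcongr
        exact log_natCast_le n
    _ = 24 * (n : ℝ) ^ 5 := by ring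
    _ ≤ ((25 * n ^ 5 : ℕ) : ℝ) := by
        push_cast
        have : (0 : ℝ) ≤ (n : ℝ) ^ 5 := by positivity
        linarith

/-- All numbers in messages are polynomial in `n`. -/
theorem fieldBound_pow (hn : 100 ≤ n) (hconn : G.Connected) (hℓ : ℓ ≤ n ^ 3) :
    FieldBound G ℓ (n ^ 6) where
  card := Nat.le_self_pow (by norm_num) n
  label v := by
    refine (label_le hconn v).trans ?_
    calc n * (1 + n * n) ≤ n * (n * n + n * n) := by gcongr; nlinarith
      _ = 2 * n ^ 3 := by ring
      _ ≤ n ^ 3 * n ^ 3 := by gcongr; nlinarith [Nat.pow_le_pow_left hn 3]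
      _ = n ^ 6 := by ring
  numWalks v := by
    have h1 : (G.degree v : ℝ) * Real.log n ≤ (n : ℝ) * n := by
      have : (G.degree v : ℝ) ≤ n := by
        have := (G.degree_lt_card_verts v).le
        rw [Fintype.card_fin] at this
        exact_mod_cast this
      have := log_natCast_le n
      have hL : 0 ≤ Real.log n := Real.log_natCast_nonneg n
      gcongr
    have h2 : numWalks G v ≤ n * n := Nat.ceil_le.2 (by exact_mod_cast h1)
    refine h2.trans ?_
    rw [← sq]
    exact Nat.pow_le_pow_right (by omega) (by norm_num)
  length := by
    have := lam_le_pow (by omega) hconn hℓ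
    calc 4 * lam G ℓ ≤ 4 * (25 * n ^ 5) := by gcongr
      _ = 100 * n ^ 5 := by ring
      _ ≤ n * n ^ 5 := by gcongr
      _ = n ^ 6 := by ring
  total := hℓ.trans (Nat.pow_le_pow_right (by omega) (by norm_num))

theorem size_pow_le (hn : 3 ≤ n) (a : ℕ) : ((n ^ a).size : ℝ) ≤ 3 * a * Real.log n + 1 := by
  have h3 : 1 ≤ Real.log n := by
    rw [Real.le_log_iff_exp_le (by positivity)]
    have : (3 : ℝ) ≤ n := by exact_mod_cast hn
    linarith [Real.exp_one_lt_d9]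
  set k := (n ^ a).size with hk
  rcases Nat.eq_zero_or_pos k with h0 | h0
  · rw [h0]
    push_cast
    positivity
  have h1 : 2 ^ (k - 1) ≤ n ^ a := Nat.lt_size.1 (by omega)
  have h2 : ((k - 1 : ℕ) : ℝ) * Real.log 2 ≤ a * Real.log n := by
    rw [← Real.log_pow, ← Real.log_pow]
    exact Real.log_le_log (by positivity) (by exact_mod_cast h1)
  have h4 := Real.log_two_gt_d9
  rw [Nat.cast_sub h0] at h2
  push_cast at h2
  have h5 : 0 ≤ (a : ℝ) * Real.log n := by positivity
  have h6 : (0 : ℝ) ≤ (k : ℝ) - 1 := by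
    have : (1 : ℝ) ≤ k := by exact_mod_cast h0
    linarith
  nlinarith

theorem bits_le (hn : 100 ≤ n) (hconn : G.Connected) (hℓ : ℓ ≤ n ^ 3) (hlam : 1 ≤ lam G ℓ)
    {ω : Coins G ℓ} {r : Round G} (hr : Occurs ω r) {d : G.Dart} {msg : Msg}
    (h : r d = some msg) : (msg.bits : ℝ) ≤ 80 * Real.log n := by
  have h1 : (msg.bits : ℝ) ≤ 4 + 4 * ((n ^ 6).size : ℝ) := by
    exact_mod_cast (fieldBound_pow hn hconn hℓ).fits_of_occurs hlam hr d msg h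
  have h2 := size_pow_le (show 3 ≤ n by omega) 6
  have h3 : 1 ≤ Real.log n := by
    rw [Real.le_log_iff_exp_le (by positivity)]
    have : (100 : ℝ) ≤ n := by exact_mod_cast hn
    linarith [Real.exp_one_lt_d9]
  push_cast at h2
  linarith

end Bits

/-! ### Rounds of a single request -/

section Rounds

variable {n : ℕ} [NeZero n] {G : SimpleGraph (Fin n)} [DecidableRel G.Adj] {ℓ : ℕ}

theorem length_log_le (hconn : G.Connected) (hlam : 1 ≤ lam G ℓ) {X : ℕ}
    (hX : ℓ * (2 * G.diam) ≤ X * lam G ℓ) (ω : Coins G ℓ) (st : RunState n) :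
    (stitched ω st).log.length ≤ X := by
  have h1 := length_log_mul_lam_le hconn ω st
  have h2 := Nat.mul_le_mul_right (2 * G.diam) (stitched_len_le hlam ω st)
  exact Nat.le_of_mul_le_mul_right (h1.trans (h2.trans hX)) hlam

/-- Only the attempts from the first to the successful one count for a request. -/
theorem tsum_attempts_eq {ω : Coins G ℓ} {k a b : ℕ} (ha : FirstAt ω k a)
    (hb : (run ω b).req = k) (hf : ¬ Fails ω (run ω b)) (f : ℕ → ℝ≥0∞) :
    (∑' i, if (run ω i).req = k then f i else 0) =
      ∑ i ∈ Finset.Icc a b, if (run ω i).req = k then f i else 0 := by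
  refine tsum_eq_sum fun i hi => if_neg fun h => hi ?_
  exact Finset.mem_Icc.2 ⟨ha.le h, success_unique hb hf h⟩

theorem fails_fresh_iff {ω : Coins G ℓ} {k e : ℕ} :
    Fails ω ⟨k, e, fun _ => 0⟩ ↔ FailsWithin ω e 1 k fun _ => 0 := by
  rw [fails_iff]
  simp [FailsWithin]

/-- The new table that is computed after a failure is computed slowly or fails at once. -/
def BadTable (ω : Coins G ℓ) (B k e : ℕ) : Prop :=
  Congested ω e B ∨ FailsWithin ω e 1 k fun _ => 0

/-- The first request includes the construction of the tree and of the first table. -/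
theorem requestRounds_zero_le (hG : ∀ x, ∃ y, G.Adj x y) (hconn : G.Connected)
    (hlam : 1 ≤ lam G ℓ) {B X : ℕ} (hX : ℓ * (2 * G.diam) ≤ X * lam G ℓ) {ω : Coins G ℓ}
    (h : ¬ BadTable ω B 0 0) :
    requestRounds ω 0 ≤
      ((2 * X + 5 * G.diam + 1 + 4 * lam G ℓ * B + 2 * lam G ℓ : ℕ) : ℝ≥0∞) := by
  rw [BadTable, not_or, ← fails_fresh_iff] at h
  have hf : ¬ Fails ω (run ω 0) := h.2
  have h0 : FirstAt ω 0 0 := rfl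
  rw [requestRounds, if_pos rfl, tsum_attempts_eq h0 h0.req hf, Finset.Icc_self,
    Finset.sum_singleton, if_pos h0.req, ← Nat.cast_add]
  refine Nat.cast_le.2 ?_
  rw [initialRounds, List.length_append, length_setup]
  have h1 := length_preProcessing_le_of_not_congested hG hconn hlam h.1
  have h2 := length_attemptRounds_of_not_fails hlam hf
  have h3 := length_log_le hconn hlam hX ω (run ω 0)
  omega

/-- A later request takes at most two attempts and one new table, if this table is good. -/
theorem requestRounds_le (hG : ∀ x, ∃ y, G.Adj x y) (hconn : G.Connected) (hlam : 1 ≤ lam G ℓ)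
    {B X : ℕ} (hX : ℓ * (2 * G.diam) ≤ X * lam G ℓ) {ω : Coins G ℓ} {k a : ℕ} (hk : k ≠ 0)
    (ha : FirstAt ω k a)
    (h : Fails ω (run ω a) → ¬ BadTable ω B k ((run ω a).table + 1)) :
    requestRounds ω k ≤
      ((2 * X + 5 * G.diam + 1 + 4 * lam G ℓ * B + 2 * lam G ℓ : ℕ) : ℝ≥0∞) := by
  rw [requestRounds, if_neg hk, zero_add]
  have h3 := length_log_le hconn hlam hX ω (run ω a)
  by_cases hf : Fails ω (run ω a)
  · have hb := h hf
    rw [BadTable, not_or, ← fails_fresh_iff] at hb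
    have hrun : run ω (a + 1) = ⟨k, (run ω a).table + 1, fun _ => 0⟩ := by
      rw [run_succ, runNext_of_fails hf, ha.req]
    have hf' : ¬ Fails ω (run ω (a + 1)) := by
      rw [hrun]
      exact hb.2
    have hreq : (run ω (a + 1)).req = k := by rw [hrun]
    rw [tsum_attempts_eq ha hreq hf', show Finset.Icc a (a + 1) = {a, a + 1} by
      ext i; simp only [Finset.mem_Icc, Finset.mem_insert, Finset.mem_singleton]; omega,
      Finset.sum_pair (show a ≠ a + 1 by omega), if_pos ha.req, if_pos hreq, ← Nat.cast_add]
    refine Nat.cast_le.2 ?_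
    have h1 := length_preProcessing_le_of_not_congested hG hconn hlam hb.1
    have h2 := length_attemptRounds_of_not_fails hlam hf'
    have h4 := length_log_le hconn hlam hX ω (run ω (a + 1))
    have h5 := length_attemptRounds_of_fails hconn hf
    omega
  · rw [tsum_attempts_eq ha ha.req hf, Finset.Icc_self, Finset.sum_singleton, if_pos ha.req]
    refine Nat.cast_le.2 ?_
    have h2 := length_attemptRounds_of_not_fails hlam hf
    omega

theorem disjoint_revealed_tableCoins (k e : ℕ) :
    Disjoint (revealed k e (∅ : Set (Short G))) (tableCoins G e) := by
  rw [Set.disjoint_left]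
  intro i hi hi'
  obtain ⟨w, hw⟩ := Set.mem_iUnion.1 hi'
  rcases hw with rfl | ⟨t, x, rfl⟩
  · rcases hi with h | ⟨-, h⟩
    · exact lt_irrefl _ h
    · exact h
  · rcases hi with h | ⟨-, h⟩
    · exact lt_irrefl _ h
    · exact h

/-- A new table is independent of the history. -/
theorem measure_inter_badTable_le (hG : ∀ x, ∃ y, G.Adj x y) {B : ℕ} {q q' : ℝ≥0∞}
    (hq : ∀ e, coinMeasure G ℓ {ω | Congested ω e B} ≤ q)
    (hq' : ∀ (e k : ℕ) (A : Set (Coins G ℓ)), IsLocal (revealed (k + 1) e ∅) A →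
      coinMeasure G ℓ (A ∩ {ω | FailsWithin ω e 1 k fun _ => 0}) ≤ coinMeasure G ℓ A * q')
    (e k : ℕ) {A : Set (Coins G ℓ)} (hA : IsLocal (revealed (k + 1) e ∅) A) :
    coinMeasure G ℓ (A ∩ {ω | BadTable ω B k e}) ≤ coinMeasure G ℓ A * (q + q') := by
  have h1 : A ∩ {ω | BadTable ω B k e} ⊆
      (A ∩ {ω | Congested ω e B}) ∪ (A ∩ {ω | FailsWithin ω e 1 k fun _ => 0}) := by
    rintro ω ⟨h1, h2 | h2⟩
    · exact Or.inl ⟨h1, h2⟩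
    · exact Or.inr ⟨h1, h2⟩
  have h2 : coinMeasure G ℓ (A ∩ {ω | Congested ω e B}) =
      coinMeasure G ℓ A * coinMeasure G ℓ {ω | Congested ω e B} :=
    hA.measure_inter _ (isLocal_congested hG e B) (disjoint_revealed_tableCoins _ _)
  refine (measure_mono h1).trans ((measure_union_le _ _).trans ?_)
  rw [h2, mul_add]
  exact add_le_add (mul_le_mul' le_rfl (hq e)) (hq' e k A hA)

/-- The outcomes in which attempt `a` is the first one for request `k`, begins in the state `st`,
and fails. -/
def firstFails (ℓ : ℕ) (G : SimpleGraph (Fin n)) [DecidableRel G.Adj] (k : ℕ)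
    (p : ℕ × RunState n) : Set (Coins G ℓ) :=
  {ω | FirstAt ω k p.1 ∧ run ω p.1 = p.2 ∧ Fails ω p.2}

/-- When the first attempt for a request fails, nothing is known about the next table. -/
theorem isLocal_firstFails (hG : ∀ x, ∃ y, G.Adj x y) (k : ℕ) (p : ℕ × RunState n) :
    IsLocal (revealed (k + 1) (p.2.table + 1) ∅) (firstFails ℓ G k p) := by
  by_cases hk : p.2.req = k
  · have h1 := (runStart_firstAt (ℓ := ℓ) hG k p.1 p.2 hk).runLocal
    have h2 := (h1.inter_runNext hG ⟨k, p.2.table + 1, fun _ => 0⟩).1.isLocal_fresh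
    convert h2 using 1
    ext ω
    simp only [firstFails, Set.mem_ofPred_eq, Set.mem_inter_iff, and_assoc]
    refine and_congr_right fun _ => and_congr_right fun _ => ⟨fun h => ?_, fun h => ?_⟩
    · rw [runNext_of_fails h, hk]
    · by_contra hf
      rw [runNext_of_not_fails hf] at h
      have := congrArg RunState.req h
      simp only at this
      omega
  · have : firstFails ℓ G k p = ∅ := by
      ext ω
      simp only [firstFails, Set.mem_ofPred_eq, Set.mem_empty_iff_false, iff_false]
      rintro ⟨h1, h2, -⟩
      exact hk (h2 ▸ h1.req)
    rw [this]
    simpa using IsLocal.univ.compl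

/-- If a request takes longer than the bound, a new table built for it, or the very first table in
the case of request `0`, is bad. -/
theorem measure_requestRounds_le (hG : ∀ x, ∃ y, G.Adj x y) (hconn : G.Connected)
    (hlam : 1 ≤ lam G ℓ) {B X : ℕ} (hX : ℓ * (2 * G.diam) ≤ X * lam G ℓ) {q q' : ℝ≥0∞}
    (hq : ∀ e, coinMeasure G ℓ {ω | Congested ω e B} ≤ q)
    (hq' : ∀ (e k : ℕ) (A : Set (Coins G ℓ)), IsLocal (revealed (k + 1) e ∅) A →
      coinMeasure G ℓ (A ∩ {ω | FailsWithin ω e 1 k fun _ => 0}) ≤ coinMeasure G ℓ A * q')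
    {k : ℕ} (hreach : ∀ᵐ ω ∂(coinMeasure G ℓ), ∃ a, (run ω a).req = k) :
    coinMeasure G ℓ {ω | ¬ requestRounds ω k ≤
      ((2 * X + 5 * G.diam + 1 + 4 * lam G ℓ * B + 2 * lam G ℓ : ℕ) : ℝ≥0∞)} ≤ q + q' := by
  have hbad := fun e k A hA => measure_inter_badTable_le (A := A) hG hq hq' e k hA
  by_cases hk : k = 0
  · subst hk
    refine (measure_mono (t := Set.univ ∩ {ω | BadTable ω B 0 0}) ?_).trans
      ((hbad 0 0 _ IsLocal.univ).trans (by rw [measure_univ, one_mul]))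
    intro ω hω
    refine ⟨trivial, ?_⟩
    by_contra h
    exact hω (requestRounds_zero_le hG hconn hlam hX h)
  · have hsub : ∀ᵐ ω ∂(coinMeasure G ℓ), ω ∈ {ω | ¬ requestRounds ω k ≤
        ((2 * X + 5 * G.diam + 1 + 4 * lam G ℓ * B + 2 * lam G ℓ : ℕ) : ℝ≥0∞)} →
        ω ∈ ⋃ p : ℕ × RunState n,
          firstFails ℓ G k p ∩ {ω | BadTable ω B k (p.2.table + 1)} := by
      filter_upwards [hreach] with ω hω h
      obtain ⟨a, ha⟩ := hω
      obtain ⟨a, ha⟩ := exists_firstAt ha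
      by_contra hnot
      refine h (requestRounds_le hG hconn hlam hX hk ha fun hf hb => hnot ?_)
      exact Set.mem_iUnion.2 ⟨(a, run ω a), ⟨ha, rfl, hf⟩, hb⟩
    refine (measure_mono_ae hsub).trans ((measure_iUnion_le _).trans ?_)
    refine (ENNReal.tsum_le_tsum fun p => hbad _ k _ (isLocal_firstFails hG k p)).trans ?_
    rw [ENNReal.tsum_mul_right, ← measure_iUnion]
    · exact mul_le_of_le_one_left' prob_le_one
    · rintro ⟨a, st⟩ ⟨a', st'⟩ hne
      rw [Function.onFun, Set.disjoint_left]
      rintro ω ⟨h1, h2, _⟩ ⟨h1', h2', _⟩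
      apply hne
      simp only at h1 h2 h1' h2'
      obtain rfl := h1.unique h1'
      rw [← h2, ← h2']
    · exact fun p => (isLocal_firstFails hG k p).meas

end Rounds

/-! ### Messages of the first requests -/

section Total

variable {n : ℕ} [NeZero n] {G : SimpleGraph (Fin n)} [DecidableRel G.Adj] {ℓ : ℕ}

/-- Each request is completed at most once. -/
theorem tsum_success_le (ω : Coins G ℓ) (K : ℕ) :
    (∑' a, if (run ω a).req < K ∧ ¬ Fails ω (run ω a) then (1 : ℝ≥0∞) else 0) ≤ K := by
  have h1 : ∀ a, (if (run ω a).req < K ∧ ¬ Fails ω (run ω a) then (1 : ℝ≥0∞) else 0) =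
      ∑ k ∈ Finset.range K, if (run ω a).req = k ∧ ¬ Fails ω (run ω a) then 1 else 0 := by
    intro a
    by_cases hf : Fails ω (run ω a)
    · simp [hf]
    · simp [hf, Finset.sum_ite_eq]
  simp only [h1]
  rw [Summable.tsum_finsetSum fun _ _ => ENNReal.summable]
  refine (Finset.sum_le_card_nsmul _ _ 1 fun k _ => ?_).trans (by simp)
  by_cases h : ∃ a, (run ω a).req = k ∧ ¬ Fails ω (run ω a)
  · obtain ⟨a, ha, hf⟩ := h
    rw [tsum_eq_single a]
    · rw [if_pos ⟨ha, hf⟩]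
    · intro b hb
      refine if_neg fun h => hb ?_
      exact le_antisymm (success_unique ha hf h.1) (success_unique h.1 h.2 ha)
  · rw [ENNReal.tsum_eq_zero.2]
    · exact zero_le_one
    · exact fun a => if_neg fun h' => h ⟨a, h'⟩

/-- All messages up to the completion of `K` requests, if an attempt costs `c₁` messages, and
`c₂` more if it fails. -/
theorem totalMessages_le {ω : Coins G ℓ} {c₀ c₁ c₂ : ℝ≥0∞}
    (h0 : (messages (initialRounds ω) : ℝ≥0∞) ≤ c₀)
    (h : ∀ st, (messages (attemptRounds ω st) : ℝ≥0∞) ≤ c₁ + if Fails ω st then c₂ else 0) (K : ℕ) :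
    totalMessages ω K ≤ c₀ + c₁ * K + (c₁ + c₂) * failCount ω K := by
  rw [totalMessages]
  simp only [requestMessages]
  rw [Finset.sum_add_distrib, add_assoc]
  refine add_le_add ?_ ?_
  · rw [Finset.sum_ite_eq' (Finset.range K) 0]
    split_ifs
    · exact h0
    · exact zero_le
  · rw [← Summable.tsum_finsetSum fun _ _ => ENNReal.summable]
    have h1 : ∀ a, (∑ k ∈ Finset.range K,
        if (run ω a).req = k then (messages (attemptRounds ω (run ω a)) : ℝ≥0∞) else 0) ≤
        c₁ * (if (run ω a).req < K ∧ ¬ Fails ω (run ω a) then (1 : ℝ≥0∞) else 0) +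
          (c₁ + c₂) * (if (run ω a).req < K ∧ Fails ω (run ω a) then 1 else 0) := by
      intro a
      rw [Finset.sum_ite_eq (Finset.range K)]
      have := h (run ω a)
      by_cases hK : (run ω a).req < K
      · by_cases hf : Fails ω (run ω a)
        · simpa [hK, hf] using this
        · simpa [hK, hf] using this
      · simp [hK]
    refine (ENNReal.tsum_le_tsum h1).trans ?_
    rw [ENNReal.tsum_add, ENNReal.tsum_mul_left, ENNReal.tsum_mul_left]
    exact add_le_add (mul_le_mul' le_rfl (tsum_success_le ω K)) le_rfl

theorem tokAfter_of_lt (hℓ : ℓ < 2 * lam G ℓ) (ω : Coins G ℓ) (e : ℕ) (s : Fin n)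
    (u : Fin n → ℕ) : tokAfter ω e s u = ⟨s, 0, u, false⟩ := by
  refine Function.iterate_fixed ?_ ℓ
  rw [tokStep, if_pos]
  exact Or.inr (by simpa using hℓ)

/-- If `ℓ < 2 λ`, no short walk is ever used. -/
theorem not_failsWithin_of_lt (hℓ : ℓ < 2 * lam G ℓ) (ω : Coins G ℓ) (e T k : ℕ)
    (u : Fin n → ℕ) : ¬ FailsWithin ω e T k u := by
  induction T generalizing k u with
  | zero => exact id
  | succ T ih =>
    rw [FailsWithin, tokAfter_of_lt hℓ]
    rintro (h | h)
    · cases h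
    · exact ih _ _ h

end Total

/-! ### Choice of the constants -/

section Regime

variable {n : ℕ} [NeZero n] {G : SimpleGraph (Fin n)} [DecidableRel G.Adj] {ℓ : ℕ} {c : ℝ}

/-- The assumptions of the theorem, with `n` large enough for the given `c`. -/
structure Regime (c : ℝ) (G : SimpleGraph (Fin n)) [DecidableRel G.Adj] (ℓ : ℕ) : Prop where
  pos : 0 < c
  conn : G.Connected
  one_le : 1 ≤ ℓ
  le_edges : (ℓ : ℝ) ≤ c * G.edgeFinset.card
  -- `10 + c` bounds `(4 √(ℓ + 1) + (ℓ + 1) / m) / √(ℓ D)`, so that a walk of length `ℓ` visits `v`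
  -- at most `deg v · λ / kap` times.
  large : kap * (10 + c) ≤ Real.log n

namespace Regime

theorem hundred_le_kap : 100 ≤ kap := by
  have h1 : (2.7 : ℝ) ≤ Real.exp 1 := by linarith [Real.exp_one_gt_d9]
  have h2 : Real.exp 4 = Real.exp 1 ^ 4 := by rw [← Real.exp_nat_mul]; norm_num
  have h3 : (2.7 : ℝ) ^ 4 ≤ Real.exp 1 ^ 4 := pow_le_pow_left₀ (by norm_num) h1 4
  rw [kap, h2]
  norm_num at h3 ⊢
  linarith

theorem kap_le_log (R : Regime c G ℓ) : 10 * kap ≤ Real.log n := by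
  have h1 := R.large
  have h2 := mul_nonneg kap_pos.le R.pos.le
  linarith

theorem log_ge (R : Regime c G ℓ) : 1000 ≤ Real.log n := by
  linarith [R.kap_le_log, hundred_le_kap]

theorem cast_ge (n : ℕ) [NeZero n] : Real.log n + 1 ≤ n := by
  have h1 := Real.add_one_le_exp (Real.log n)
  rwa [Real.exp_log (by exact_mod_cast Nat.pos_of_neZero n)] at h1

theorem n_ge (R : Regime c G ℓ) : 1000 ≤ n := by
  have : (1000 : ℝ) ≤ n := by linarith [R.log_ge, cast_ge n]
  exact_mod_cast this

theorem adj (R : Regime c G ℓ) (x : Fin n) : ∃ y, G.Adj x y := by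
  have : Nontrivial (Fin n) := Fin.nontrivial_iff_two_le.2 (by linarith [R.n_ge])
  exact R.conn.preconnected.exists_adj_of_nontrivial x

theorem one_le_diam (R : Regime c G ℓ) : 1 ≤ G.diam := by
  have : Nontrivial (Fin n) := Fin.nontrivial_iff_two_le.2 (by linarith [R.n_ge])
  exact Nat.one_le_iff_ne_zero.2 (SimpleGraph.connected_iff_diam_ne_zero.1 R.conn)

theorem one_le_sqrt (R : Regime c G ℓ) : 1 ≤ √((ℓ : ℝ) * G.diam) := by
  rw [Real.one_le_sqrt]
  have h1 : (1 : ℝ) ≤ ℓ := by exact_mod_cast R.one_le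
  have h2 : (1 : ℝ) ≤ G.diam := by exact_mod_cast R.one_le_diam
  nlinarith

theorem lam_ge : 24 * √((ℓ : ℝ) * G.diam) * Real.log n ^ 3 ≤ lam G ℓ :=
  Nat.le_ceil _

/-- A weaker bound, sufficient for the life of a table: it needs only the first power of `log n`. -/
theorem lam_ge_sqrt (R : Regime c G ℓ) : 24 * √((ℓ : ℝ) * G.diam) * Real.log n ≤ lam G ℓ := by
  refine le_trans ?_ lam_ge
  have h1 := R.log_ge
  have h2 : Real.log n ≤ Real.log n ^ 3 := le_self_pow₀ (by linarith) (by norm_num)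
  gcongr

theorem log_le_lam (R : Regime c G ℓ) : Real.log n ≤ lam G ℓ := by
  have h1 := R.lam_ge_sqrt
  have h2 := R.one_le_sqrt
  have h3 := R.log_ge
  nlinarith

theorem one_le_lam (R : Regime c G ℓ) : 1 ≤ lam G ℓ := by
  have : (1 : ℝ) ≤ lam G ℓ := by linarith [R.log_le_lam, R.log_ge]
  exact_mod_cast this

theorem lam_le (R : Regime c G ℓ) :
    (lam G ℓ : ℝ) ≤ 25 * √((ℓ : ℝ) * G.diam) * Real.log n ^ 3 := by
  have h1 := R.one_le_sqrt
  have h2 : (1 : ℝ) ≤ Real.log n ^ 3 := one_le_pow₀ (by linarith [R.log_ge])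
  have h3 := (Nat.ceil_lt_add_one
    (show 0 ≤ 24 * √((ℓ : ℝ) * G.diam) * Real.log n ^ 3 by positivity)).le
  rw [lam]
  nlinarith

theorem n_le_edges (R : Regime c G ℓ) : (n : ℝ) ≤ 2 * G.edgeFinset.card := by
  rw [← sum_degree_real]
  have h := Finset.sum_le_sum (s := Finset.univ) fun (v : Fin n) _ =>
    show (1 : ℝ) ≤ G.degree v by exact_mod_cast degree_pos R.adj v
  simpa using h

theorem edges_ge_one (R : Regime c G ℓ) : (1 : ℝ) ≤ G.edgeFinset.card := by
  have : (1000 : ℝ) ≤ n := by exact_mod_cast R.n_ge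
  linarith [R.n_le_edges]

/-- Since `ℓ ≤ c m` with `c ≤ n` and `m ≤ n ^ 2`. -/
theorem le_cube (R : Regime c G ℓ) : ℓ ≤ n ^ 3 := by
  have h1 : (G.edgeFinset.card : ℝ) ≤ n * n := by exact_mod_cast card_edgeFinset_le
  have h2 : c ≤ n := by
    have := R.large
    have := cast_ge n
    nlinarith [hundred_le_kap, R.pos]
  have h3 : (ℓ : ℝ) ≤ (n : ℝ) ^ 3 := by
    calc (ℓ : ℝ) ≤ c * G.edgeFinset.card := R.le_edges
      _ ≤ n * (n * n) := by
        refine mul_le_mul h2 h1 (Nat.cast_nonneg _) (Nat.cast_nonneg _)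
      _ = _ := by ring
  exact_mod_cast h3

/-- A short walk is long compared with the number of visits to any node. -/
theorem visits_bound (R : Regime c G ℓ) (v x : Fin n) :
    kap * (visits G v (ℓ + 1) x / lam G ℓ) ≤ G.degree v := by
  set S := √((ℓ : ℝ) * G.diam) with hS
  have hS1 := R.one_le_sqrt
  have hd := (degree_pos R.adj v).le
  have hm := R.edges_ge_one
  have h1 := visits_le R.adj R.conn v (ℓ + 1) x
  have hℓ1 : (1 : ℝ) ≤ ℓ := by exact_mod_cast R.one_le
  have hD1 : (1 : ℝ) ≤ G.diam := by exact_mod_cast R.one_le_diam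
  have h2 : √((ℓ + 1 : ℕ) : ℝ) ≤ 2 * S := by
    rw [Real.sqrt_le_left (by positivity), mul_pow, hS, Real.sq_sqrt (by positivity)]
    push_cast
    nlinarith
  have h3 : ((ℓ + 1 : ℕ) : ℝ) / G.edgeFinset.card ≤ (c + 1) * S := by
    rw [div_le_iff₀ (by linarith)]
    push_cast
    have := R.le_edges
    have hc := R.pos
    have h4 : (c + 1) * (G.edgeFinset.card : ℝ) ≤ (c + 1) * S * G.edgeFinset.card := by
      have : 0 ≤ (c + 1) * (G.edgeFinset.card : ℝ) := by
        apply mul_nonneg <;> linarith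
      nlinarith
    linarith
  have h5 : kap * (4 * √((ℓ + 1 : ℕ) : ℝ) + ((ℓ + 1 : ℕ) : ℝ) / G.edgeFinset.card) ≤
      lam G ℓ := by
    have h6 := R.large
    have h7 : kap * (4 * √((ℓ + 1 : ℕ) : ℝ) + ((ℓ + 1 : ℕ) : ℝ) / G.edgeFinset.card) ≤
        kap * (10 + c) * S := by
      rw [mul_assoc]
      refine mul_le_mul_of_nonneg_left ?_ kap_pos.le
      linarith
    have h8 : kap * (10 + c) * S ≤ Real.log n * S := by gcongr
    have h9 := R.lam_ge_sqrt
    have h10 : 0 ≤ Real.log n * S := mul_nonneg (by linarith [R.log_ge]) (by linarith)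
    linarith
  have hl : (0 : ℝ) < lam G ℓ := by exact_mod_cast R.one_le_lam
  rw [← mul_div_assoc, div_le_iff₀ hl]
  calc kap * visits G v (ℓ + 1) x
      ≤ kap * (G.degree v * (4 * √((ℓ + 1 : ℕ) : ℝ) + ((ℓ + 1 : ℕ) : ℝ) / G.edgeFinset.card)) :=
        mul_le_mul_of_nonneg_left h1 kap_pos.le
    _ = G.degree v *
        (kap * (4 * √((ℓ + 1 : ℕ) : ℝ) + ((ℓ + 1 : ℕ) : ℝ) / G.edgeFinset.card)) := by ring
    _ ≤ G.degree v * lam G ℓ := mul_le_mul_of_nonneg_left h5 hd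

/-- Order of the number of messages of a pre-processing. -/
def work (G : SimpleGraph (Fin n)) [DecidableRel G.Adj] (ℓ : ℕ) : ℝ :=
  lam G ℓ * G.edgeFinset.card * Real.log n

/-- Number of requests that a new table survives with high probability. -/
def lifetime (G : SimpleGraph (Fin n)) [DecidableRel G.Adj] (ℓ : ℕ) : ℕ :=
  ⌊work G ℓ / (kap * (ℓ + G.diam))⌋₊

/-- A table costs more than a request, because `ℓ + D = O(m)`. -/
theorem add_diam_le_work (R : Regime c G ℓ) : kap * (ℓ + G.diam) ≤ work G ℓ := by
  have h1 : (G.diam : ℝ) ≤ 2 * G.edgeFinset.card :=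
    le_trans (by exact_mod_cast (diam_lt R.conn).le) R.n_le_edges
  have h2 := R.le_edges
  have hm := R.edges_ge_one
  have hk := hundred_le_kap
  have h3 := R.large
  have h4 : (1 : ℝ) ≤ lam G ℓ := by exact_mod_cast R.one_le_lam
  have h5 : kap * (ℓ + G.diam) ≤ kap * (10 + c) * G.edgeFinset.card := by
    rw [mul_assoc]
    refine mul_le_mul_of_nonneg_left ?_ kap_pos.le
    linarith
  have h6 : kap * (10 + c) * G.edgeFinset.card ≤ Real.log n * G.edgeFinset.card :=
    mul_le_mul_of_nonneg_right h3 (by linarith)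
  have h7 : 0 ≤ Real.log n * (G.edgeFinset.card : ℝ) :=
    mul_nonneg (by linarith [R.log_ge]) (by linarith)
  rw [work]
  nlinarith

theorem add_diam_ge (R : Regime c G ℓ) : (2 : ℝ) ≤ ℓ + G.diam := by
  have hℓ1 : (1 : ℝ) ≤ ℓ := by exact_mod_cast R.one_le
  have hD1 : (1 : ℝ) ≤ G.diam := by exact_mod_cast R.one_le_diam
  linarith

theorem one_le_lifetime (R : Regime c G ℓ) : 1 ≤ lifetime G ℓ := by
  refine Nat.le_floor ?_
  rw [Nat.cast_one, one_le_div (mul_pos kap_pos (by linarith [R.add_diam_ge]))]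
  exact R.add_diam_le_work

theorem work_le_lifetime (R : Regime c G ℓ) :
    work G ℓ ≤ 2 * kap * (ℓ + G.diam) * lifetime G ℓ := by
  have h0 : 0 < kap * (ℓ + G.diam) := mul_pos kap_pos (by linarith [R.add_diam_ge])
  have h1 := (Nat.lt_floor_add_one (work G ℓ / (kap * (ℓ + G.diam)))).le
  have h2 : (1 : ℝ) ≤ lifetime G ℓ := by exact_mod_cast R.one_le_lifetime
  rw [div_le_iff₀ h0] at h1
  change work G ℓ ≤ ((lifetime G ℓ : ℝ) + 1) * _ at h1
  nlinarith

/-- During the `lifetime` the potential grows at most by the factor `n`. -/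
theorem growth_pow_le (R : Regime c G ℓ) (hℓ : 2 * lam G ℓ ≤ ℓ) :
    growth G ℓ ^ lifetime G ℓ ≤ n := by
  have hm := R.edges_ge_one
  have hl : (1 : ℝ) ≤ lam G ℓ := by exact_mod_cast R.one_le_lam
  have hℓ' : 2 * (lam G ℓ : ℝ) ≤ ℓ := by exact_mod_cast hℓ
  have hL := R.log_ge
  have hn0 : (0 : ℝ) < n := by exact_mod_cast Nat.pos_of_neZero n
  have hD : (0 : ℝ) ≤ G.diam := Nat.cast_nonneg _
  set x : ℝ := kap * ((1 + ℓ / lam G ℓ) / (2 * G.edgeFinset.card)) with hx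
  have hx0 : 0 ≤ x := mul_nonneg kap_pos.le (div_nonneg (by positivity) (by linarith))
  have hxle : x ≤ kap * (ℓ / (lam G ℓ * G.edgeFinset.card)) := by
    refine mul_le_mul_of_nonneg_left ?_ kap_pos.le
    have h1 : 1 + (ℓ : ℝ) / lam G ℓ ≤ 2 * (ℓ / lam G ℓ) := by
      have : 1 ≤ (ℓ : ℝ) / lam G ℓ := by
        rw [one_le_div (by linarith)]
        linarith
      linarith
    calc (1 + (ℓ : ℝ) / lam G ℓ) / (2 * G.edgeFinset.card)
        ≤ 2 * (ℓ / lam G ℓ) / (2 * G.edgeFinset.card) :=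
          div_le_div_of_nonneg_right h1 (by linarith)
      _ = ℓ / (lam G ℓ * G.edgeFinset.card) := by
          rw [mul_div_mul_left _ _ two_ne_zero, div_div]
  have hT : (lifetime G ℓ : ℝ) ≤ work G ℓ / (kap * (ℓ + G.diam)) :=
    Nat.floor_le (div_nonneg
      (mul_nonneg (mul_nonneg (by linarith) (by linarith)) (by linarith))
      (mul_nonneg kap_pos.le (by linarith)))
  have hTx : lifetime G ℓ * x ≤ Real.log n := by
    have hℓ0 : (0 : ℝ) < ℓ := by linarith
    have hden : 0 < kap * ((ℓ : ℝ) + G.diam) := mul_pos kap_pos (by linarith)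
    have hprod : (0 : ℝ) < lam G ℓ * G.edgeFinset.card := mul_pos (by linarith) (by linarith)
    calc lifetime G ℓ * x
        ≤ work G ℓ / (kap * (ℓ + G.diam)) * (kap * (ℓ / (lam G ℓ * G.edgeFinset.card))) := by
          refine mul_le_mul hT hxle hx0 ?_
          exact (Nat.cast_nonneg _).trans hT
      _ = Real.log n * (ℓ / (ℓ + G.diam)) := by
          rw [work]
          have := kap_pos
          have h1 : (lam G ℓ : ℝ) ≠ 0 := by linarith
          have h2 : (G.edgeFinset.card : ℝ) ≠ 0 := by linarith
          field_simp
      _ ≤ Real.log n * 1 := by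
          refine mul_le_mul_of_nonneg_left ?_ (by linarith)
          rw [div_le_one (by linarith)]
          linarith
      _ = Real.log n := mul_one _
  calc growth G ℓ ^ lifetime G ℓ ≤ Real.exp x ^ lifetime G ℓ := by
        refine pow_le_pow_left₀ (zero_le_one.trans one_le_growth) ?_ _
        rw [growth, add_comm]
        exact Real.add_one_le_exp x
    _ = Real.exp (lifetime G ℓ * x) := (Real.exp_nat_mul _ _).symm
    _ ≤ Real.exp (Real.log n) := Real.exp_le_exp.2 hTx
    _ = n := Real.exp_log hn0

/-- The potential of a new table, `n ^ (-3) (2 + kap)`, is small enough for a growth by the factor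
`n`. -/
theorem failBound_le (R : Regime c G ℓ) (hℓ : 2 * lam G ℓ ≤ ℓ) :
    failBound G ℓ (lifetime G ℓ) ≤ 1 / (4 * n) := by
  have hn0 : (0 : ℝ) < n := by exact_mod_cast Nat.pos_of_neZero n
  have h1 := R.growth_pow_le hℓ
  have h2 : Real.exp (-4 * Real.log n) = 1 / (n : ℝ) ^ 4 := by
    rw [neg_mul, Real.exp_neg, ← Real.log_rpow hn0, Real.exp_log (by positivity), one_div]
    norm_cast
  have hk := kap_pos
  have h3 : 4 * (2 + kap) ≤ n := by
    linarith [R.kap_le_log, cast_ge n, hundred_le_kap]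
  rw [failBound, h2]
  calc (n : ℝ) * (1 / (n : ℝ) ^ 4) * (2 + kap) * growth G ℓ ^ lifetime G ℓ
      ≤ (n : ℝ) * (1 / (n : ℝ) ^ 4) * (n / 4) * n := by
        gcongr
        · exact pow_nonneg (zero_le_one.trans one_le_growth) _
        · linarith
    _ = 1 / (4 * (n : ℝ)) := by field_simp

theorem failsWithin_mono {ω : Coins G ℓ} {e T T' k : ℕ} {u : Fin n → ℕ} (hT : T ≤ T')
    (h : FailsWithin ω e T k u) : FailsWithin ω e T' k u := by
  induction T generalizing T' k u with
  | zero => exact h.elim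
  | succ T ih =>
    obtain ⟨T', rfl⟩ := Nat.exists_eq_add_of_le' (Nat.one_le_of_lt hT)
    exact h.imp id (ih (by omega))

/-- A new table fails in one of the next `lifetime` requests with probability at most
`1 / (4 n)`. -/
theorem measure_failsWithin_le (R : Regime c G ℓ) {T : ℕ} (hT : T ≤ lifetime G ℓ) (e k : ℕ)
    (A : Set (Coins G ℓ)) (hA : IsLocal (revealed (k + 1) e ∅) A) :
    coinMeasure G ℓ (A ∩ {ω | FailsWithin ω e T k fun _ => 0}) ≤
      coinMeasure G ℓ A * ENNReal.ofReal (1 / (4 * n)) := by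
  -- Without short walks no attempt fails; the bound for `growth` uses that `ℓ / λ` is not small.
  by_cases hℓ : 2 * lam G ℓ ≤ ℓ
  · refine (measure_mono (Set.inter_subset_inter_right A fun ω h =>
      failsWithin_mono hT h)).trans ((measure_inter_fresh_failsWithin_le R.adj R.one_le_lam
        R.visits_bound (lifetime G ℓ) k e hA).trans ?_)
    exact mul_le_mul' le_rfl (ENNReal.ofReal_le_ofReal (R.failBound_le hℓ))
  · have : A ∩ {ω | FailsWithin ω e T k fun _ => 0} = ∅ := by
      ext ω
      simp only [Set.mem_inter_iff, Set.mem_ofPred_eq, Set.mem_empty_iff_false, iff_false, not_and]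
      exact fun _ => not_failsWithin_of_lt (by omega) ω e T k _
    rw [this, measure_empty]
    exact zero_le

theorem tableBounds (R : Regime c G ℓ) : TableBounds G ℓ (lifetime G ℓ) := by
  refine ContinuousRandomWalk.tableBounds R.adj R.one_le_lifetime ?_
    (R.measure_failsWithin_le le_rfl)
  have hn : (1000 : ℝ) ≤ n := by exact_mod_cast R.n_ge
  rw [show (1 / 8 : ℝ≥0∞) = ENNReal.ofReal (1 / 8) by
    rw [ENNReal.ofReal_div_of_pos (by norm_num)]; norm_num]
  refine ENNReal.ofReal_le_ofReal ?_
  exact one_div_le_one_div_of_le (by norm_num) (by linarith)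

end Regime
end Regime

section Conclusion

variable {n : ℕ} [NeZero n] {G : SimpleGraph (Fin n)} [DecidableRel G.Adj] {ℓ : ℕ} {c : ℝ}

namespace Regime

/-! ### Amortized message complexity -/

theorem work_nonneg (R : Regime c G ℓ) : 0 ≤ work G ℓ :=
  mul_nonneg (mul_nonneg (Nat.cast_nonneg _) (Nat.cast_nonneg _)) (by linarith [R.log_ge])

theorem edges_le_work (R : Regime c G ℓ) : (G.edgeFinset.card : ℝ) ≤ work G ℓ := by
  have hm := R.edges_ge_one
  have hl : (1 : ℝ) ≤ lam G ℓ := by exact_mod_cast R.one_le_lam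
  have hL := R.log_ge
  have h1 : (G.edgeFinset.card : ℝ) ≤ lam G ℓ * G.edgeFinset.card := by nlinarith
  rw [work]
  nlinarith

theorem card_short_le (R : Regime c G ℓ) :
    (Fintype.card (Short G) : ℝ) ≤ 4 * G.edgeFinset.card * Real.log n := by
  have h1 : (Fintype.card (Short G) : ℝ) ≤ ∑ v, (Real.log n + 1) * G.degree v := by
    rw [Fintype.card_sigma]
    push_cast
    refine Finset.sum_le_sum fun v _ => ?_
    rw [Fintype.card_fin]
    exact numWalks_le R.adj (by linarith [R.n_ge]) v
  rw [← Finset.mul_sum, sum_degree_real] at h1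
  have hm := R.edges_ge_one
  nlinarith [R.log_ge]

theorem messages_preProcessing_le (R : Regime c G ℓ) (ω : Coins G ℓ) (e : ℕ) :
    (messages (preProcessing ω e) : ℝ) ≤ 20 * work G ℓ := by
  have h1 : (messages (preProcessing ω e) : ℝ) ≤
      4 * lam G ℓ * Fintype.card (Short G) + n + 2 * G.edgeFinset.card := by
    exact_mod_cast ContinuousRandomWalk.messages_preProcessing_le R.one_le_lam ω e
  have h2 := R.n_le_edges
  have h3 := R.edges_le_work
  have h4 : 4 * (lam G ℓ : ℝ) * Fintype.card (Short G) ≤ 16 * work G ℓ := by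
    refine (mul_le_mul_of_nonneg_left R.card_short_le (by positivity)).trans (le_of_eq ?_)
    rw [work]
    ring
  linarith

theorem messages_initialRounds_le (R : Regime c G ℓ) (ω : Coins G ℓ) :
    (messages (initialRounds ω) : ℝ) ≤ 26 * work G ℓ := by
  have h1 : (messages (setup G) : ℝ) ≤ 6 * G.edgeFinset.card := by
    exact_mod_cast messages_setup_le
  have h2 := R.messages_preProcessing_le ω 0
  have h3 := R.edges_le_work
  rw [initialRounds, messages_append]
  push_cast
  linarith

/-- Bound for the number of rounds of the stitching part of an attempt. -/
def stitchRounds (G : SimpleGraph (Fin n)) (ℓ : ℕ) : ℕ := ⌈√((ℓ : ℝ) * G.diam)⌉₊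

theorem stitchRounds_le (R : Regime c G ℓ) :
    (stitchRounds G ℓ : ℝ) ≤ 2 * √((ℓ : ℝ) * G.diam) := by
  have h1 := (Nat.ceil_lt_add_one (Real.sqrt_nonneg ((ℓ : ℝ) * G.diam))).le
  have h2 := R.one_le_sqrt
  rw [stitchRounds]
  linarith

/-- The stitching part takes at most `2 D ℓ / λ ≤ √(ℓ D)` rounds. -/
theorem le_stitchRounds_mul (R : Regime c G ℓ) :
    ℓ * (2 * G.diam) ≤ stitchRounds G ℓ * lam G ℓ := by
  set S := √((ℓ : ℝ) * G.diam) with hS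
  have h1 : S ≤ stitchRounds G ℓ := Nat.le_ceil _
  have h2 : 24 * S * Real.log n ≤ lam G ℓ := R.lam_ge_sqrt
  have h3 : S * S = ℓ * G.diam := Real.mul_self_sqrt (by positivity)
  have h4 : 0 ≤ S := Real.sqrt_nonneg _
  have h5 : 2 * S ≤ lam G ℓ := by nlinarith [R.log_ge]
  have h6 : (ℓ : ℝ) * (2 * G.diam) ≤ stitchRounds G ℓ * lam G ℓ := by
    calc (ℓ : ℝ) * (2 * G.diam) = S * (2 * S) := by linarith
      _ ≤ stitchRounds G ℓ * lam G ℓ := by gcongr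
  exact_mod_cast h6

theorem messages_attemptRounds_le (R : Regime c G ℓ) (ω : Coins G ℓ) (st : RunState n) :
    (messages (attemptRounds ω st) : ℝ≥0∞) ≤ ENNReal.ofReal (2 * (ℓ + G.diam)) +
      if Fails ω st then ENNReal.ofReal (22 * work G ℓ) else 0 := by
  have h1 := ContinuousRandomWalk.messages_attemptRounds_le R.conn ω st
  have h2 := length_log_le R.conn R.one_le_lam R.le_stitchRounds_mul ω st
  have h3 : ((stitchRounds G ℓ + ℓ + G.diam : ℕ) : ℝ) ≤ 2 * (ℓ + G.diam) := by
    have h4 := (Nat.ceil_lt_add_one (Real.sqrt_nonneg ((ℓ : ℝ) * G.diam))).le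
    have h5 : √((ℓ : ℝ) * G.diam) ≤ (ℓ + G.diam) / 2 := by
      rw [Real.sqrt_le_left (by positivity)]
      nlinarith [sq_nonneg ((ℓ : ℝ) - G.diam)]
    have h6 := R.add_diam_ge
    change (stitchRounds G ℓ : ℝ) ≤ _ at h4
    push_cast
    linarith
  have h4 : ∀ N : ℕ, (N : ℝ≥0∞) = ENNReal.ofReal N := fun N => (ENNReal.ofReal_natCast N).symm
  have hnn : (0 : ℝ) ≤ 2 * (ℓ + G.diam) := by positivity
  by_cases hf : Fails ω st
  · rw [if_pos hf] at h1 ⊢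
    rw [h4, ← ENNReal.ofReal_add hnn (mul_nonneg (by norm_num) R.work_nonneg)]
    refine ENNReal.ofReal_le_ofReal ?_
    have h5 : (messages (attemptRounds ω st) : ℝ) ≤ ((stitchRounds G ℓ + ℓ + G.diam : ℕ) : ℝ) +
        (2 * G.edgeFinset.card + messages (preProcessing ω (st.table + 1))) := by
      exact_mod_cast h1.trans (by omega)
    have h6 := R.messages_preProcessing_le ω (st.table + 1)
    have h7 := R.edges_le_work
    linarith
  · rw [if_neg hf] at h1 ⊢
    rw [h4, add_zero]
    refine ENNReal.ofReal_le_ofReal (le_trans ?_ h3)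
    exact_mod_cast h1.trans (by omega)

theorem totalMessages_le (R : Regime c G ℓ) (ω : Coins G ℓ) (K : ℕ) :
    totalMessages ω K ≤ ENNReal.ofReal (26 * work G ℓ + 2 * (ℓ + G.diam) * K) +
      ENNReal.ofReal (2 * (ℓ + G.diam) + 22 * work G ℓ) * failCount ω K := by
  have hW := R.work_nonneg
  have h0 : (messages (initialRounds ω) : ℝ≥0∞) ≤ ENNReal.ofReal (26 * work G ℓ) := by
    rw [← ENNReal.ofReal_natCast]
    exact ENNReal.ofReal_le_ofReal (R.messages_initialRounds_le ω)
  have h1 := ContinuousRandomWalk.totalMessages_le h0 (R.messages_attemptRounds_le ω) K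
  rwa [← ENNReal.ofReal_natCast K, ← ENNReal.ofReal_mul (by positivity),
    ← ENNReal.ofReal_add (by positivity) (by positivity),
    ← ENNReal.ofReal_add (by positivity) (by positivity)] at h1

/-- The cost of new tables, distributed to the requests between them. -/
theorem cost_div_lifetime_le (R : Regime c G ℓ) :
    (2 * (ℓ + G.diam) + 22 * work G ℓ) * (3 / lifetime G ℓ) ≤ 133 * kap * (ℓ + G.diam) := by
  have hT : (1 : ℝ) ≤ lifetime G ℓ := by exact_mod_cast R.one_le_lifetime
  have h1 := R.work_le_lifetime
  have hk := hundred_le_kap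
  have ha := R.add_diam_ge
  rw [mul_div_assoc', div_le_iff₀ (by linarith)]
  have h2 : ((ℓ : ℝ) + G.diam) * 6 ≤ kap * (ℓ + G.diam) * lifetime G ℓ := by
    have h3 : ((ℓ : ℝ) + G.diam) * 6 ≤ kap * (ℓ + G.diam) := by nlinarith
    have h4 : kap * ((ℓ : ℝ) + G.diam) ≤ kap * (ℓ + G.diam) * lifetime G ℓ :=
      le_mul_of_one_le_right (mul_nonneg kap_pos.le (by linarith)) hT
    linarith
  linarith

theorem lintegral_totalMessages_le (R : Regime c G ℓ) (K : ℕ) :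
    ∫⁻ ω, totalMessages ω K ∂(coinMeasure G ℓ) ≤
      ENNReal.ofReal (200 * kap * ((ℓ + G.diam) * K +
        lam G ℓ * G.edgeFinset.card * Real.log n)) := by
  have hW := R.work_nonneg
  have hT : (1 : ℝ) ≤ lifetime G ℓ := by exact_mod_cast R.one_le_lifetime
  have ha := R.add_diam_ge
  have hk := hundred_le_kap
  refine (lintegral_mono fun ω => R.totalMessages_le ω K).trans ?_
  rw [lintegral_add_left measurable_const, lintegral_const, measure_univ, mul_one,
    lintegral_const_mul' _ _ ENNReal.ofReal_ne_top]
  refine (add_le_add le_rfl (mul_le_mul' le_rfl (R.tableBounds.lintegral_failCount K))).trans ?_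
  rw [← ENNReal.ofReal_mul (by positivity), ← ENNReal.ofReal_add (by positivity) (by positivity)]
  refine ENNReal.ofReal_le_ofReal ?_
  change _ ≤ 200 * kap * ((ℓ + G.diam) * K + work G ℓ)
  have h1 := mul_le_mul_of_nonneg_right R.cost_div_lifetime_le (Nat.cast_nonneg (α := ℝ) K)
  have h2 := R.add_diam_le_work
  have h3 : (ℓ : ℝ) + G.diam ≤ work G ℓ := by nlinarith
  have h4 : (2 * ((ℓ : ℝ) + G.diam) + 22 * work G ℓ) * (3 * K / lifetime G ℓ + 3) =
      (2 * ((ℓ : ℝ) + G.diam) + 22 * work G ℓ) * (3 / lifetime G ℓ) * K +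
        3 * (2 * ((ℓ : ℝ) + G.diam) + 22 * work G ℓ) := by ring
  have h5 : 0 ≤ ((ℓ : ℝ) + G.diam) * K := by positivity
  have h6 : 98 * work G ℓ ≤ 200 * kap * work G ℓ := by nlinarith
  have h7 : 2 * (((ℓ : ℝ) + G.diam) * K) ≤ 67 * kap * (((ℓ : ℝ) + G.diam) * K) := by nlinarith
  rw [h4]
  linarith

theorem limsup_totalMessages_le (R : Regime c G ℓ) :
    ∀ᵐ ω ∂(coinMeasure G ℓ),
      Filter.limsup (fun K : ℕ => totalMessages ω K / (K : ℝ≥0∞)) Filter.atTop ≤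
        ENNReal.ofReal (200 * kap * (ℓ + G.diam)) := by
  have hW := R.work_nonneg
  have hT : (1 : ℝ) ≤ lifetime G ℓ := by exact_mod_cast R.one_le_lifetime
  have ha := R.add_diam_ge
  have hk := hundred_le_kap
  filter_upwards [R.tableBounds.eventually_failCount] with ω hω
  refine Filter.limsup_le_of_le (by isBoundedDefault) ?_
  filter_upwards [hω, Filter.eventually_ge_atTop ⌈50 * work G ℓ⌉₊, Filter.eventually_ge_atTop 1]
    with K h1 h2 h3
  have hK : (1 : ℝ) ≤ K := by exact_mod_cast h3
  have hKW : 50 * work G ℓ ≤ K := Nat.ceil_le.1 h2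
  rw [ENNReal.div_le_iff_le_mul (Or.inl (by simp; omega)) (Or.inl (by simp)),
    ← ENNReal.ofReal_natCast K, ← ENNReal.ofReal_mul (by positivity)]
  refine (R.totalMessages_le ω K).trans ((add_le_add le_rfl (mul_le_mul' le_rfl h1)).trans ?_)
  rw [← ENNReal.ofReal_mul (by positivity), ← ENNReal.ofReal_add (by positivity) (by positivity)]
  refine ENNReal.ofReal_le_ofReal ?_
  have h4 := mul_le_mul_of_nonneg_right R.cost_div_lifetime_le (Nat.cast_nonneg (α := ℝ) K)
  have h5 := R.add_diam_le_work
  have h6 : (ℓ : ℝ) + G.diam ≤ work G ℓ := by nlinarith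
  have h7 : (2 * ((ℓ : ℝ) + G.diam) + 22 * work G ℓ) * (3 * K / lifetime G ℓ + 1) =
      (2 * ((ℓ : ℝ) + G.diam) + 22 * work G ℓ) * (3 / lifetime G ℓ) * K +
        (2 * ((ℓ : ℝ) + G.diam) + 22 * work G ℓ) := by ring
  have h8 : (K : ℝ) ≤ ((ℓ : ℝ) + G.diam) * K := by nlinarith
  have h9 : 3 * (((ℓ : ℝ) + G.diam) * K) ≤ 67 * kap * (((ℓ : ℝ) + G.diam) * K) := by nlinarith
  rw [h7]
  linarith

/-! ### Round complexity -/

/-- Congestion that is not exceeded with high probability. -/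
def congestion (n : ℕ) : ℕ := ⌈30 * Real.log n⌉₊

/-- Union bound over the hops, of which there are at most `n ^ 6`, and the directed edges. -/
theorem measure_congested_le (R : Regime c G ℓ) (e : ℕ) :
    coinMeasure G ℓ {ω | Congested ω e (congestion n)} ≤ ENNReal.ofReal (1 / (4 * n)) := by
  refine (ContinuousRandomWalk.measure_congested_le R.adj (by linarith [R.n_ge]) e _).trans
    (ENNReal.ofReal_le_ofReal ?_)
  have hn : (1000 : ℝ) ≤ n := by exact_mod_cast R.n_ge
  have hn0 : (0 : ℝ) < n := by linarith
  have hL := R.log_ge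
  have h1 : 4 * (lam G ℓ : ℝ) ≤ (n : ℝ) ^ 6 := by
    exact_mod_cast (fieldBound_pow (by linarith [R.n_ge]) R.conn R.le_cube).length
  have h2 : (2 * G.edgeFinset.card : ℝ) ≤ 2 * (n : ℝ) ^ 2 := by
    have : (G.edgeFinset.card : ℝ) ≤ n * n := by exact_mod_cast card_edgeFinset_le
    nlinarith
  have h3 : Real.exp (Real.log n + 1) ≤ 3 * n := by
    rw [Real.exp_add, Real.exp_log hn0]
    nlinarith [Real.exp_one_lt_d9]
  -- `30 log 2 > 20`.
  have h4 : (n : ℝ) ^ 20 ≤ 2 ^ congestion n := by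
    have h5 : (30 * Real.log n) ≤ congestion n := Nat.le_ceil _
    have h6 := Real.log_two_gt_d9
    rw [← Real.log_le_log_iff (by positivity) (by positivity), Real.log_pow, Real.log_pow]
    push_cast
    nlinarith
  have hm : (0 : ℝ) ≤ 2 * G.edgeFinset.card := mul_nonneg zero_le_two (Nat.cast_nonneg _)
  calc 4 * (lam G ℓ : ℝ) * (2 * G.edgeFinset.card) *
        (Real.exp (Real.log n + 1) / 2 ^ congestion n)
      ≤ (n : ℝ) ^ 6 * (2 * (n : ℝ) ^ 2) * (3 * n / (n : ℝ) ^ 20) := by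
        gcongr
    _ = 6 / (n : ℝ) ^ 11 := by field_simp; norm_num
    _ ≤ 1 / (4 * n) := by
        rw [div_le_div_iff₀ (by positivity) (by positivity), one_mul]
        have h5 : (n : ℝ) ^ 2 ≤ (n : ℝ) ^ 11 := pow_le_pow_right₀ (by linarith) (by norm_num)
        nlinarith

theorem rounds_le (R : Regime c G ℓ) :
    ((2 * stitchRounds G ℓ + 5 * G.diam + 1 + 4 * lam G ℓ * congestion n + 2 * lam G ℓ : ℕ) : ℝ) ≤
      200 * kap * Real.log n ^ 4 * (√((ℓ : ℝ) * G.diam) + G.diam) := by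
  set S := √((ℓ : ℝ) * G.diam) with hS
  set L := Real.log n with hL
  have hL1 : 1000 ≤ L := R.log_ge
  have hS1 : 1 ≤ S := R.one_le_sqrt
  have h1 : (stitchRounds G ℓ : ℝ) ≤ 2 * S := R.stitchRounds_le
  have h2 : (lam G ℓ : ℝ) ≤ 25 * S * L ^ 3 := R.lam_le
  have h3 : (congestion n : ℝ) ≤ 31 * L := by
    have := (Nat.ceil_lt_add_one (show 0 ≤ 30 * L by linarith)).le
    rw [congestion]
    linarith
  have hD : (1 : ℝ) ≤ G.diam := by exact_mod_cast R.one_le_diam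
  have hk := hundred_le_kap
  have h4 : 4 * (lam G ℓ : ℝ) * congestion n ≤ 3100 * (L ^ 4 * S) := by
    calc 4 * (lam G ℓ : ℝ) * congestion n ≤ 4 * (25 * S * L ^ 3) * (31 * L) := by gcongr
      _ = 3100 * (L ^ 4 * S) := by ring
  have h5 : L ^ 3 * S ≤ L ^ 4 * S := by
    gcongr
    · linarith
    · norm_num
  have h6 : S ≤ L ^ 4 * S := le_mul_of_one_le_left (by linarith) (one_le_pow₀ (by linarith))
  have h7 : (G.diam : ℝ) ≤ L ^ 4 * G.diam :=
    le_mul_of_one_le_left (by linarith) (one_le_pow₀ (by linarith))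
  have h8 : 20000 * (L ^ 4 * (S + G.diam)) ≤ 200 * kap * (L ^ 4 * (S + G.diam)) := by
    have : 0 ≤ L ^ 4 * (S + G.diam) := by positivity
    nlinarith
  push_cast
  nlinarith

theorem measureReal_requestRounds_ge (R : Regime c G ℓ) (k : ℕ) :
    1 - 1 / (n : ℝ) ≤ (coinMeasure G ℓ).real {ω | requestRounds ω k ≤
      ENNReal.ofReal (200 * kap * Real.log n ^ 4 * (√((ℓ : ℝ) * G.diam) + G.diam))} := by
  set N := 2 * stitchRounds G ℓ + 5 * G.diam + 1 + 4 * lam G ℓ * congestion n + 2 * lam G ℓ with hN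
  set good := {ω : Coins G ℓ | requestRounds ω k ≤
      ENNReal.ofReal (200 * kap * Real.log n ^ 4 * (√((ℓ : ℝ) * G.diam) + G.diam))} with hgood
  have hreach : ∀ᵐ ω ∂(coinMeasure G ℓ), ∃ a, (run ω a).req = k := by
    filter_upwards [R.tableBounds.reached] with ω hω
    obtain ⟨a, ha, _⟩ := hω k
    exact ⟨a, ha⟩
  have h1 := measure_requestRounds_le R.adj R.conn R.one_le_lam R.le_stitchRounds_mul
    R.measure_congested_le (R.measure_failsWithin_le R.one_le_lifetime) hreach
  have hn0 : (0 : ℝ) < n := by exact_mod_cast Nat.pos_of_neZero n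
  have h2 : coinMeasure G ℓ goodᶜ ≤ ENNReal.ofReal (1 / n) := by
    refine (measure_mono ?_).trans (h1.trans ?_)
    · intro ω hω h
      refine hω (h.trans ?_)
      rw [← ENNReal.ofReal_natCast]
      exact ENNReal.ofReal_le_ofReal R.rounds_le
    · rw [← ENNReal.ofReal_add (by positivity) (by positivity)]
      refine ENNReal.ofReal_le_ofReal ?_
      rw [← add_div, div_le_div_iff₀ (by positivity) hn0]
      linarith
  have h3 : (coinMeasure G ℓ).real goodᶜ ≤ 1 / n :=
    ENNReal.toReal_le_of_le_ofReal (by positivity) h2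
  have h4 : (1 : ℝ) ≤ (coinMeasure G ℓ).real good + (coinMeasure G ℓ).real goodᶜ := by
    have := measureReal_union_le (μ := coinMeasure G ℓ) good goodᶜ
    rwa [Set.union_compl_self, probReal_univ] at this
  linarith

end Regime
end Conclusion
end
end ContinuousRandomWalk
theorem mainTheorem1 :
    ∃ b : ℕ, ∀ c : ℝ, 0 < c → ∃ C : ℝ, 0 < C ∧ ∃ n₀ : ℕ,
      ∀ (n : ℕ) [NeZero n] (G : SimpleGraph (Fin n)) [DecidableRel G.Adj] (ℓ : ℕ),
        n₀ ≤ n → G.Connected → 1 ≤ ℓ → (ℓ : ℝ) ≤ c * (G.edgeFinset.card : ℝ) →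
        -- all messages have O(log n) bits
        (∀ (ω : ContinuousRandomWalk.Coins G ℓ) (r : ContinuousRandomWalk.Round G)
            (d : G.Dart) (msg : ContinuousRandomWalk.Msg),
          ContinuousRandomWalk.Occurs ω r → r d = some msg →
            (msg.bits : ℝ) ≤ C * Real.log n) ∧
        -- all requests are answered, with the end of a walk of length ℓ from the source
        (∀ᵐ ω ∂(ContinuousRandomWalk.coinMeasure G ℓ), ∀ k : ℕ,
          ∃! v : Fin n, ContinuousRandomWalk.Answers ω k v) ∧
        (∀ (ω : ContinuousRandomWalk.Coins G ℓ) (k : ℕ) (v : Fin n),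
          ContinuousRandomWalk.Answers ω k v →
            ∃ p : G.Walk (ContinuousRandomWalk.source ω k) v, p.length = ℓ) ∧
        -- the answer is a sample of the walk distribution, up to the event of a failed attempt
        (∀ (k : ℕ) (s v : Fin n),
          |(ContinuousRandomWalk.coinMeasure G ℓ).real
              {ω | ContinuousRandomWalk.source ω k = s ∧ ContinuousRandomWalk.Answers ω k v} -
            (ContinuousRandomWalk.coinMeasure G ℓ).real
              {ω | ContinuousRandomWalk.source ω k = s} *
                (ContinuousRandomWalk.transition G ^ ℓ) s v| ≤
          (ContinuousRandomWalk.coinMeasure G ℓ).real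
            {ω | ContinuousRandomWalk.source ω k = s ∧ ContinuousRandomWalk.Rebuilds ω k}) ∧
        -- amortized message complexity, in expectation and almost surely in the long run
        (∀ K : ℕ,
          ∫⁻ ω, ContinuousRandomWalk.totalMessages ω K ∂(ContinuousRandomWalk.coinMeasure G ℓ) ≤
            ENNReal.ofReal (C * (((ℓ : ℝ) + G.diam) * K +
              ContinuousRandomWalk.lam G ℓ * G.edgeFinset.card * Real.log n))) ∧
        (∀ᵐ ω ∂(ContinuousRandomWalk.coinMeasure G ℓ),
          Filter.limsup (fun K : ℕ => ContinuousRandomWalk.totalMessages ω K / (K : ℝ≥0∞))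
            Filter.atTop ≤ ENNReal.ofReal (C * ((ℓ : ℝ) + G.diam))) ∧
        -- round complexity of every single request, with high probability
        (∀ k : ℕ,
          1 - 1 / (n : ℝ) ≤ (ContinuousRandomWalk.coinMeasure G ℓ).real
            {ω | ContinuousRandomWalk.requestRounds ω k ≤
              ENNReal.ofReal (C * Real.log n ^ b *
                (√((ℓ : ℝ) * G.diam) + G.diam))}) := by
  refine ⟨4, fun c hc => ⟨200 * ContinuousRandomWalk.kap,
    mul_pos (by norm_num) ContinuousRandomWalk.kap_pos,
    ⌈Real.exp (ContinuousRandomWalk.kap * (10 + c))⌉₊, ?_⟩⟩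
  intro n _ G _ ℓ hn hconn hℓ hℓm
  have R : ContinuousRandomWalk.Regime c G ℓ := by
    refine ⟨hc, hconn, hℓ, hℓm, ?_⟩
    rw [Real.le_log_iff_exp_le (by exact_mod_cast Nat.pos_of_neZero n)]
    exact Nat.ceil_le.1 hn
  refine ⟨fun ω r d msg hr hmsg => ?_, ?_, fun ω k v h => ?_, fun k s v => ?_,
    R.lintegral_totalMessages_le, R.limsup_totalMessages_le, R.measureReal_requestRounds_ge⟩
  · refine (ContinuousRandomWalk.bits_le (by linarith [R.n_ge]) hconn R.le_cube R.one_le_lam hr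
      hmsg).trans (mul_le_mul_of_nonneg_right ?_ (by linarith [R.log_ge]))
    linarith [ContinuousRandomWalk.Regime.hundred_le_kap]
  · filter_upwards [R.tableBounds.reached] with ω hω k
    exact ContinuousRandomWalk.existsUnique_answers (hω k)
  · exact ContinuousRandomWalk.exists_walk_of_answers R.adj R.one_le_lam h
  · refine ContinuousRandomWalk.answers_law R.adj R.one_le_lam ?_ s v
    filter_upwards [R.tableBounds.reached] with ω hω
    obtain ⟨a, ha, _⟩ := hω k
    exact ⟨a, ha⟩
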